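/- Let $G$ be a finite simple graph with vertex set $V$ and $m$ edges. For a bijection $f\colon E(G)\to\{1,2,\dots,m\}$ and $x\in V$ put $\phi_f(x)=\sum_{e\ni x} f(e)$, the sum over the edges $e$ of $G$ incident to $x$. Such an $f$ is a strongly antimagic labeling of $G$ if $\phi_f(u)\neq\phi_f(v)$ for all distinct $u,v\in V$, and $\phi_f(u)>\phi_f(v)$ for all $u,v\in V$ with $\deg(u)>\deg(v)$. The graph $G$ is strongly antimagic if it admits a strongly antimagic labeling. A double spider is a finite tree with exactly two vertices of degree greater than $2$. Every double spider is strongly antimagic. -/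

import Mathlib

namespace SimpleGraph

variable {V : Type*} [Fintype V] [DecidableEq V] (G : SimpleGraph V) [DecidableRel G.Adj]

/-- The vertex sum `φ_f(v)`: the sum of the labels of the edges incident to `v`. Only the values
of `f` on edges of `G` matter. -/
def vertexSum (f : Sym2 V → ℕ) (v : V) : ℕ :=
  ∑ e ∈ G.incidenceFinset v, f e

/-- An antimagic labeling: a bijection from the edges of `G` onto `{1, …, m}`, where `m` is the
number of edges, such that distinct vertices have distinct vertex sums. -/
def IsAntimagicLabeling (f : Sym2 V → ℕ) : Prop :=
  Set.BijOn f G.edgeSet (Set.Icc 1 G.edgeFinset.card) ∧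
    ∀ u v : V, u ≠ v → G.vertexSum f u ≠ G.vertexSum f v

/-- A strongly antimagic labeling: an antimagic labeling in which a vertex of larger degree has a
larger vertex sum. -/
def IsStronglyAntimagicLabeling (f : Sym2 V → ℕ) : Prop :=
  G.IsAntimagicLabeling f ∧
    ∀ u v : V, G.degree v < G.degree u → G.vertexSum f v < G.vertexSum f u

/-- A graph is strongly antimagic if it admits a strongly antimagic labeling. -/
def IsStronglyAntimagic : Prop :=
  ∃ f : Sym2 V → ℕ, G.IsStronglyAntimagicLabeling f

/-- A double spider: a tree with exactly two vertices of degree greater than two. -/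
def IsDoubleSpider : Prop :=
  G.IsTree ∧ (Finset.univ.filter fun v : V => 2 < G.degree v).card = 2

end SimpleGraph

/-! Let `u` and `v` be the branch vertices. A labeling is recorded as the lists of labels along the
legs and along the path from `u` to `v` (`Labeling`). The vertex sums are then the last labels of
the legs (leaves), the sums of two consecutive labels (degree two), and the sums of the labels next
to `u` and next to `v`. It suffices that the sums at degree two are distinct, lie above all leaf
labels and below both branch sums, and that the branch sums differ, with the larger one at the
vertex of larger degree. So a `Plain` labeling is sought when `u` has more legs than `v`, and a
`Balanced` one when the numbers agree.

Labelings are grown by induction on the leg lengths. Given a threshold `τ`, `shift` opens a gap of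
size `α` below the labels up to `τ` and a gap of size `δ` just above them. A sum at degree two then
grows by `2 * α` plus `δ` times the number of its entries above `τ`. Hence these sums stay distinct
if pairs with more large entries already have larger sums, which is the field `cls`. The gaps are
filled by a new leg on which low and high labels alternate: its sums are consecutive integers
(`map_psum_pairs_alt`), and they lie below all old sums when every old pair has a large entry. In
this way an `Insertable` labeling admits any new leg at `u` (`HasInsertable.addU`) and, if `u` has
at least two more legs than `v`, an odd one at `v` (`HasInsertable.addV`). The bound on the number
of large labels at `v` keeps the sum at `v` below that at `u`. A `1`-leg at `u` together with a
`2`-leg at `v` can be added to any plain labeling (`HasPlain.add_one_two`), but this creates a pair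
without large entry, so the result is only plain.

If no leg is a single edge, all pendant edges are cut off and restored with the labels `1, …, k`, in
the order of the labels at the cut ends (`HasPlain.extend`, `HasBalanced.extend`). In the balanced
case with a pendant edge at `v` and at least three legs there, this edge is removed, and the plain
result applies to the rest (`HasPlain.balance`).

The remaining base cases are three legs at `u` and two at `v`, two legs at each, and arbitrarily
many legs at `v` that are all even. They are labeled by alternating paths that use up the small and
the large labels in increasing order, so that the consecutive sums increase from path to path
(`build`). A few tiny spiders get explicit labelings.

Finally, a double spider is cut into a path from `u` to `v` and legs by growing legs as long as a
vertex is missing (`IsDecomp.exists_spanning`), and any `Labeling` with the right lengths comes from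
a function on its edges (`IsDecomp.exists_labelingOf_eq`). -/

namespace DoubleSpider

/-! ### Labelings as lists of labels -/

/-- The pairs of consecutive entries of a list. -/
def pairs : List ℕ → List (ℕ × ℕ)
  | [] => []
  | [_] => []
  | a :: b :: l => (a, b) :: pairs (b :: l)

@[simp] lemma pairs_nil : pairs [] = [] := rfl
@[simp] lemma pairs_singleton (a : ℕ) : pairs [a] = [] := rfl
@[simp] lemma pairs_cons_cons (a b : ℕ) (l : List ℕ) :
    pairs (a :: b :: l) = (a, b) :: pairs (b :: l) := rfl

lemma pairs_cons (a : ℕ) {l : List ℕ} (h : l ≠ []) :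
    pairs (a :: l) = (a, l.headD 0) :: pairs l := by
  cases l with
  | nil => exact absurd rfl h
  | cons b l => rfl

lemma pairs_map (f : ℕ → ℕ) (l : List ℕ) :
    pairs (l.map f) = (pairs l).map (Prod.map f f) := by
  induction l with
  | nil => rfl
  | cons a l ih =>
    cases l with
    | nil => rfl
    | cons b l => simpa using ih

lemma pairs_concat {l : List ℕ} (h : l ≠ []) (a : ℕ) :
    pairs (l ++ [a]) = pairs l ++ [(l.getLastD 0, a)] := by
  induction l with
  | nil => exact absurd rfl h
  | cons b l ih =>
    cases l with
    | nil => rfl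
    | cons c l => simpa using ih (by simp)

lemma pairs_reverse (l : List ℕ) :
    (pairs l.reverse : Multiset (ℕ × ℕ)) = (pairs l : Multiset (ℕ × ℕ)).map Prod.swap := by
  induction l with
  | nil => rfl
  | cons a l ih =>
    cases l with
    | nil => rfl
    | cons b l =>
      rw [List.reverse_cons, pairs_concat (by simp), ← Multiset.coe_add, ih]
      rw [pairs_cons_cons, ← Multiset.cons_coe (a, b), Multiset.map_cons, add_comm]
      simp

lemma headD_map (f : ℕ → ℕ) {l : List ℕ} (h : l ≠ []) :
    (l.map f).headD 0 = f (l.headD 0) := by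
  cases l with
  | nil => exact absurd rfl h
  | cons b l => rfl

lemma getLastD_map (f : ℕ → ℕ) {l : List ℕ} (h : l ≠ []) :
    (l.map f).getLastD 0 = f (l.getLastD 0) := by
  rw [List.getLastD_eq_getLast?, List.getLastD_eq_getLast?, List.getLast?_map,
    List.getLast?_eq_some_getLast h]
  rfl

lemma headD_mem {l : List ℕ} (h : l ≠ []) : l.headD 0 ∈ l := by
  cases l with
  | nil => exact absurd rfl h
  | cons b l => simp

lemma getLastD_mem {l : List ℕ} (h : l ≠ []) : l.getLastD 0 ∈ l := by
  rw [List.getLastD_eq_getLast?, List.getLast?_eq_some_getLast h]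
  exact List.getLast_mem h

/-- Edge labels on a double spider with branch vertices `u` and `v`: the legs at `u`, the legs at
`v` (each read from the branch vertex to the leaf), and the path from `u` to `v`. -/
structure Labeling where
  /-- the legs at `u` -/
  A : Multiset (List ℕ)
  /-- the legs at `v` -/
  B : Multiset (List ℕ)
  /-- the path from `u` to `v` -/
  C : List ℕ

namespace Labeling

/-- All labels. -/
def labels (D : Labeling) : Multiset ℕ :=
  D.A.bind (fun l => (l : Multiset ℕ)) + D.B.bind (fun l => (l : Multiset ℕ)) + (D.C : Multiset ℕ)

/-- The pairs of labels at the vertices of degree two. -/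
def inner (D : Labeling) : Multiset (ℕ × ℕ) :=
  D.A.bind (fun l => (pairs l : Multiset (ℕ × ℕ))) +
    D.B.bind (fun l => (pairs l : Multiset (ℕ × ℕ))) + (pairs D.C : Multiset (ℕ × ℕ))

/-- The labels of the pendant edges. -/
def leaves (D : Labeling) : Multiset ℕ :=
  D.A.map (fun l => l.getLastD 0) + D.B.map (fun l => l.getLastD 0)

/-- The labels at `u`. -/
def edgesU (D : Labeling) : Multiset ℕ := D.C.headD 0 ::ₘ D.A.map (fun l => l.headD 0)

/-- The labels at `v`. -/
def edgesV (D : Labeling) : Multiset ℕ := D.C.getLastD 0 ::ₘ D.B.map (fun l => l.headD 0)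

/-- No leg is empty, and neither is the path between the branch vertices. -/
def WF (D : Labeling) : Prop := D.C ≠ [] ∧ (∀ l ∈ D.A, l ≠ []) ∧ ∀ l ∈ D.B, l ≠ []

/-- Relabel. -/
def map (f : ℕ → ℕ) (D : Labeling) : Labeling :=
  ⟨D.A.map (List.map f), D.B.map (List.map f), D.C.map f⟩

/-- Attach a leg at `u`. -/
def addU (D : Labeling) (l : List ℕ) : Labeling := ⟨l ::ₘ D.A, D.B, D.C⟩

/-- Attach a leg at `v`. -/
def addV (D : Labeling) (l : List ℕ) : Labeling := ⟨D.A, l ::ₘ D.B, D.C⟩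

@[simp] lemma labels_map (f : ℕ → ℕ) (D : Labeling) : (D.map f).labels = D.labels.map f := by
  simp [labels, map, Multiset.bind_map, Multiset.map_bind]

@[simp] lemma inner_map (f : ℕ → ℕ) (D : Labeling) :
    (D.map f).inner = D.inner.map (Prod.map f f) := by
  simp [inner, map, Multiset.bind_map, Multiset.map_bind, pairs_map]

lemma leaves_map (f : ℕ → ℕ) {D : Labeling} (h : D.WF) :
    (D.map f).leaves = D.leaves.map f := by
  simp only [leaves, map, Multiset.map_add, Multiset.map_map]
  congr 1
  · exact Multiset.map_congr rfl fun l hl => getLastD_map f (h.2.1 l hl)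
  · exact Multiset.map_congr rfl fun l hl => getLastD_map f (h.2.2 l hl)

lemma edgesU_map (f : ℕ → ℕ) {D : Labeling} (h : D.WF) :
    (D.map f).edgesU = D.edgesU.map f := by
  simp only [edgesU, map, Multiset.map_cons, Multiset.map_map, headD_map f h.1]
  congr 1
  exact Multiset.map_congr rfl fun l hl => headD_map f (h.2.1 l hl)

lemma edgesV_map (f : ℕ → ℕ) {D : Labeling} (h : D.WF) :
    (D.map f).edgesV = D.edgesV.map f := by
  simp only [edgesV, map, Multiset.map_cons, Multiset.map_map, getLastD_map f h.1]
  congr 1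
  exact Multiset.map_congr rfl fun l hl => headD_map f (h.2.2 l hl)

lemma WF.map {D : Labeling} (h : D.WF) (f : ℕ → ℕ) : (D.map f).WF := by
  refine ⟨by simpa [Labeling.map] using h.1, ?_, ?_⟩ <;> intro l hl <;>
    obtain ⟨l', hl', rfl⟩ := Multiset.mem_map.1 hl
  · simpa using h.2.1 l' hl'
  · simpa using h.2.2 l' hl'

lemma WF.addU {D : Labeling} (h : D.WF) {l : List ℕ} (hl : l ≠ []) : (D.addU l).WF :=
  ⟨h.1, by simpa [Labeling.addU] using ⟨hl, h.2.1⟩, h.2.2⟩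

lemma WF.addV {D : Labeling} (h : D.WF) {l : List ℕ} (hl : l ≠ []) : (D.addV l).WF :=
  ⟨h.1, h.2.1, by simpa [Labeling.addV] using ⟨hl, h.2.2⟩⟩

section simp_lemmas

variable (D : Labeling) (l : List ℕ)

@[simp] lemma labels_addU : (D.addU l).labels = l + D.labels := by
  simp [labels, addU, add_assoc]

@[simp] lemma labels_addV : (D.addV l).labels = l + D.labels := by
  simp [labels, addV, add_left_comm, add_assoc]

@[simp] lemma inner_addU : (D.addU l).inner = pairs l + D.inner := by
  simp [inner, addU, add_assoc]

@[simp] lemma inner_addV : (D.addV l).inner = pairs l + D.inner := by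
  simp [inner, addV, add_left_comm, add_assoc]

@[simp] lemma leaves_addU : (D.addU l).leaves = l.getLastD 0 ::ₘ D.leaves := by
  simp [leaves, addU]

@[simp] lemma leaves_addV : (D.addV l).leaves = l.getLastD 0 ::ₘ D.leaves := by
  simp [leaves, addV]

@[simp] lemma edgesU_addU : (D.addU l).edgesU = l.headD 0 ::ₘ D.edgesU := by
  simp [edgesU, addU, Multiset.cons_swap]

@[simp] lemma edgesV_addV : (D.addV l).edgesV = l.headD 0 ::ₘ D.edgesV := by
  simp [edgesV, addV, Multiset.cons_swap]

@[simp] lemma edgesU_addV : (D.addV l).edgesU = D.edgesU := rfl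

@[simp] lemma edgesV_addU : (D.addU l).edgesV = D.edgesV := rfl

end simp_lemmas

lemma map_getLastD_le {A : Multiset (List ℕ)} (h : ∀ l ∈ A, l ≠ []) :
    A.map (fun l => l.getLastD 0) ≤ A.bind (fun l => (l : Multiset ℕ)) := by
  induction A using Multiset.induction_on with
  | empty => simp
  | cons a A ih =>
    rw [Multiset.map_cons, Multiset.cons_bind, ← Multiset.singleton_add]
    refine add_le_add ?_ (ih fun l hl => h l (Multiset.mem_cons_of_mem hl))
    rw [Multiset.singleton_le]
    exact getLastD_mem (h a (Multiset.mem_cons_self a A))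

/-- Different legs use different edges. Once all labels are distinct, this makes the leaf sums
distinct. -/
lemma leaves_le_labels {D : Labeling} (h : D.WF) : D.leaves ≤ D.labels :=
  (add_le_add (map_getLastD_le h.2.1) (map_getLastD_le h.2.2)).trans (Multiset.le_add_right _ _)

end Labeling

/-! ### Thresholds, and shifts that make room for new labels -/

/-- The multiset is `{1, …, k}` with `k` its size. -/
def Full (M : Multiset ℕ) : Prop := ∀ x, 1 ≤ x → x ≤ M.card → x ∈ M

lemma Full.eq {M : Multiset ℕ} (h : Full M) : M = (Finset.Icc 1 M.card).val := by
  symm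
  apply Multiset.eq_of_le_of_card_le
  · rw [Multiset.le_iff_subset (Finset.nodup _)]
    intro x hx
    simp only [Finset.mem_val, Finset.mem_Icc] at hx
    exact h x hx.1 hx.2
  · simp

lemma Full.nodup {M : Multiset ℕ} (h : Full M) : M.Nodup := by
  rw [h.eq]; exact Finset.nodup _

lemma Full.mem_iff {M : Multiset ℕ} (h : Full M) {x : ℕ} : x ∈ M ↔ 1 ≤ x ∧ x ≤ M.card := by
  refine ⟨fun hx => ?_, fun hx => h x hx.1 hx.2⟩
  rw [h.eq] at hx
  simpa using hx

/-- The number of entries of a pair that exceed `τ`. -/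
def big (τ : ℕ) (p : ℕ × ℕ) : ℕ := (if τ < p.1 then 1 else 0) + if τ < p.2 then 1 else 0

/-- The sum of a pair. -/
def psum (p : ℕ × ℕ) : ℕ := p.1 + p.2

/-- Move up by `α` the numbers up to `τ`, and by `α + δ` the larger ones. -/
def shift (τ α δ x : ℕ) : ℕ := if x ≤ τ then x + α else x + α + δ

lemma shift_of_le {τ α δ x : ℕ} (h : x ≤ τ) : shift τ α δ x = x + α := if_pos h

lemma shift_of_lt {τ α δ x : ℕ} (h : τ < x) : shift τ α δ x = x + α + δ := if_neg (by omega)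

/-- The increase depends only on the number of large entries, so pairs in the same class keep their
differences. -/
lemma psum_shift (τ α δ : ℕ) (p : ℕ × ℕ) :
    psum (Prod.map (shift τ α δ) (shift τ α δ) p) = psum p + 2 * α + δ * big τ p := by
  simp only [psum, Prod.map, shift, big]
  split_ifs <;> omega

/-- No shifted label lies in the gap above `τ + α`, so any threshold in this gap separates the old
labels as `τ` did. The choice of `τ'` decides only whether the new labels in the gap count as small
or as large. -/
lemma big_shift {τ τ' α δ : ℕ} (h1 : τ + α ≤ τ') (h2 : τ' ≤ τ + α + δ) (p : ℕ × ℕ) :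
    big τ' (Prod.map (shift τ α δ) (shift τ α δ) p) = big τ p := by
  simp only [Prod.map, shift, big]
  split_ifs <;> omega

lemma lt_shift_iff {τ τ' α δ : ℕ} (h1 : τ + α ≤ τ') (h2 : τ' ≤ τ + α + δ) (x : ℕ) :
    τ' < shift τ α δ x ↔ τ < x := by
  simp only [shift]
  split_ifs <;> omega

lemma sum_map_shift (τ α δ : ℕ) (M : Multiset ℕ) :
    (M.map (shift τ α δ)).sum = M.sum + α * M.card + δ * M.countP (τ < ·) := by
  induction M using Multiset.induction_on with
  | empty => simp
  | cons a M ih =>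
    simp only [Multiset.map_cons, Multiset.sum_cons, ih, Multiset.card_cons,
      Multiset.countP_cons, shift]
    split_ifs <;> (try omega) <;> ring_nf

lemma countP_map_shift {τ τ' α δ : ℕ} (h1 : τ + α ≤ τ') (h2 : τ' ≤ τ + α + δ) (M : Multiset ℕ) :
    (M.map (shift τ α δ)).countP (τ' < ·) = M.countP (τ < ·) := by
  induction M using Multiset.induction_on with
  | empty => simp
  | cons a M ih =>
    simp only [Multiset.map_cons, ih, Multiset.countP_cons, lt_shift_iff h1 h2]

/-! ### The invariants of the inductions -/

/-- Labelings for double spiders with more legs at `u` than at `v`. -/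
structure Plain (τ : ℕ) (D : Labeling) : Prop where
  wf : D.WF
  full : Full D.labels
  le : τ ≤ D.labels.card
  nodup : (D.inner.map psum).Nodup
  cls : ∀ p ∈ D.inner, ∀ q ∈ D.inner, big τ p < big τ q → psum p < psum q
  leaf : ∀ x ∈ D.leaves, x ≤ τ
  low : ∀ p ∈ D.inner, τ < psum p
  lowV : τ < D.edgesV.sum
  high : ∀ p ∈ D.inner, psum p < D.edgesV.sum
  lt : D.edgesV.sum < D.edgesU.sum
  -- The constant is the slack in `HasPlain.add_one_two`: with `α = 2` and `δ = 1`, the additional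
  -- edge at `u` gains `2`, the new label at `u` is `2`, and the new label at `v` is `1`.
  count : D.edgesV.countP (τ < ·) ≤ D.edgesU.countP (τ < ·) + 3

/-- A labeling as in `Plain` into which legs can be inserted. -/
structure Insertable (τ : ℕ) (D : Labeling) : Prop extends Plain τ D where
  -- This lifts every old sum by at least `2 * α + δ`, past the sums on an inserted alternating leg.
  big_pos : ∀ p ∈ D.inner, 1 ≤ big τ p
  count_pos : 1 ≤ D.edgesV.countP (τ < ·)
  -- Each excess large label at `v` costs `δ = k` when a leg is inserted. The other terms pay for `2
  -- * k`.
  count_le : D.edgesV.countP (τ < ·) ≤ D.edgesU.countP (τ < ·) + 2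

/-- Labelings for double spiders with equally many legs at `u` and `v`. -/
structure Balanced (D : Labeling) : Prop where
  wf : D.WF
  full : Full D.labels
  nodup : (D.inner.map psum).Nodup
  leaf : ∀ x ∈ D.leaves, ∀ p ∈ D.inner, x < psum p
  leafU : ∀ x ∈ D.leaves, x < D.edgesU.sum
  leafV : ∀ x ∈ D.leaves, x < D.edgesV.sum
  highU : ∀ p ∈ D.inner, psum p < D.edgesU.sum
  highV : ∀ p ∈ D.inner, psum p < D.edgesV.sum
  ne : D.edgesU.sum ≠ D.edgesV.sum

/-! ### Alternating lists -/

/-- The list `a, b, a + 1, b + 1, …` of length `n`. -/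
def alt (a b : ℕ) : ℕ → List ℕ
  | 0 => []
  | n + 1 => a :: alt b (a + 1) n

@[simp] lemma alt_zero (a b : ℕ) : alt a b 0 = [] := rfl

lemma alt_succ (a b n : ℕ) : alt a b (n + 1) = a :: alt b (a + 1) n := rfl

@[simp] lemma length_alt (a b n : ℕ) : (alt a b n).length = n := by
  induction n generalizing a b with
  | zero => rfl
  | succ n ih => simp [alt_succ, ih]

lemma alt_ne_nil {a b n : ℕ} (h : 0 < n) : alt a b n ≠ [] := by
  rw [← List.length_pos_iff]; simpa

lemma mem_alt {a b n x : ℕ} :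
    x ∈ alt a b n ↔ (a ≤ x ∧ x < a + (n + 1) / 2) ∨ (b ≤ x ∧ x < b + n / 2) := by
  induction n generalizing a b with
  | zero => simp
  | succ n ih =>
    rw [alt_succ, List.mem_cons, ih]
    omega

lemma headD_alt {a b n : ℕ} (h : 0 < n) : (alt a b n).headD 0 = a := by
  cases n with
  | zero => omega
  | succ n => rfl

lemma getLastD_alt_odd (a b n : ℕ) : (alt a b (2 * n + 1)).getLastD 0 = a + n := by
  induction n generalizing a b with
  | zero => rfl
  | succ n ih =>
    have := ih (a + 1) (b + 1)
    rw [show 2 * (n + 1) + 1 = 2 * n + 1 + 1 + 1 by ring, alt_succ, alt_succ]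
    rw [alt_succ] at this ⊢
    simpa [add_assoc, add_comm, add_left_comm] using this

lemma getLastD_alt_even (a b n : ℕ) : (alt a b (2 * n + 2)).getLastD 0 = b + n := by
  have := getLastD_alt_odd b (a + 1) n
  rw [alt_succ] at this ⊢
  rw [alt_succ]
  simpa using this

/-- Each step replaces the smaller of two labels of one kind by its successor, so the sum goes up by
one. This is why alternating paths are used throughout. -/
lemma map_psum_pairs_alt (a b n : ℕ) :
    (pairs (alt a b (n + 1))).map psum = List.range' (a + b) n := by
  induction n generalizing a b with
  | zero => rfl
  | succ n ih =>
    have := ih b (a + 1)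
    rw [alt_succ, alt_succ, pairs_cons_cons, ← alt_succ, List.map_cons, this, List.range'_succ]
    congr 2
    ring

lemma of_mem_pairs_alt {a b n : ℕ} {p : ℕ × ℕ} (h : p ∈ pairs (alt a b n)) :
    (a ≤ p.1 ∧ p.1 < a + (n + 1) / 2 ∧ b ≤ p.2 ∧ p.2 < b + n / 2) ∨
      (b ≤ p.1 ∧ p.1 < b + n / 2 ∧ a ≤ p.2 ∧ p.2 < a + (n + 1) / 2) := by
  induction n generalizing a b with
  | zero => simp at h
  | succ n ih =>
    cases n with
    | zero => simp [alt_succ] at h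
    | succ n =>
      rw [alt_succ, alt_succ, pairs_cons_cons, ← alt_succ, List.mem_cons] at h
      rcases h with rfl | h
      · left; simp only; omega
      · have := ih h; omega

lemma psum_swap (p : ℕ × ℕ) : psum p.swap = psum p := add_comm _ _

lemma big_swap (τ : ℕ) (p : ℕ × ℕ) : big τ p.swap = big τ p := add_comm _ _

lemma map_psum_pairs_reverse (l : List ℕ) :
    (pairs l.reverse : Multiset (ℕ × ℕ)).map psum = (pairs l : Multiset (ℕ × ℕ)).map psum := by
  rw [pairs_reverse, Multiset.map_map]
  exact Multiset.map_congr rfl fun p _ => psum_swap p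

lemma mem_pairs_reverse {l : List ℕ} {p : ℕ × ℕ} : p ∈ pairs l.reverse ↔ p.swap ∈ pairs l := by
  rw [← Multiset.mem_coe, pairs_reverse, Multiset.mem_map]
  constructor
  · rintro ⟨q, hq, rfl⟩; simpa using hq
  · intro h; exact ⟨p.swap, h, by simp⟩

lemma headD_reverse (l : List ℕ) : l.reverse.headD 0 = l.getLastD 0 := by
  rw [List.headD_eq_head?_getD, List.getLastD_eq_getLast?, List.head?_reverse]

lemma getLastD_reverse (l : List ℕ) : l.reverse.getLastD 0 = l.headD 0 := by
  rw [← headD_reverse, List.reverse_reverse]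

/-! ### Behavior of the invariants under shifting and attaching -/

section shift

variable {I : Multiset (ℕ × ℕ)} {τ τ' α δ : ℕ}

lemma psum_shift_lt (δ : ℕ) {p q : ℕ × ℕ} (hb : big τ p ≤ big τ q) (hs : psum p < psum q) :
    psum (Prod.map (shift τ α δ) (shift τ α δ) p) <
      psum (Prod.map (shift τ α δ) (shift τ α δ) q) := by
  rw [psum_shift, psum_shift]
  have := Nat.mul_le_mul_left δ hb
  omega

/-- Within a class the sums move by the same amount. Between classes the one with more large entries
was ahead and moves at least as far. -/
lemma nodup_shift (hI : (I.map psum).Nodup)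
    (hc : ∀ p ∈ I, ∀ q ∈ I, big τ p < big τ q → psum p < psum q) :
    ((I.map (Prod.map (shift τ α δ) (shift τ α δ))).map psum).Nodup := by
  rw [Multiset.map_map]
  refine Multiset.Nodup.map_on (fun p hp q hq h => ?_) (Multiset.Nodup.of_map _ hI)
  refine Multiset.inj_on_of_nodup_map hI p hp q hq ?_
  simp only [Function.comp] at h
  rcases lt_trichotomy (big τ p) (big τ q) with hb | hb | hb
  · exact absurd h (psum_shift_lt δ hb.le (hc p hp q hq hb)).ne
  · rw [psum_shift, psum_shift, hb] at h
    omega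
  · exact absurd h (psum_shift_lt δ hb.le (hc q hq p hp hb)).ne'

lemma nodup_attach {N : Multiset (ℕ × ℕ)} (hN : (N.map psum).Nodup) (hI : (I.map psum).Nodup)
    (hlt : ∀ n ∈ N, ∀ p ∈ I, psum n < psum p) : ((N + I).map psum).Nodup := by
  rw [Multiset.map_add, Multiset.nodup_add]
  refine ⟨hN, hI, Multiset.disjoint_left.2 fun {x} hx hy => ?_⟩
  obtain ⟨n, hn, rfl⟩ := Multiset.mem_map.1 hx
  obtain ⟨p, hp, h⟩ := Multiset.mem_map.1 hy
  exact absurd h (hlt n hn p hp).ne'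

/-- New pairs with smaller sums are harmless as long as they have no more large entries than the old
ones. -/
lemma cls_attach {N : Multiset (ℕ × ℕ)}
    (hN : ∀ n ∈ N, ∀ n' ∈ N, big τ n < big τ n' → psum n < psum n')
    (hI : ∀ p ∈ I, ∀ q ∈ I, big τ p < big τ q → psum p < psum q)
    (hb : ∀ n ∈ N, ∀ p ∈ I, big τ n ≤ big τ p)
    (hlt : ∀ n ∈ N, ∀ p ∈ I, psum n < psum p) :
    ∀ p ∈ N + I, ∀ q ∈ N + I, big τ p < big τ q → psum p < psum q := by
  intro p hp q hq h
  rcases Multiset.mem_add.1 hp with hp | hp <;> rcases Multiset.mem_add.1 hq with hq | hq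
  · exact hN p hp q hq h
  · exact hlt p hp q hq
  · exact absurd (hb q hq p hp) (by omega)
  · exact hI p hp q hq h

lemma cls_shift (h1 : τ + α ≤ τ') (h2 : τ' ≤ τ + α + δ)
    (hc : ∀ p ∈ I, ∀ q ∈ I, big τ p < big τ q → psum p < psum q) :
    ∀ p ∈ I.map (Prod.map (shift τ α δ) (shift τ α δ)),
      ∀ q ∈ I.map (Prod.map (shift τ α δ) (shift τ α δ)), big τ' p < big τ' q →
        psum p < psum q := by
  intro p hp q hq h
  obtain ⟨p', hp', rfl⟩ := Multiset.mem_map.1 hp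
  obtain ⟨q', hq', rfl⟩ := Multiset.mem_map.1 hq
  rw [big_shift h1 h2, big_shift h1 h2] at h
  exact psum_shift_lt δ h.le (hc p' hp' q' hq' h)

/-- The new labels fill exactly the two gaps `1, …, α` and `τ + α + 1, …, τ + α + δ`. -/
lemma Full.shift {M N : Multiset ℕ} (hM : Full M) (hτ : τ ≤ M.card) (hN : N.card = α + δ)
    (h1 : ∀ x, 1 ≤ x → x ≤ α → x ∈ N) (h2 : ∀ x, τ + α < x → x ≤ τ + α + δ → x ∈ N) :
    Full (N + M.map (shift τ α δ)) := by
  intro x hx hx'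
  rw [Multiset.card_add, Multiset.card_map] at hx'
  rw [Multiset.mem_add, Multiset.mem_map]
  rcases le_or_gt x α with h | h
  · exact Or.inl (h1 x hx h)
  rcases le_or_gt x (τ + α) with h' | h'
  · exact Or.inr ⟨x - α, hM _ (by omega) (by omega), by rw [shift_of_le] <;> omega⟩
  rcases le_or_gt x (τ + α + δ) with h'' | h''
  · exact Or.inl (h2 x h' h'')
  · exact Or.inr ⟨x - α - δ, hM _ (by omega) (by omega), by rw [shift_of_lt] <;> omega⟩

end shift

/-! ### Shapes, and the insertion of single legs -/

/-- The numbers of edges in the legs at `u`, in those at `v`, and between `u` and `v`. -/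
def Shape (D : Labeling) (U V : Multiset ℕ) (l : ℕ) : Prop :=
  D.A.map List.length = U ∧ D.B.map List.length = V ∧ D.C.length = l

def HasPlain (U V : Multiset ℕ) (l : ℕ) : Prop := ∃ τ D, Plain τ D ∧ Shape D U V l

def HasInsertable (U V : Multiset ℕ) (l : ℕ) : Prop := ∃ τ D, Insertable τ D ∧ Shape D U V l

def HasBalanced (U V : Multiset ℕ) (l : ℕ) : Prop := ∃ D, Balanced D ∧ Shape D U V l

lemma Shape.card_edgesU {D : Labeling} {U V : Multiset ℕ} {l : ℕ} (h : Shape D U V l) :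
    D.edgesU.card = U.card + 1 := by
  simp [Labeling.edgesU, ← h.1]

lemma Shape.card_edgesV {D : Labeling} {U V : Multiset ℕ} {l : ℕ} (h : Shape D U V l) :
    D.edgesV.card = V.card + 1 := by
  simp [Labeling.edgesV, ← h.2.1]

lemma Shape.map {D : Labeling} {U V : Multiset ℕ} {l : ℕ} (h : Shape D U V l) (f : ℕ → ℕ) :
    Shape (D.map f) U V l := by
  obtain ⟨rfl, rfl, rfl⟩ := h
  simp [Shape, Labeling.map]

lemma Shape.addU {D : Labeling} {U V : Multiset ℕ} {l : ℕ} (h : Shape D U V l) (P : List ℕ) :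
    Shape (D.addU P) (P.length ::ₘ U) V l := by
  obtain ⟨rfl, rfl, rfl⟩ := h
  simp [Shape, Labeling.addU]

lemma Shape.addV {D : Labeling} {U V : Multiset ℕ} {l : ℕ} (h : Shape D U V l) (P : List ℕ) :
    Shape (D.addV P) U (P.length ::ₘ V) l := by
  obtain ⟨rfl, rfl, rfl⟩ := h
  simp [Shape, Labeling.addV]

/-- Replacing a `1`-leg at `u` and a `2`-leg at `v`. -/
lemma HasPlain.add_one_two {U V : Multiset ℕ} {l : ℕ} (h : HasPlain U V l)
    (hUV : V.card < U.card) (hV : 2 ≤ V.card) : HasPlain (1 ::ₘ U) (2 ::ₘ V) l := by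
  obtain ⟨τ, D, hD, hs⟩ := h
  have hcU := hs.card_edgesU
  have hcV := hs.card_edgesV
  have hw := hD.wf.map (shift τ 2 1)
  have hU := sum_map_shift τ 2 1 D.edgesU
  have hV' := sum_map_shift τ 2 1 D.edgesV
  have hcount := hD.count
  have hlt := hD.lt
  -- The only new pair `(1, τ + 3)` has sum `τ + 4`. The old sums exceed `τ` and grow by at least
  -- `4`.
  have hold : ∀ p ∈ D.inner.map (Prod.map (shift τ 2 1) (shift τ 2 1)), τ + 5 ≤ psum p := by
    intro p hp
    obtain ⟨r, hr, rfl⟩ := Multiset.mem_map.1 hp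
    have := hD.low r hr
    rw [psum_shift]; omega
  have hinner : (((D.map (shift τ 2 1)).addV [1, τ + 3]).addU [2]).inner =
      {((1 : ℕ), τ + 3)} + D.inner.map (Prod.map (shift τ 2 1) (shift τ 2 1)) := by
    simp
  have hlt' : ∀ n ∈ ({((1 : ℕ), τ + 3)} : Multiset (ℕ × ℕ)),
      ∀ p ∈ D.inner.map (Prod.map (shift τ 2 1) (shift τ 2 1)), psum n < psum p := by
    intro n hn p hp
    rw [Multiset.mem_singleton.1 hn]
    have := hold p hp
    simp only [psum] at *; omega
  -- The threshold is at the upper end of the gap, so that the pendant label `τ + 3` counts as small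
  -- and may sit at a leaf. The new pair then has no large entry, which is why the result need not
  -- be insertable.
  refine ⟨τ + 3, ((D.map (shift τ 2 1)).addV [1, τ + 3]).addU [2], ?_, ?_⟩
  swap
  · simpa using ((hs.map (shift τ 2 1)).addV [1, τ + 3]).addU [2]
  constructor
  · exact (hw.addV (by simp)).addU (by simp)
  · have : (((D.map (shift τ 2 1)).addV [1, τ + 3]).addU [2]).labels =
        {2, 1, τ + 3} + D.labels.map (shift τ 2 1) := by
      simp [← Multiset.singleton_add, ← Multiset.cons_coe, add_assoc]
    rw [this]
    refine hD.full.shift hD.le rfl ?_ ?_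
    · intro x h1 h2; simp; omega
    · intro x h1 h2; simp; omega
  · have := hD.le
    simp; omega
  · rw [hinner]
    exact nodup_attach (by simp) (nodup_shift hD.nodup hD.cls) hlt'
  · rw [hinner]
    refine cls_attach ?_ (cls_shift (by omega) (by omega) hD.cls) ?_ hlt'
    · simp
    · intro n hn p hp
      rw [Multiset.mem_singleton.1 hn]
      simp [big]
  · intro x hx
    simp only [Labeling.leaves_addU, Labeling.leaves_addV, Labeling.leaves_map _ hD.wf,
      Multiset.mem_cons, Multiset.mem_map] at hx
    rcases hx with rfl | rfl | ⟨y, hy, rfl⟩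
    · simp
    · simp
    · have := hD.leaf y hy
      rw [shift_of_le this]; omega
  · rw [hinner]
    intro p hp
    rcases Multiset.mem_add.1 hp with hp | hp
    · rw [Multiset.mem_singleton.1 hp]; simp only [psum]; omega
    · have := hold p hp; omega
  · have := hD.lowV
    simp only [Labeling.edgesV_addU, Labeling.edgesV_addV, Labeling.edgesV_map _ hD.wf,
      Multiset.sum_cons, hV']
    simp; omega
  · rw [hinner]
    have := hD.lowV
    simp only [Labeling.edgesV_addU, Labeling.edgesV_addV, Labeling.edgesV_map _ hD.wf,
      Multiset.sum_cons, hV']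
    intro p hp
    rcases Multiset.mem_add.1 hp with hp | hp
    · rw [Multiset.mem_singleton.1 hp]; simp only [psum, List.headD_cons]; omega
    · obtain ⟨r, hr, rfl⟩ := Multiset.mem_map.1 hp
      have := hD.high r hr
      have hb : big τ r ≤ 2 := by unfold big; split_ifs <;> omega
      rw [psum_shift]
      simp only [List.headD_cons]; omega
  · simp only [Labeling.edgesV_addU, Labeling.edgesV_addV, Labeling.edgesV_map _ hD.wf,
      Multiset.sum_cons, hV', Labeling.edgesU_addU, Labeling.edgesU_addV,
      Labeling.edgesU_map _ hD.wf, hU, List.headD_cons]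
    omega
  · simp only [Labeling.edgesV_addU, Labeling.edgesV_addV, Labeling.edgesV_map _ hD.wf,
      Labeling.edgesU_addU, Labeling.edgesU_addV, Multiset.countP_cons,
      Labeling.edgesU_map _ hD.wf, List.headD_cons]
    rw [countP_map_shift (by omega) (by omega), countP_map_shift (by omega) (by omega)]
    simp; omega

/-- One entry is at least `τ + 1`, and each of the others is at least `1`. -/
lemma two_mul_le_card_add {x : ℕ} {M : Multiset ℕ} {τ : ℕ} (hx : 1 ≤ M.countP (τ < ·))
    (h1 : ∀ y ∈ M, 1 ≤ y) (hM : x ≤ M.card) : τ + x ≤ M.sum := by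
  obtain ⟨a, ha, hτ⟩ := Multiset.countP_pos.1 hx
  obtain ⟨M, rfl⟩ := Multiset.exists_cons_of_mem ha
  have := Multiset.card_nsmul_le_sum (s := M) (a := 1)
    (fun y hy => h1 y (Multiset.mem_cons_of_mem hy))
  simp at *
  omega

lemma Labeling.edgesV_subset {D : Labeling} (h : D.WF) {x : ℕ} (hx : x ∈ D.edgesV) :
    x ∈ D.labels := by
  simp only [Labeling.edgesV, Labeling.labels, Multiset.mem_cons, Multiset.mem_add,
    Multiset.mem_map, Multiset.mem_bind, Multiset.mem_coe] at *
  rcases hx with rfl | ⟨l, hl, rfl⟩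
  · exact Or.inr (getLastD_mem h.1)
  · exact Or.inl (Or.inr ⟨l, hl, headD_mem (h.2.2 l hl)⟩)

/-- Common part of the insertions at `u` and at `v`: `E` arises from `D` by shifting with `α = ℓ`
and `δ = k` and attaching the leg `P`, whose labels fill the gaps alternately. Each end must supply
the comparison of the branch sums, the counts of large labels, and a lower bound for the sum at `v`.
-/
lemma Insertable.insert {τ : ℕ} {D E : Labeling} (hD : Insertable τ D) {ℓ k : ℕ}
    (h1 : k ≤ ℓ) (h2 : ℓ ≤ k + 1) (hc : 3 ≤ D.edgesV.card) (hE : E.WF) (P : List ℕ)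
    (hP : (P : Multiset ℕ) = alt 1 (τ + ℓ + 1) (ℓ + k))
    (hpairs : (pairs P : Multiset (ℕ × ℕ)).map psum =
      (List.range' (τ + ℓ + 2) (ℓ + k - 1) : Multiset ℕ))
    (hbig : ∀ p ∈ pairs P, big (τ + ℓ) p = 1) (hleaf : P.getLastD 0 ≤ ℓ)
    (hinner : E.inner = pairs P + D.inner.map (Prod.map (shift τ ℓ k) (shift τ ℓ k)))
    (hlabels : E.labels = P + D.labels.map (shift τ ℓ k))
    (hleaves : E.leaves = P.getLastD 0 ::ₘ D.leaves.map (shift τ ℓ k))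
    (hV : D.edgesV.sum + ℓ * D.edgesV.card + k * D.edgesV.countP (τ < ·) ≤ E.edgesV.sum)
    (hlt : E.edgesV.sum < E.edgesU.sum) (hpos : 1 ≤ E.edgesV.countP (τ + ℓ < ·))
    (hle : E.edgesV.countP (τ + ℓ < ·) ≤ E.edgesU.countP (τ + ℓ < ·) + 2) :
    Insertable (τ + ℓ) E := by
  -- The sums on the new leg end at `τ + 2 * ℓ + k`, just below this bound.
  have hold : ∀ p ∈ D.inner.map (Prod.map (shift τ ℓ k) (shift τ ℓ k)),
      τ + 1 + 2 * ℓ + k ≤ psum p := by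
    intro p hp
    obtain ⟨r, hr, rfl⟩ := Multiset.mem_map.1 hp
    have := hD.low r hr
    have := Nat.mul_le_mul_left k (hD.big_pos r hr)
    rw [psum_shift]; omega
  have hnew : ∀ p ∈ (pairs P : Multiset (ℕ × ℕ)),
      τ + ℓ + 2 ≤ psum p ∧ psum p ≤ τ + ℓ + ℓ + k := by
    intro p hp
    have : psum p ∈ (pairs P : Multiset (ℕ × ℕ)).map psum := Multiset.mem_map_of_mem _ hp
    rw [hpairs, Multiset.mem_coe, List.mem_range'_1] at this
    omega
  have hcmp : ∀ n ∈ (pairs P : Multiset (ℕ × ℕ)),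
      ∀ p ∈ D.inner.map (Prod.map (shift τ ℓ k) (shift τ ℓ k)), psum n < psum p := by
    intro n hn p hp
    have := hold p hp
    have := hnew n hn
    omega
  have hVlow : τ + 3 + ℓ * D.edgesV.card + k * D.edgesV.countP (τ < ·) ≤ E.edgesV.sum := by
    have := two_mul_le_card_add hD.count_pos
      (fun y hy => (hD.full.mem_iff.1 (Labeling.edgesV_subset hD.wf hy)).1) hc
    omega
  have hm1 := Nat.mul_le_mul_left ℓ hc
  have hm2 := Nat.mul_le_mul_left k hD.count_pos
  have hbig' : ∀ p ∈ D.inner.map (Prod.map (shift τ ℓ k) (shift τ ℓ k)), 1 ≤ big (τ + ℓ) p := by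
    intro p hp
    obtain ⟨r, hr, rfl⟩ := Multiset.mem_map.1 hp
    rw [big_shift (by omega) (by omega)]
    exact hD.big_pos r hr
  refine ⟨⟨hE, ?_, ?_, ?_, ?_, ?_, ?_, ?_, ?_, hlt, ?_⟩, ?_, hpos, hle⟩
  · rw [hlabels, hP]
    refine hD.full.shift hD.le (by simp) ?_ ?_
    · intro x hx hx'
      rw [Multiset.mem_coe, mem_alt]; left; omega
    · intro x hx hx'
      rw [Multiset.mem_coe, mem_alt]; right; omega
  · rw [hlabels, hP]
    have := hD.le
    simp; omega
  · rw [hinner]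
    refine nodup_attach ?_ (nodup_shift hD.nodup hD.cls) hcmp
    rw [hpairs]
    exact List.nodup_range'
  · rw [hinner]
    refine cls_attach ?_ (cls_shift (by omega) (by omega) hD.cls) ?_ hcmp
    · intro n hn n' hn' h
      rw [hbig n hn, hbig n' hn'] at h; omega
    · intro n hn p hp
      rw [hbig n hn]; exact hbig' p hp
  · intro x hx
    rw [hleaves, Multiset.mem_cons, Multiset.mem_map] at hx
    rcases hx with rfl | ⟨y, hy, rfl⟩
    · omega
    · have := hD.leaf y hy
      rw [shift_of_le this]; omega
  · rw [hinner]
    intro p hp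
    rcases Multiset.mem_add.1 hp with hp | hp
    · have := hnew p hp; omega
    · have := hold p hp; omega
  · omega
  · rw [hinner]
    intro p hp
    rcases Multiset.mem_add.1 hp with hp | hp
    · have := hnew p hp; omega
    -- An old sum grows by at most `2 * ℓ + 2 * k`. The sum at `v` grows by at least `3 * ℓ + k`,
    -- having three or more labels of which at least one is large, and `k ≤ ℓ`.
    · obtain ⟨r, hr, rfl⟩ := Multiset.mem_map.1 hp
      have := hD.high r hr
      have hb : big τ r ≤ 2 := by unfold big; split_ifs <;> omega
      have := Nat.mul_le_mul_left k hb
      rw [psum_shift]; omega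
  · omega
  · rw [hinner]
    intro p hp
    rcases Multiset.mem_add.1 hp with hp | hp
    · rw [hbig p hp]
    · exact hbig' p hp

lemma big_of_mem_pairs_alt {a b n τ : ℕ} {p : ℕ × ℕ} (h : p ∈ pairs (alt a b n))
    (ha : a + (n + 1) / 2 ≤ τ + 1) (hb : τ < b) : big τ p = 1 := by
  have := of_mem_pairs_alt h
  simp only [big]
  split_ifs <;> omega

/-- The leg starts at the leaf with label `1`, so its label at `u` is at least `ℓ`. Together with
the gain `ℓ` from the additional edge at `u`, this pays for the at most `2 * k` lost through excess
large labels at `v`. -/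
lemma HasInsertable.addU {U V : Multiset ℕ} {l : ℕ} (h : HasInsertable U V l)
    (hUV : V.card < U.card) (hV : 2 ≤ V.card) {n : ℕ} (hn : 1 ≤ n) :
    HasInsertable (n ::ₘ U) V l := by
  obtain ⟨τ, D, hD, hs⟩ := h
  have hcU := hs.card_edgesU
  have hcV := hs.card_edgesV
  obtain ⟨k, ℓ, hk, h1, h2⟩ : ∃ k ℓ, n = ℓ + k ∧ k ≤ ℓ ∧ ℓ ≤ k + 1 :=
    ⟨n / 2, (n + 1) / 2, by omega, by omega, by omega⟩
  have hw := hD.wf.map (shift τ ℓ k)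
  have hU' := sum_map_shift τ ℓ k D.edgesU
  have hV' := sum_map_shift τ ℓ k D.edgesV
  have hlt := hD.lt
  have hpos := hD.count_pos
  have hle := hD.count_le
  -- Lists run from the branch vertex to the leaf, so reversing puts the label `1` at the leaf and
  -- the last, largest label of its kind at `u`.
  set P := (alt 1 (τ + ℓ + 1) n).reverse with hP
  have hP0 : P ≠ [] := by simpa [hP] using alt_ne_nil (by omega)
  have hU0 : ∃ x, P.headD 0 = x ∧ ℓ ≤ x ∧ (ℓ = k → τ + ℓ < x) := by
    refine ⟨_, rfl, ?_⟩
    rw [hP, headD_reverse]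
    rcases eq_or_ne ℓ k with h | h
    · obtain ⟨j, rfl⟩ : ∃ j, n = 2 * j + 2 := ⟨k - 1, by omega⟩
      rw [getLastD_alt_even]; omega
    · obtain ⟨j, rfl⟩ : ∃ j, n = 2 * j + 1 := ⟨k, by omega⟩
      rw [getLastD_alt_odd]; omega
  obtain ⟨x, hx, hxℓ, hxk⟩ := hU0
  have hmul : ℓ * (V.card + 1) + ℓ ≤ ℓ * (U.card + 1) := by
    rw [← Nat.mul_succ]; exact Nat.mul_le_mul_left ℓ (by omega)
  have hmul2 : k * D.edgesV.countP (τ < ·) ≤ k * D.edgesU.countP (τ < ·) + k * 2 := by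
    rw [← Nat.mul_add]; exact Nat.mul_le_mul_left k hle
  refine ⟨τ + ℓ, (D.map (shift τ ℓ k)).addU P,
    hD.insert (ℓ := ℓ) (k := k) h1 h2 (by omega) (hw.addU hP0) P ?_ ?_ ?_ ?_ ?_ ?_ ?_
      ?_ ?_ ?_ ?_, ?_⟩
  · rw [hP, ← hk]; exact Multiset.coe_reverse _
  · rw [hP, map_psum_pairs_reverse, Multiset.map_coe]
    obtain ⟨j, rfl⟩ : ∃ j, n = j + 1 := ⟨n - 1, by omega⟩
    rw [map_psum_pairs_alt, ← hk]
    congr 2; omega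
  · intro p hp
    rw [← big_swap]
    exact big_of_mem_pairs_alt (mem_pairs_reverse.1 hp) (by omega) (by omega)
  · rw [hP, getLastD_reverse, headD_alt (by omega)]; omega
  · simp
  · simp
  · simp [Labeling.leaves_map _ hD.wf]
  · simp [Labeling.edgesV_map _ hD.wf, hV']
  · simp only [Labeling.edgesV_addU, Labeling.edgesV_map _ hD.wf, hV', Labeling.edgesU_addU,
      Labeling.edgesU_map _ hD.wf, hU', Multiset.sum_cons, hx, hcU, hcV]
    rcases eq_or_ne ℓ k with h | h
    · have := hxk h; omega
    · omega
  · rw [Labeling.edgesV_addU, Labeling.edgesV_map _ hD.wf,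
      countP_map_shift (by omega) (by omega)]
    exact hpos
  · rw [Labeling.edgesV_addU, Labeling.edgesV_map _ hD.wf, Labeling.edgesU_addU,
      Labeling.edgesU_map _ hD.wf, Multiset.countP_cons,
      countP_map_shift (by omega) (by omega), countP_map_shift (by omega) (by omega)]
    omega
  · have := (hs.map (shift τ ℓ k)).addU P
    rwa [hP, List.length_reverse, length_alt] at this

/-- On an odd leg both ends can be small: `1` goes to `v` and `k + 1` to the leaf. The two
additional edges at `u` gain `2 * (k + 1)`, which exceeds this `1` plus the possible loss `2 * k`.
On an even alternating leg a small leaf would force a large label at `v`. -/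
lemma HasInsertable.addV {U V : Multiset ℕ} {l : ℕ} (h : HasInsertable U V l)
    (hUV : V.card + 2 ≤ U.card) (hV : 2 ≤ V.card) (k : ℕ) :
    HasInsertable U ((2 * k + 1) ::ₘ V) l := by
  obtain ⟨τ, D, hD, hs⟩ := h
  have hcU := hs.card_edgesU
  have hcV := hs.card_edgesV
  have hw := hD.wf.map (shift τ (k + 1) k)
  have hU' := sum_map_shift τ (k + 1) k D.edgesU
  have hV' := sum_map_shift τ (k + 1) k D.edgesV
  have hlt := hD.lt
  have hpos := hD.count_pos
  have hle := hD.count_le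
  set P := alt 1 (τ + (k + 1) + 1) (2 * k + 1) with hP
  have hP0 : P ≠ [] := alt_ne_nil (by omega)
  have hmul : (k + 1) * (V.card + 1) + (k + 1) * 2 ≤ (k + 1) * (U.card + 1) := by
    rw [← Nat.mul_add]; exact Nat.mul_le_mul_left _ (by omega)
  have hmul2 : k * D.edgesV.countP (τ < ·) ≤ k * D.edgesU.countP (τ < ·) + k * 2 := by
    rw [← Nat.mul_add]; exact Nat.mul_le_mul_left k hle
  refine ⟨τ + (k + 1), (D.map (shift τ (k + 1) k)).addV P,
    hD.insert (ℓ := k + 1) (k := k) (by omega) (by omega) (by omega) (hw.addV hP0) P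
      ?_ ?_ ?_ ?_ ?_ ?_ ?_ ?_ ?_ ?_ ?_, ?_⟩
  · rw [hP, show 2 * k + 1 = k + 1 + k by omega]
  · rw [hP, Multiset.map_coe, map_psum_pairs_alt]
    congr 2 <;> omega
  · intro p hp
    exact big_of_mem_pairs_alt hp (by omega) (by omega)
  · rw [hP, getLastD_alt_odd]; omega
  · simp
  · simp
  · simp [Labeling.leaves_map _ hD.wf]
  · simp [Labeling.edgesV_map _ hD.wf, hV']
  · simp only [Labeling.edgesV_addV, Labeling.edgesV_map _ hD.wf, hV', Labeling.edgesU_addV,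
      Labeling.edgesU_map _ hD.wf, hU', Multiset.sum_cons, hcU, hcV]
    rw [hP, headD_alt (by omega)]
    omega
  · rw [Labeling.edgesV_addV, Labeling.edgesV_map _ hD.wf, Multiset.countP_cons,
      countP_map_shift (by omega) (by omega)]
    omega
  · rw [Labeling.edgesV_addV, Labeling.edgesV_map _ hD.wf, Labeling.edgesU_addV,
      Labeling.edgesU_map _ hD.wf, Multiset.countP_cons,
      countP_map_shift (by omega) (by omega), countP_map_shift (by omega) (by omega),
      hP, headD_alt (by omega), if_neg (by omega)]
    omega
  · have := (hs.map (shift τ (k + 1) k)).addV P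
    rwa [hP, length_alt] at this

/-! ### Extending every leg by one edge -/

/-- The rank of `x` among the elements of `M`. -/
def rank (M : Multiset ℕ) (x : ℕ) : ℕ := M.countP (· ≤ x)

lemma rank_le (M : Multiset ℕ) (x : ℕ) : rank M x ≤ M.card := Multiset.countP_le_card _ _

lemma rank_pos {M : Multiset ℕ} {x : ℕ} (h : x ∈ M) : 1 ≤ rank M x :=
  Multiset.countP_pos.2 ⟨x, h, le_rfl⟩

lemma rank_lt_rank {M : Multiset ℕ} {x y : ℕ} (hy : y ∈ M) (h : x < y) :
    rank M x < rank M y := by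
  obtain ⟨M, rfl⟩ := Multiset.exists_cons_of_mem hy
  have : M.countP (· ≤ x) ≤ M.countP (· ≤ y) := by
    rw [Multiset.countP_eq_card_filter, Multiset.countP_eq_card_filter]
    exact Multiset.card_le_card (Multiset.monotone_filter_right M fun z hz => by omega)
  simp only [rank, Multiset.countP_cons]
  split_ifs <;> omega

lemma rank_inj {M : Multiset ℕ} {x y : ℕ} (hx : x ∈ M) (hy : y ∈ M)
    (h : rank M x = rank M y) : x = y := by
  rcases lt_trichotomy x y with h' | h' | h'
  · exact absurd h (rank_lt_rank hy h').ne
  · exact h'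
  · exact absurd h (rank_lt_rank hx h').ne'

/-- The ranks of distinct elements are distinct and lie between `1` and the cardinality. They serve
as the labels of the new pendant edges. -/
lemma full_map_rank {M : Multiset ℕ} (hM : M.Nodup) : Full (M.map (rank M)) := by
  have h : M.map (rank M) = (Finset.Icc 1 M.card).val := by
    apply Multiset.eq_of_le_of_card_le
    · rw [Multiset.le_iff_subset
        (Multiset.Nodup.map_on (fun x hx y hy h => rank_inj hx hy h) hM)]
      intro x hx
      obtain ⟨y, hy, rfl⟩ := Multiset.mem_map.1 hx
      simpa using ⟨rank_pos hy, rank_le M y⟩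
    · simp
  intro x hx hx'
  rw [h]
  simpa using ⟨hx, by simpa using hx'⟩

namespace Labeling

/-- Extend a leg by one edge at its leaf, after relabeling. -/
def extendLeg (f r : ℕ → ℕ) (l : List ℕ) : List ℕ := l.map f ++ [r (l.getLastD 0)]

/-- Extend all legs by one edge at the leaf, after relabeling. -/
def extend (f r : ℕ → ℕ) (D : Labeling) : Labeling :=
  ⟨D.A.map (extendLeg f r), D.B.map (extendLeg f r), D.C.map f⟩

variable {D : Labeling} (f r : ℕ → ℕ)

lemma labels_extend : (D.extend f r).labels = D.labels.map f + D.leaves.map r := by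
  have key : ∀ A : Multiset (List ℕ),
      (A.map (extendLeg f r)).bind (fun l => (l : Multiset ℕ)) =
        (A.bind (fun l => (l : Multiset ℕ))).map f +
          (A.map (fun l => l.getLastD 0)).map r := by
    intro A
    induction A using Multiset.induction_on with
    | empty => simp
    | cons a A ih =>
      rw [Multiset.map_cons, Multiset.cons_bind, ih, extendLeg, ← Multiset.coe_add]
      simp only [Multiset.cons_bind, Multiset.map_add, Multiset.map_cons, ← Multiset.map_coe,
        Multiset.coe_singleton]
      simp only [← Multiset.singleton_add]
      abel
  simp only [labels, extend, leaves, key, Multiset.map_add, Multiset.map_coe]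
  abel

lemma inner_extend (h : D.WF) : (D.extend f r).inner =
    D.leaves.map (fun x => (f x, r x)) + D.inner.map (Prod.map f f) := by
  have key : ∀ A : Multiset (List ℕ), (∀ l ∈ A, l ≠ []) →
      (A.map (extendLeg f r)).bind (fun l => (pairs l : Multiset (ℕ × ℕ))) =
        (A.map (fun l => l.getLastD 0)).map (fun x => (f x, r x)) +
          (A.bind (fun l => (pairs l : Multiset (ℕ × ℕ)))).map (Prod.map f f) := by
    intro A hA
    induction A using Multiset.induction_on with
    | empty => simp
    | cons a A ih =>
      have ha := hA a (Multiset.mem_cons_self a A)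
      rw [Multiset.map_cons, Multiset.cons_bind, ih fun l hl => hA l (Multiset.mem_cons_of_mem hl),
        extendLeg, pairs_concat (by simpa using ha), ← Multiset.coe_add, getLastD_map f ha,
        pairs_map]
      simp only [Multiset.cons_bind, Multiset.map_add, Multiset.map_cons, ← Multiset.map_coe,
        Multiset.coe_singleton]
      simp only [← Multiset.singleton_add]
      abel
  simp only [inner, extend, leaves, key _ h.2.1, key _ h.2.2, Multiset.map_add, pairs_map,
    ← Multiset.map_coe]
  abel

lemma leaves_extend : (D.extend f r).leaves = D.leaves.map r := by
  simp [leaves, extend, extendLeg, Multiset.map_map]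

lemma headD_extendLeg {l : List ℕ} (h : l ≠ []) : (extendLeg f r l).headD 0 = f (l.headD 0) := by
  cases l with
  | nil => exact absurd rfl h
  | cons a l => rfl

lemma edgesU_extend (h : D.WF) : (D.extend f r).edgesU = D.edgesU.map f := by
  simp only [edgesU, extend, Multiset.map_map, Multiset.map_cons, headD_map f h.1]
  congr 1
  exact Multiset.map_congr rfl fun l hl => headD_extendLeg f r (h.2.1 l hl)

lemma edgesV_extend (h : D.WF) : (D.extend f r).edgesV = D.edgesV.map f := by
  simp only [edgesV, extend, Multiset.map_map, Multiset.map_cons, getLastD_map f h.1]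
  congr 1
  exact Multiset.map_congr rfl fun l hl => headD_extendLeg f r (h.2.2 l hl)

lemma wf_extend (h : D.WF) : (D.extend f r).WF := by
  refine ⟨by simpa [extend] using h.1, ?_, ?_⟩ <;> intro l hl <;>
    obtain ⟨l', hl', rfl⟩ := Multiset.mem_map.1 hl <;> simp [extendLeg]

lemma shape_extend {U V : Multiset ℕ} {l : ℕ} (h : Shape D U V l) :
    Shape (D.extend f r) (U.map (· + 1)) (V.map (· + 1)) l := by
  obtain ⟨rfl, rfl, rfl⟩ := h
  simp [Shape, extend, extendLeg]

lemma full_extend (hw : D.WF) (h : Full D.labels) :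
    Full (D.extend (· + D.leaves.card) (rank D.leaves)).labels := by
  rw [labels_extend]
  have hr := full_map_rank (Multiset.nodup_of_le (leaves_le_labels hw) h.nodup)
  intro x hx hx'
  simp only [Multiset.card_add, Multiset.card_map] at hx'
  rw [Multiset.mem_add]
  rcases le_or_gt x D.leaves.card with h' | h'
  · exact Or.inr (hr x hx (by simpa using h'))
  · exact Or.inl (Multiset.mem_map.2 ⟨x - D.leaves.card, h _ (by omega) (by omega), by omega⟩)

/-- With `k` leaves, a former leaf with label `x` gets the sum `x + k + rank x`, at most `x + 2 *
k`, while an old sum grows by exactly `2 * k`. -/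
lemma psum_lt_extend (h : ∀ x ∈ D.leaves, ∀ p ∈ D.inner, x < psum p) :
    ∀ n ∈ D.leaves.map (fun x => (x + D.leaves.card, rank D.leaves x)),
      ∀ p ∈ D.inner.map (Prod.map (· + D.leaves.card) (· + D.leaves.card)),
        psum n < psum p := by
  intro n hn p hp
  obtain ⟨x, hx, rfl⟩ := Multiset.mem_map.1 hn
  obtain ⟨q, hq, rfl⟩ := Multiset.mem_map.1 hp
  have := h x hx q hq
  have := rank_le D.leaves x
  simp only [psum, Prod.map] at *
  omega

lemma high_extend (hw : D.WF) {S : ℕ} (hp : ∀ p ∈ D.inner, psum p < S)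
    (hl : ∀ x ∈ D.leaves, x < S) :
    ∀ p ∈ (D.extend (· + D.leaves.card) (rank D.leaves)).inner,
      psum p < S + D.leaves.card * 2 := by
  rw [inner_extend _ _ hw]
  intro p hp'
  rcases Multiset.mem_add.1 hp' with h | h
  · obtain ⟨x, hx, rfl⟩ := Multiset.mem_map.1 h
    have := hl x hx
    have := rank_le D.leaves x
    simp only [psum]; omega
  · obtain ⟨q, hq, rfl⟩ := Multiset.mem_map.1 h
    have := hp q hq
    simp only [psum, Prod.map] at *; omega

/-- Since the rank increases with `x`, the sums `x + k + rank x` at the former leaves are strictly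
increasing. The old sums are all translated by `2 * k`. -/
lemma nodup_extend (hw : D.WF) (hf : Full D.labels) (hn : (D.inner.map psum).Nodup)
    (h : ∀ x ∈ D.leaves, ∀ p ∈ D.inner, x < psum p) :
    ((D.extend (· + D.leaves.card) (rank D.leaves)).inner.map psum).Nodup := by
  rw [inner_extend _ _ hw]
  refine nodup_attach ?_ ?_ (psum_lt_extend h)
  · rw [Multiset.map_map]
    refine Multiset.Nodup.map_on (fun x hx y hy hxy => ?_)
      (Multiset.nodup_of_le (leaves_le_labels hw) hf.nodup)
    simp only [Function.comp, psum] at hxy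
    rcases lt_trichotomy x y with h' | h' | h'
    · have := rank_lt_rank hy h'; omega
    · exact h'
    · have := rank_lt_rank hx h'; omega
  · rw [Multiset.map_map]
    have : (psum ∘ Prod.map (· + D.leaves.card) (· + D.leaves.card)) =
        (· + 2 * D.leaves.card) ∘ psum := by
      funext p; simp only [psum, Function.comp, Prod.map]; ring
    rw [this, ← Multiset.map_map]
    exact hn.map fun x y h => by simpa using h

end Labeling

open Labeling

lemma sum_map_add_const (k : ℕ) (M : Multiset ℕ) : (M.map (· + k)).sum = M.sum + k * M.card := by
  rw [Multiset.sum_map_add]; simp [mul_comm]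

lemma countP_map_add_const {k : ℕ} {M : Multiset ℕ} (h : ∀ x ∈ M, 1 ≤ x) :
    (M.map (· + k)).countP (k < ·) = M.card := by
  rw [Multiset.countP_map, Multiset.filter_eq_self.2 fun x hx => by have := h x hx; omega]

lemma Labeling.edgesU_subset {D : Labeling} (h : D.WF) {x : ℕ} (hx : x ∈ D.edgesU) :
    x ∈ D.labels := by
  simp only [Labeling.edgesU, Labeling.labels, Multiset.mem_cons, Multiset.mem_add,
    Multiset.mem_map, Multiset.mem_bind, Multiset.mem_coe] at *
  rcases hx with rfl | ⟨l, hl, rfl⟩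
  · exact Or.inr (headD_mem h.1)
  · exact Or.inl (Or.inl ⟨l, hl, headD_mem (h.2.1 l hl)⟩)

lemma Labeling.leaf_pos {D : Labeling} (hw : D.WF) (hf : Full D.labels) {x : ℕ}
    (hx : x ∈ D.leaves) : 1 ≤ x :=
  (hf.mem_iff.1 (Multiset.mem_of_le (leaves_le_labels hw) hx)).1

lemma Labeling.inner_pos {D : Labeling} (hf : Full D.labels) {p : ℕ × ℕ} (hp : p ∈ D.inner) :
    1 ≤ p.1 ∧ 1 ≤ p.2 := by
  have key : ∀ l : List ℕ, p ∈ pairs l → p.1 ∈ l ∧ p.2 ∈ l := by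
    intro l
    induction l with
    | nil => simp
    | cons a l ih =>
      cases l with
      | nil => simp
      | cons b l =>
        rw [pairs_cons_cons, List.mem_cons]
        rintro (rfl | h)
        · simp
        · exact ⟨List.mem_cons_of_mem _ (ih h).1, List.mem_cons_of_mem _ (ih h).2⟩
  have : p.1 ∈ D.labels ∧ p.2 ∈ D.labels := by
    simp only [Labeling.inner, Labeling.labels, Multiset.mem_add, Multiset.mem_bind,
      Multiset.mem_coe] at *
    rcases hp with (⟨l, hl, hp⟩ | ⟨l, hl, hp⟩) | hp
    · exact ⟨.inl (.inl ⟨l, hl, (key l hp).1⟩), .inl (.inl ⟨l, hl, (key l hp).2⟩)⟩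
    · exact ⟨.inl (.inr ⟨l, hl, (key l hp).1⟩), .inl (.inr ⟨l, hl, (key l hp).2⟩)⟩
    · exact ⟨.inr (key _ hp).1, .inr (key _ hp).2⟩
  exact ⟨(hf.mem_iff.1 this.1).1, (hf.mem_iff.1 this.2).1⟩

lemma Shape.card_leaves {D : Labeling} {U V : Multiset ℕ} {l : ℕ} (h : Shape D U V l) :
    D.leaves.card = U.card + V.card := by
  simp [leaves, ← h.1, ← h.2.1]

/-- With the new threshold `k`, the number of leaves, all old labels are large and exactly the new
ones are small. Old pairs have two large entries and new pairs have one. All labels at the branch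
vertices are large, so the counts are the numbers of edges there. Hence a plain labeling is enough
to obtain an insertable one. -/
lemma HasPlain.extend {U V : Multiset ℕ} {l : ℕ} (h : HasPlain U V l) (hUV : V.card < U.card)
    (hV0 : 1 ≤ V.card) : HasInsertable (U.map (· + 1)) (V.map (· + 1)) l := by
  obtain ⟨τ, D, hD, hs⟩ := h
  have hcU := hs.card_edgesU
  have hcV := hs.card_edgesV
  have hck := hs.card_leaves
  set k := D.leaves.card with hk
  have hw := hD.wf
  have hlp : ∀ x ∈ D.leaves, ∀ p ∈ D.inner, x < psum p := fun x hx p hp =>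
    (hD.leaf x hx).trans_lt (hD.low p hp)
  have hV := sum_map_add_const k D.edgesV
  have hU := sum_map_add_const k D.edgesU
  have hnV : (D.edgesV.map (· + k)).countP (k < ·) = D.edgesV.card :=
    countP_map_add_const fun x hx => (hD.full.mem_iff.1 (edgesV_subset hw hx)).1
  have hnU : (D.edgesU.map (· + k)).countP (k < ·) = D.edgesU.card :=
    countP_map_add_const fun x hx => (hD.full.mem_iff.1 (edgesU_subset hw hx)).1
  have hlow := hD.lowV
  have hlt := hD.lt
  have hbigo : ∀ p ∈ D.inner.map (Prod.map (· + k) (· + k)), big k p = 2 := by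
    intro p hp
    obtain ⟨q, hq, rfl⟩ := Multiset.mem_map.1 hp
    have := inner_pos hD.full hq
    simp only [big, Prod.map]
    split_ifs <;> omega
  have hbign : ∀ p ∈ D.leaves.map (fun x => (x + k, rank D.leaves x)), big k p = 1 := by
    intro p hp
    obtain ⟨x, hx, rfl⟩ := Multiset.mem_map.1 hp
    have := leaf_pos hw hD.full hx
    have := rank_le D.leaves x
    simp only [big]
    split_ifs <;> omega
  have hVk : k * 2 ≤ k * D.edgesV.card := Nat.mul_le_mul_left k (by omega)
  have hVV : k * D.edgesV.card ≤ k * D.edgesU.card := Nat.mul_le_mul_left k (by omega)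
  refine ⟨k, D.extend (· + k) (rank D.leaves),
    ⟨⟨wf_extend _ _ hw, full_extend hw hD.full, ?_, nodup_extend hw hD.full hD.nodup hlp,
      ?_, ?_, ?_, ?_, ?_, ?_, ?_⟩, ?_, ?_, ?_⟩, shape_extend _ _ hs⟩
  · rw [labels_extend]; simp; omega
  · rw [inner_extend _ _ hw]
    refine cls_attach ?_ ?_ ?_ (psum_lt_extend hlp)
    · intro n hn n' hn' h
      rw [hbign n hn, hbign n' hn'] at h; omega
    · intro n hn n' hn' h
      rw [hbigo n hn, hbigo n' hn'] at h; omega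
    · intro n hn p hp
      rw [hbign n hn, hbigo p hp]; omega
  · rw [leaves_extend]
    intro x hx
    obtain ⟨y, hy, rfl⟩ := Multiset.mem_map.1 hx
    exact rank_le _ _
  · rw [inner_extend _ _ hw]
    intro p hp
    rcases Multiset.mem_add.1 hp with hp | hp
    · obtain ⟨x, hx, rfl⟩ := Multiset.mem_map.1 hp
      have := leaf_pos hw hD.full hx
      simp only [psum]; omega
    · obtain ⟨q, hq, rfl⟩ := Multiset.mem_map.1 hp
      have := inner_pos hD.full hq
      simp only [psum, Prod.map]; omega
  · rw [edgesV_extend _ _ hw, hV]; omega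
  · rw [edgesV_extend _ _ hw, hV]
    intro p hp
    have := high_extend hw hD.high (fun x hx => (hD.leaf x hx).trans_lt hlow) p hp
    omega
  · rw [edgesV_extend _ _ hw, hV, edgesU_extend _ _ hw, hU]; omega
  · rw [edgesV_extend _ _ hw, edgesU_extend _ _ hw, hnV, hnU]; omega
  · rw [inner_extend _ _ hw]
    intro p hp
    rcases Multiset.mem_add.1 hp with hp | hp
    · rw [hbign p hp]
    · rw [hbigo p hp]; omega
  · rw [edgesV_extend _ _ hw, hnV]; omega
  · rw [edgesV_extend _ _ hw, edgesU_extend _ _ hw, hnV, hnU]; omega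

/-- The branch vertices have equally many edges, so their sums grow by the same amount and stay
different. -/
lemma HasBalanced.extend {U V : Multiset ℕ} {l : ℕ} (h : HasBalanced U V l)
    (hUV : V.card = U.card) (hV0 : 1 ≤ V.card) :
    HasBalanced (U.map (· + 1)) (V.map (· + 1)) l := by
  obtain ⟨D, hD, hs⟩ := h
  have hcU := hs.card_edgesU
  have hcV := hs.card_edgesV
  have hck := hs.card_leaves
  set k := D.leaves.card with hk
  have hw := hD.wf
  have hV := sum_map_add_const k D.edgesV
  have hU := sum_map_add_const k D.edgesU
  have hVk : k * 2 ≤ k * D.edgesV.card := Nat.mul_le_mul_left k (by omega)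
  have hVU : D.edgesU.card = D.edgesV.card := by omega
  rw [hVU] at hU
  refine ⟨D.extend (· + k) (rank D.leaves), ⟨wf_extend _ _ hw, full_extend hw hD.full,
    nodup_extend hw hD.full hD.nodup hD.leaf, ?_, ?_, ?_, ?_, ?_, ?_⟩, shape_extend _ _ hs⟩
  · rw [leaves_extend, inner_extend _ _ hw]
    intro x hx p hp
    obtain ⟨y, hy, rfl⟩ := Multiset.mem_map.1 hx
    have hr := rank_le D.leaves y
    rcases Multiset.mem_add.1 hp with hp | hp
    · obtain ⟨z, hz, rfl⟩ := Multiset.mem_map.1 hp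
      have := leaf_pos hw hD.full hz
      simp only [psum]; omega
    · obtain ⟨q, hq, rfl⟩ := Multiset.mem_map.1 hp
      have := inner_pos hD.full hq
      simp only [psum, Prod.map]; omega
  · rw [leaves_extend, edgesU_extend _ _ hw, hU]
    intro x hx
    obtain ⟨y, hy, rfl⟩ := Multiset.mem_map.1 hx
    have hr := rank_le D.leaves y
    have := hD.leafU y hy
    omega
  · rw [leaves_extend, edgesV_extend _ _ hw, hV]
    intro x hx
    obtain ⟨y, hy, rfl⟩ := Multiset.mem_map.1 hx
    have hr := rank_le D.leaves y
    have := hD.leafV y hy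
    omega
  · rw [edgesU_extend _ _ hw, hU]
    intro p hp
    have := high_extend hw hD.highU hD.leafU p hp
    omega
  · rw [edgesV_extend _ _ hw, hV]
    intro p hp
    have := high_extend hw hD.highV hD.leafV p hp
    omega
  · rw [edgesU_extend _ _ hw, edgesV_extend _ _ hw, hU, hV]
    have := hD.ne
    omega

/-- Adding a pendant edge at `v`. -/
lemma HasPlain.balance {U V : Multiset ℕ} {l : ℕ} (h : HasPlain U V l)
    (hUV : U.card = V.card + 1) (hV0 : 1 ≤ V.card) : HasBalanced U (1 ::ₘ V) l := by
  obtain ⟨τ, D, hD, hs⟩ := h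
  have hcU := hs.card_edgesU
  have hcV := hs.card_edgesV
  have hw := hD.wf
  have hV := sum_map_add_const 1 D.edgesV
  have hU := sum_map_add_const 1 D.edgesU
  have hlt := hD.lt
  have hlow := hD.lowV
  have hwm := hw.map (· + 1)
  have hinner : ((D.map (· + 1)).addV [1]).inner = D.inner.map (Prod.map (· + 1) (· + 1)) := by
    simp
  have hps : ∀ p ∈ D.inner.map (Prod.map (· + 1) (· + 1)), ∃ q ∈ D.inner, psum p = psum q + 2 := by
    intro p hp
    obtain ⟨q, hq, rfl⟩ := Multiset.mem_map.1 hp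
    exact ⟨q, hq, by simp only [psum, Prod.map]; ring⟩
  have hl : ∀ x ∈ ((D.map (· + 1)).addV [1]).leaves, x ≤ τ + 1 := by
    intro x hx
    simp only [leaves_addV, leaves_map _ hw, Multiset.mem_cons, Multiset.mem_map] at hx
    rcases hx with rfl | ⟨y, hy, rfl⟩
    · simp
    · have := hD.leaf y hy; omega
  -- The new pendant label `1` makes up for the missing edge at `v`, so both branch sums grow
  -- equally and remain different.
  have hU' : ((D.map (· + 1)).addV [1]).edgesU.sum = D.edgesU.sum + D.edgesU.card := by
    simp only [edgesU_addV, edgesU_map _ hw, hU]; omega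
  have hV' : ((D.map (· + 1)).addV [1]).edgesV.sum = D.edgesV.sum + D.edgesV.card + 1 := by
    simp only [edgesV_addV, edgesV_map _ hw, hV, Multiset.sum_cons, List.headD_cons]; omega
  refine ⟨(D.map (· + 1)).addV [1], ⟨hwm.addV (by simp), ?_, ?_, ?_, ?_, ?_, ?_, ?_, ?_⟩,
    by simpa using (hs.map (· + 1)).addV [1]⟩
  · intro x hx hx'
    simp only [labels_addV, labels_map, Multiset.card_add, Multiset.card_map, Multiset.coe_card,
      List.length_singleton, Multiset.mem_add, Multiset.mem_coe, List.mem_singleton,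
      Multiset.mem_map] at *
    rcases eq_or_ne x 1 with h | h
    · exact Or.inl h
    · exact Or.inr ⟨x - 1, hD.full _ (by omega) (by omega), by omega⟩
  · rw [hinner, Multiset.map_map]
    have : (psum ∘ Prod.map (· + 1) (· + 1)) = (· + 2) ∘ psum := by
      funext p; simp only [psum, Function.comp, Prod.map]; ring
    rw [this, ← Multiset.map_map]
    exact hD.nodup.map fun x y h => by simpa using h
  · rw [hinner]
    intro x hx p hp
    obtain ⟨q, hq, h⟩ := hps p hp
    have := hD.low q hq
    have := hl x hx
    omega
  · intro x hx
    have := hl x hx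
    omega
  · intro x hx
    have := hl x hx
    omega
  · rw [hinner]
    intro p hp
    obtain ⟨q, hq, h⟩ := hps p hp
    have := hD.high q hq
    omega
  · rw [hinner]
    intro p hp
    obtain ⟨q, hq, h⟩ := hps p hp
    have := hD.high q hq
    omega
  · omega

/-- Exchange the two branch vertices. -/
def Labeling.swap (D : Labeling) : Labeling := ⟨D.B, D.A, D.C.reverse⟩

lemma HasBalanced.swap {U V : Multiset ℕ} {l : ℕ} (h : HasBalanced U V l) :
    HasBalanced V U l := by
  obtain ⟨D, hD, h1, h2, h3⟩ := h
  have hl : D.swap.labels = D.labels := by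
    simp only [Labeling.swap, labels, Multiset.coe_reverse, add_comm (D.B.bind _)]
  have hlv : D.swap.leaves = D.leaves := by
    simp only [Labeling.swap, leaves, add_comm (D.B.map _)]
  have hin : D.swap.inner.map psum = D.inner.map psum := by
    simp only [Labeling.swap, Labeling.inner, Multiset.map_add, map_psum_pairs_reverse]
    rw [add_comm ((D.B.bind _).map _)]
  -- Reversing the middle path swaps the entries of its pairs, so only statements about sums carry
  -- over.
  have hi : ∀ P : ℕ → Prop, (∀ p ∈ D.inner, P (psum p)) → ∀ p ∈ D.swap.inner, P (psum p) := by
    intro P hP p hp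
    have : psum p ∈ D.swap.inner.map psum := Multiset.mem_map_of_mem _ hp
    rw [hin] at this
    obtain ⟨q, hq, h⟩ := Multiset.mem_map.1 this
    rw [← h]; exact hP q hq
  have hU : D.swap.edgesU = D.edgesV := by simp [Labeling.swap, edgesU, edgesV]
  have hV : D.swap.edgesV = D.edgesU := by simp [Labeling.swap, edgesU, edgesV]
  refine ⟨D.swap, ⟨⟨?_, hD.wf.2.2, hD.wf.2.1⟩, hl ▸ hD.full, hin ▸ hD.nodup, ?_, ?_, ?_, ?_, ?_, ?_⟩,
    h2, h1, by simpa [Labeling.swap] using h3⟩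
  · simpa [Labeling.swap] using hD.wf.1
  · rw [hlv]; intro x hx; exact hi _ (hD.leaf x hx)
  · rw [hlv, hU]; exact hD.leafV
  · rw [hlv, hV]; exact hD.leafU
  · rw [hU]; exact hi (· < D.edgesV.sum) hD.highV
  · rw [hV]; exact hi (· < D.edgesU.sum) hD.highU
  · rw [hU, hV]; exact hD.ne.symm

open Labeling

/-! ### Items: alternating paths with extra labels -/

/-- Where a path of the double spider sits. -/
inductive Place
  | atU | atV | core
  deriving DecidableEq

/-- Extra labels attached to an alternating path: a top label in front, a top label at the end, or
a middle label followed by a top label in front. -/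
inductive Extra
  | none | front | back | two
  deriving DecidableEq

/-- The description of an alternating path of small and large labels: whether it starts with a
small label, whether it is listed in decreasing order, whether its length `2 * k + 1` or
`2 * k + 2` is odd. -/
structure Item where
  place : Place
  extra : Extra
  small : Bool
  rev : Bool
  odd : Bool
  k : ℕ

namespace Item

variable (i : Item) (a b c t : ℕ)

/-- The number of small labels. -/
def x : ℕ := match i.odd, i.small with
  | true, false => i.k
  | _, _ => i.k + 1

/-- The number of large labels. -/
def y : ℕ := match i.odd, i.small with
  | true, true => i.k
  | _, _ => i.k + 1

/-- The number of top labels. -/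
def z : ℕ := match i.extra with
  | .none => 0
  | _ => 1

/-- The number of middle labels. -/
def w : ℕ := match i.extra with
  | .two => 1
  | _ => 0

/-- The alternating path on the small labels from `a` and the large labels from `b`. -/
def path : List ℕ := match i.rev, i.small with
  | false, true => alt a b (i.x + i.y)
  | false, false => alt b a (i.x + i.y)
  | true, true => (alt a b (i.x + i.y)).reverse
  | true, false => (alt b a (i.x + i.y)).reverse

/-- The first entry of `path`. -/
def hd : ℕ := match i.rev, i.small, i.odd with
  | false, true, _ => a
  | false, false, _ => b
  | true, true, true => a + i.k
  | true, true, false => b + i.k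
  | true, false, true => b + i.k
  | true, false, false => a + i.k

/-- The last entry of `path`. -/
def tl : ℕ := match i.rev, i.small, i.odd with
  | true, true, _ => a
  | true, false, _ => b
  | false, true, true => a + i.k
  | false, true, false => b + i.k
  | false, false, true => b + i.k
  | false, false, false => a + i.k

/-- Whether the first entry of `path` is large. -/
def hdLarge : Bool := match i.rev, i.small, i.odd with
  | true, true, false => true
  | true, false, false => false
  | _, s, _ => !s

/-- Whether the last entry of `path` is large. -/
def tlLarge : Bool := match i.rev, i.small, i.odd with
  | false, true, false => true
  | false, false, false => false
  | _, s, _ => !s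

lemma length_path : (i.path a b).length = i.x + i.y := by
  unfold path; split <;> simp

lemma path_pos : 0 < i.x + i.y := by
  obtain ⟨_, _, _ | _, _, _ | _, k⟩ := i <;> simp [x, y]

lemma path_ne_nil : i.path a b ≠ [] := by
  rw [← List.length_pos_iff, length_path]; exact i.path_pos

lemma small_count (h : i.small = true) : (i.x + i.y + 1) / 2 = i.x ∧ (i.x + i.y) / 2 = i.y := by
  obtain ⟨_, _, sm, _, _ | _, k⟩ := i <;> subst h <;> simp [x, y] <;> omega

lemma large_count (h : i.small = false) : (i.x + i.y + 1) / 2 = i.y ∧ (i.x + i.y) / 2 = i.x := by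
  obtain ⟨_, _, sm, _, _ | _, k⟩ := i <;> subst h <;> simp [x, y] <;> omega

lemma mem_path {n : ℕ} :
    n ∈ i.path a b ↔ (a ≤ n ∧ n < a + i.x) ∨ (b ≤ n ∧ n < b + i.y) := by
  unfold path
  split
  all_goals
    rename_i h
    first
      | have := i.small_count h
      | have := i.large_count h
    simp only [List.mem_reverse, mem_alt]
    omega

lemma map_psum_path : (pairs (i.path a b) : Multiset (ℕ × ℕ)).map psum =
    (List.range' (a + b) (i.x + i.y - 1) : Multiset ℕ) := by
  obtain ⟨n, hn⟩ : ∃ n, i.x + i.y = n + 1 := ⟨i.x + i.y - 1, by have := i.path_pos; omega⟩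
  unfold path
  split <;> (try rw [map_psum_pairs_reverse]) <;> simp only [Multiset.map_coe, hn,
    map_psum_pairs_alt, Nat.add_sub_cancel, add_comm b a]

lemma of_mem_pairs_path {p : ℕ × ℕ} (h : p ∈ pairs (i.path a b)) :
    (a ≤ p.1 ∧ p.1 < a + i.x ∧ b ≤ p.2 ∧ p.2 < b + i.y) ∨
      (b ≤ p.1 ∧ p.1 < b + i.y ∧ a ≤ p.2 ∧ p.2 < a + i.x) := by
  unfold path at h
  split at h
  all_goals
    rename_i hs
    first
      | have := i.small_count hs
      | have := i.large_count hs
    try rw [mem_pairs_reverse] at h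
    have := of_mem_pairs_alt h
    try simp only [Prod.fst_swap, Prod.snd_swap] at this
    omega

lemma getLastD_alt_item (h : i.small = true) : (alt a b (i.x + i.y)).getLastD 0 =
    match i.odd with
    | true => a + i.k
    | false => b + i.k := by
  rcases ho : i.odd
  · have : i.x + i.y = 2 * i.k + 2 := by unfold x y; rw [ho]; simp; omega
    rw [this, getLastD_alt_even]
  · have : i.x + i.y = 2 * i.k + 1 := by unfold x y; rw [ho, h]; simp; omega
    rw [this, getLastD_alt_odd]

lemma getLastD_alt_item' (h : i.small = false) : (alt b a (i.x + i.y)).getLastD 0 =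
    match i.odd with
    | true => b + i.k
    | false => a + i.k := by
  rcases ho : i.odd
  · have : i.x + i.y = 2 * i.k + 2 := by unfold x y; rw [ho]; simp; omega
    rw [this, getLastD_alt_even]
  · have : i.x + i.y = 2 * i.k + 1 := by unfold x y; rw [ho, h]; simp; omega
    rw [this, getLastD_alt_odd]

lemma headD_path : (i.path a b).headD 0 = i.hd a b := by
  have := i.path_pos
  unfold path hd
  rcases hr : i.rev <;> rcases hs : i.small <;>
    simp only [headD_reverse, headD_alt this]
  · rw [getLastD_alt_item' _ _ _ hs]; rcases i.odd <;> rfl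
  · rw [getLastD_alt_item _ _ _ hs]; rcases i.odd <;> rfl

lemma getLastD_path : (i.path a b).getLastD 0 = i.tl a b := by
  have := i.path_pos
  unfold path tl
  rcases hr : i.rev <;> rcases hs : i.small <;>
    simp only [getLastD_reverse, headD_alt this]
  · rw [getLastD_alt_item' _ _ _ hs]; rcases i.odd <;> rfl
  · rw [getLastD_alt_item _ _ _ hs]; rcases i.odd <;> rfl

lemma hd_large (h : i.hdLarge = true) : b ≤ i.hd a b ∧ i.hd a b < b + i.y := by
  obtain ⟨_, _, _ | _, _ | _, _ | _, k⟩ := i <;> simp [hdLarge, hd, y] at h ⊢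

lemma hd_small (h : i.hdLarge = false) : a ≤ i.hd a b ∧ i.hd a b < a + i.x := by
  obtain ⟨_, _, _ | _, _ | _, _ | _, k⟩ := i <;> simp [hdLarge, hd, x] at h ⊢

lemma tl_large (h : i.tlLarge = true) : b ≤ i.tl a b ∧ i.tl a b < b + i.y := by
  obtain ⟨_, _, _ | _, _ | _, _ | _, k⟩ := i <;> simp [tlLarge, tl, y] at h ⊢

lemma tl_small (h : i.tlLarge = false) : a ≤ i.tl a b ∧ i.tl a b < a + i.x := by
  obtain ⟨_, _, _ | _, _ | _, _ | _, k⟩ := i <;> simp [tlLarge, tl, x] at h ⊢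

/-- The path with its extra labels. -/
def list : List ℕ := match i.extra with
  | .none => i.path a b
  | .front => t :: i.path a b
  | .back => i.path a b ++ [t]
  | .two => c :: t :: i.path a b

/-- The pairs formed by a large and a top label. -/
def tops : Multiset (ℕ × ℕ) := match i.extra with
  | .none => 0
  | .back => {(i.tl a b, t)}
  | _ => {(t, i.hd a b)}

/-- The pairs formed by a middle and a top label. -/
def mids : Multiset (ℕ × ℕ) := match i.extra with
  | .two => {(c, t)}
  | _ => 0

/-- The first entry of `list`. -/
def root : ℕ := match i.extra with
  | .front => t
  | .two => c
  | _ => i.hd a b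

/-- The last entry of `list`. -/
def leaf : ℕ := match i.extra with
  | .back => t
  | _ => i.tl a b

/-- The length of `list`. -/
def len : ℕ := i.x + i.y + i.z + i.w

lemma length_list : (i.list a b c t).length = i.len := by
  unfold list len z w
  rcases i.extra <;> simp [length_path]

lemma list_ne_nil : i.list a b c t ≠ [] := by
  rw [← List.length_pos_iff, length_list]
  have := i.path_pos
  unfold len; omega

/-- The pairs are split by kind because their sums live in different ranges: small plus large,
middle plus top, large plus top. -/
lemma pairs_list : (pairs (i.list a b c t) : Multiset (ℕ × ℕ)) =
    pairs (i.path a b) + i.mids c t + i.tops a b t := by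
  unfold list mids tops
  rcases i.extra <;>
    simp only [pairs_cons _ (i.path_ne_nil a b), pairs_concat (i.path_ne_nil a b), headD_path,
      getLastD_path, pairs_cons_cons, ← Multiset.cons_coe, ← Multiset.coe_add,
      ← Multiset.singleton_add, add_zero]
  all_goals abel

lemma headD_list : (i.list a b c t).headD 0 = i.root a b c t := by
  unfold list root
  rcases i.extra <;> simp only [headD_path, List.headD_cons]
  rw [← headD_path]
  have := i.path_ne_nil a b
  cases h : i.path a b with
  | nil => exact absurd h this
  | cons n l => rfl

lemma getLastD_list : (i.list a b c t).getLastD 0 = i.leaf a b t := by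
  have := i.path_ne_nil a b
  unfold list leaf
  rcases i.extra <;> simp only [getLastD_path, List.getLastD_concat] <;>
  rw [← getLastD_path] <;>
  cases h : i.path a b with
  | nil => exact absurd h this
  | cons n l => rfl

lemma mem_list {n : ℕ} (h : (a ≤ n ∧ n < a + i.x) ∨ (b ≤ n ∧ n < b + i.y) ∨
    (c ≤ n ∧ n < c + i.w) ∨ (t ≤ n ∧ n < t + i.z)) : n ∈ i.list a b c t := by
  have := i.mem_path a b (n := n)
  unfold w z at h
  unfold list
  rcases he : i.extra <;> simp only [he] at h ⊢
  · rw [this]; omega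
  · rw [List.mem_cons, this]; omega
  · rw [List.mem_append, List.mem_singleton, this]; omega
  · rw [List.mem_cons, List.mem_cons, this]; omega

/-- The item as a labeling of a part of the double spider. -/
def labeling : Labeling := match i.place with
  | .atU => ⟨{i.list a b c t}, 0, []⟩
  | .atV => ⟨0, {i.list a b c t}, []⟩
  | .core => ⟨0, 0, i.list a b c t⟩

end Item

/-! ### Running through a list of items -/

/-- Combine labelings of parts. -/
def Labeling.append (D E : Labeling) : Labeling := ⟨D.A + E.A, D.B + E.B, D.C ++ E.C⟩

/-- Successive alternating paths. -/
def run : List Item → ℕ → ℕ → ℕ → ℕ → Labeling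
  | [], _, _, _, _ => ⟨0, 0, []⟩
  | i :: is, a, b, c, t =>
    (i.labeling a b c t).append (run is (a + i.x) (b + i.y) (c + i.w) (t + i.z))

open Labeling

namespace Labeling

variable {D E : Labeling}

lemma labels_append : (D.append E).labels = D.labels + E.labels := by
  simp only [labels, append, Multiset.add_bind, ← Multiset.coe_add]
  abel

lemma inner_append (h : D.C = [] ∨ E.C = []) : (D.append E).inner = D.inner + E.inner := by
  simp only [Labeling.inner, append, Multiset.add_bind]
  rcases h with h | h <;> simp only [h, List.nil_append, List.append_nil, pairs_nil,
    Multiset.coe_nil, add_zero] <;> abel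

lemma leaves_append : (D.append E).leaves = D.leaves + E.leaves := by
  simp only [leaves, append, Multiset.map_add]
  abel

end Labeling

/-- The number of items between the branch vertices. -/
def cores (is : List Item) : ℕ := is.countP (fun i => i.place = .core)

/-- The pairs in the alternating paths. -/
def chainPairs : List Item → ℕ → ℕ → Multiset (ℕ × ℕ)
  | [], _, _ => 0
  | i :: is, a, b => pairs (i.path a b) + chainPairs is (a + i.x) (b + i.y)

/-- The pairs of middle and top labels. -/
def midPairs : List Item → ℕ → ℕ → Multiset (ℕ × ℕ)
  | [], _, _ => 0
  | i :: is, c, t => i.mids c t + midPairs is (c + i.w) (t + i.z)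

/-- The pairs of large and top labels. -/
def topPairs : List Item → ℕ → ℕ → ℕ → Multiset (ℕ × ℕ)
  | [], _, _, _ => 0
  | i :: is, a, b, t => i.tops a b t + topPairs is (a + i.x) (b + i.y) (t + i.z)

/-- The labels at `u`. -/
def headsU : List Item → ℕ → ℕ → ℕ → ℕ → Multiset ℕ
  | [], _, _, _, _ => 0
  | i :: is, a, b, c, t => (match i.place with
    | .atV => 0
    | _ => {i.root a b c t}) + headsU is (a + i.x) (b + i.y) (c + i.w) (t + i.z)

/-- The labels at `v`. -/
def headsV : List Item → ℕ → ℕ → ℕ → ℕ → Multiset ℕ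
  | [], _, _, _, _ => 0
  | i :: is, a, b, c, t => (match i.place with
    | .atU => 0
    | .atV => {i.root a b c t}
    | .core => {i.leaf a b t}) + headsV is (a + i.x) (b + i.y) (c + i.w) (t + i.z)

/-- The lengths of the legs at `u`. -/
def lensU : List Item → Multiset ℕ
  | [] => 0
  | i :: is => (match i.place with
    | .atU => {i.len}
    | _ => 0) + lensU is

/-- The lengths of the legs at `v`. -/
def lensV : List Item → Multiset ℕ
  | [] => 0
  | i :: is => (match i.place with
    | .atV => {i.len}
    | _ => 0) + lensV is

/-- The length of the path between the branch vertices. -/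
def lensC : List Item → ℕ
  | [] => 0
  | i :: is => (match i.place with
    | .core => i.len
    | _ => 0) + lensC is

/-- The total number of small labels. -/
def sx (is : List Item) : ℕ := (is.map Item.x).sum

/-- The total number of large labels. -/
def sy (is : List Item) : ℕ := (is.map Item.y).sum

/-- The total number of top labels. -/
def sz (is : List Item) : ℕ := (is.map Item.z).sum

/-- The total number of middle labels. -/
def sw (is : List Item) : ℕ := (is.map Item.w).sum

section simp_lemmas

variable (i : Item) (is : List Item)

@[simp] lemma sx_nil : sx [] = 0 := rfl
@[simp] lemma sy_nil : sy [] = 0 := rfl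
@[simp] lemma sz_nil : sz [] = 0 := rfl
@[simp] lemma sw_nil : sw [] = 0 := rfl
@[simp] lemma sx_cons : sx (i :: is) = i.x + sx is := by simp [sx]
@[simp] lemma sy_cons : sy (i :: is) = i.y + sy is := by simp [sy]
@[simp] lemma sz_cons : sz (i :: is) = i.z + sz is := by simp [sz]
@[simp] lemma sw_cons : sw (i :: is) = i.w + sw is := by simp [sw]
@[simp] lemma cores_nil : cores [] = 0 := rfl
lemma cores_cons : cores (i :: is) = cores is + if i.place = .core then 1 else 0 := by
  simp [cores, List.countP_cons]

end simp_lemmas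

variable {is : List Item} {a b c t : ℕ}

lemma C_run (h : cores is = 0) : (run is a b c t).C = [] := by
  induction is generalizing a b c t with
  | nil => rfl
  | cons i is ih =>
    rw [cores_cons] at h
    split_ifs at h with hi
    simp only [run, append, ih (by omega), List.append_nil]
    unfold Item.labeling
    split <;> simp_all

lemma Item.labels_labeling (i : Item) : (i.labeling a b c t).labels = i.list a b c t := by
  unfold Item.labeling
  split <;> simp [labels]

lemma Item.inner_labeling (i : Item) : (i.labeling a b c t).inner = pairs (i.list a b c t) := by
  unfold Item.labeling
  split <;> simp [Labeling.inner]

lemma card_labels_run : (run is a b c t).labels.card = sx is + sy is + sz is + sw is := by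
  induction is generalizing a b c t with
  | nil => rfl
  | cons i is ih =>
    simp only [run, labels_append, Multiset.card_add, ih, Item.labels_labeling, sx_cons, sy_cons,
      sz_cons, sw_cons, Multiset.coe_card, Item.length_list, Item.len]
    ring

lemma mem_labels_run {n : ℕ} (h : (a ≤ n ∧ n < a + sx is) ∨ (b ≤ n ∧ n < b + sy is) ∨
    (c ≤ n ∧ n < c + sw is) ∨ (t ≤ n ∧ n < t + sz is)) : n ∈ (run is a b c t).labels := by
  induction is generalizing a b c t with
  | nil => simp at h; omega
  | cons i is ih =>
    simp only [sx_cons, sy_cons, sz_cons, sw_cons] at h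
    rw [run, labels_append, Multiset.mem_add, Item.labels_labeling, Multiset.mem_coe]
    by_cases h' : (a ≤ n ∧ n < a + i.x) ∨ (b ≤ n ∧ n < b + i.y) ∨
        (c ≤ n ∧ n < c + i.w) ∨ (t ≤ n ∧ n < t + i.z)
    · exact Or.inl (i.mem_list a b c t h')
    · exact Or.inr (ih (by omega))

/-- Two items in the middle would be concatenated there and form an additional pair at the junction.
-/
lemma inner_run (h : cores is ≤ 1) :
    (run is a b c t).inner = chainPairs is a b + midPairs is c t + topPairs is a b t := by
  induction is generalizing a b c t with
  | nil => simp [run, Labeling.inner, chainPairs, midPairs, topPairs]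
  | cons i is ih =>
    rw [cores_cons] at h
    rw [run, inner_append, ih (by omega), Item.inner_labeling, Item.pairs_list, chainPairs,
      midPairs, topPairs]
    · abel
    · split_ifs at h with hi
      · exact Or.inr (C_run (by omega))
      · left
        unfold Item.labeling
        split <;> simp_all

lemma chainPairs_bound {p : ℕ × ℕ} (h : p ∈ chainPairs is a b) :
    a + b ≤ psum p ∧ psum p + 2 ≤ a + b + sx is + sy is := by
  induction is generalizing a b with
  | nil => simp [chainPairs] at h
  | cons i is ih =>
    rw [chainPairs, Multiset.mem_add] at h
    have hpos := i.path_pos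
    simp only [sx_cons, sy_cons]
    rcases h with h | h
    · have : psum p ∈ (pairs (i.path a b) : Multiset (ℕ × ℕ)).map psum :=
        Multiset.mem_map_of_mem _ h
      rw [i.map_psum_path, Multiset.mem_coe, List.mem_range'_1] at this
      omega
    · have := ih h
      omega

/-- A path with `x` small and `y` large labels has sums from `a + b` to `a + b + x + y - 2`. The
next path starts from `a + x` and `b + y`, so its sums begin later; the sum `a + b + x + y - 1` is
skipped. -/
lemma chainPairs_nodup : ((chainPairs is a b).map psum).Nodup := by
  induction is generalizing a b with
  | nil => simp [chainPairs]
  | cons i is ih =>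
    rw [chainPairs]
    have hpos := i.path_pos
    refine nodup_attach ?_ ih fun n hn p hp => ?_
    · rw [i.map_psum_path]; exact List.nodup_range'
    · have h1 : psum n ∈ (pairs (i.path a b) : Multiset (ℕ × ℕ)).map psum :=
        Multiset.mem_map_of_mem _ hn
      rw [i.map_psum_path, Multiset.mem_coe, List.mem_range'_1] at h1
      have := chainPairs_bound hp
      omega

lemma chainPairs_big {p : ℕ × ℕ} {s : ℕ} (h : p ∈ chainPairs is a b) (ha : a + sx is ≤ s + 1)
    (hb : s < b) : big s p = 1 := by
  induction is generalizing a b with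
  | nil => simp [chainPairs] at h
  | cons i is ih =>
    rw [chainPairs, Multiset.mem_add] at h
    simp only [sx_cons] at ha
    rcases h with h | h
    · have := i.of_mem_pairs_path a b h
      simp only [big]
      split_ifs <;> omega
    · exact ih h (by omega) (by omega)

lemma midPairs_bound {p : ℕ × ℕ} (h : p ∈ midPairs is c t) :
    c ≤ p.1 ∧ p.1 < c + sw is ∧ t ≤ p.2 ∧ p.2 < t + sz is := by
  induction is generalizing c t with
  | nil => simp [midPairs] at h
  | cons i is ih =>
    rw [midPairs, Multiset.mem_add] at h
    simp only [sw_cons, sz_cons]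
    rcases h with h | h
    · unfold Item.mids at h
      unfold Item.w Item.z
      rcases he : i.extra <;> simp only [he, Multiset.notMem_zero, Multiset.mem_singleton] at h
      subst h
      simp
    · have := ih h
      omega

lemma midPairs_nodup : ((midPairs is c t).map psum).Nodup := by
  induction is generalizing c t with
  | nil => simp [midPairs]
  | cons i is ih =>
    rw [midPairs]
    refine nodup_attach ?_ ih fun n hn p hp => ?_
    · unfold Item.mids
      split <;> simp
    · have := midPairs_bound hp
      unfold Item.mids at hn
      unfold Item.w Item.z at this
      rcases he : i.extra <;> simp only [he, Multiset.notMem_zero, Multiset.mem_singleton] at hn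
      subst hn
      simp only [he] at this
      simp only [psum]
      omega

/-- The extra top labels are attached to large labels, and the ends of legs are small. -/
def Item.Good (i : Item) : Prop :=
  (i.place ≠ .core → i.extra ≠ .back ∧ i.tlLarge = false) ∧ (i.extra = .back → i.tlLarge = true) ∧
    (i.extra = .front ∨ i.extra = .two → i.hdLarge = true)

lemma Item.tops_bound {i : Item} {p : ℕ × ℕ} (hi : i.Good) (h : p ∈ i.tops a b t) :
    i.z = 1 ∧ (p.1 = t ∧ b ≤ p.2 ∧ p.2 < b + i.y ∨ p.2 = t ∧ b ≤ p.1 ∧ p.1 < b + i.y) := by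
  obtain ⟨_, h2, h3⟩ := hi
  unfold Item.tops at h
  unfold Item.z
  rcases he : i.extra <;> simp only [he, Multiset.notMem_zero, Multiset.mem_singleton] at h <;>
    subst h
  · have := i.hd_large a b (h3 (.inl he)); simp; omega
  · have := i.tl_large a b (h2 he); simp; omega
  · have := i.hd_large a b (h3 (.inr he)); simp; omega

lemma topPairs_bound {p : ℕ × ℕ} (hi : ∀ i ∈ is, i.Good) (h : p ∈ topPairs is a b t) :
    b ≤ p.1 ∧ t ≤ p.2 ∧ p.1 < b + sy is ∧ p.2 < t + sz is ∨
      b ≤ p.2 ∧ t ≤ p.1 ∧ p.2 < b + sy is ∧ p.1 < t + sz is := by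
  induction is generalizing a b t with
  | nil => simp [topPairs] at h
  | cons i is ih =>
    rw [topPairs, Multiset.mem_add] at h
    simp only [sy_cons, sz_cons]
    rcases h with h | h
    · have := Item.tops_bound (hi i (by simp)) h
      omega
    · have := ih (fun j hj => hi j (by simp [hj])) h
      omega

/-- Along the list both the large and the top labels increase, and hence so do their sums. -/
lemma topPairs_nodup (hi : ∀ i ∈ is, i.Good) : ((topPairs is a b t).map psum).Nodup := by
  induction is generalizing a b t with
  | nil => simp [topPairs]
  | cons i is ih =>
    rw [topPairs]
    refine nodup_attach ?_ (ih fun j hj => hi j (by simp [hj])) fun n hn p hp => ?_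
    · unfold Item.tops
      split <;> simp
    · have := topPairs_bound (fun j hj => hi j (by simp [hj])) hp
      have := Item.tops_bound (hi i (by simp)) hn
      simp only [psum]
      omega

lemma leaves_run {n : ℕ} (hi : ∀ i ∈ is, i.Good) (h : n ∈ (run is a b c t).leaves) :
    n < a + sx is := by
  induction is generalizing a b c t with
  | nil => simp [run, leaves] at h
  | cons i is ih =>
    rw [run, leaves_append, Multiset.mem_add] at h
    rw [sx_cons]
    rcases h with h | h
    · have hg := (hi i (by simp)).1
      unfold Item.labeling at h
      rcases hp : i.place <;>
        simp [hp, leaves, Item.getLastD_list, -List.getLastD_eq_getLast?] at h hg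
      all_goals
        subst h
        have := i.tl_small a b hg.2
        unfold Item.leaf
        rcases he : i.extra <;> simp only [he] at hg ⊢ <;> first | omega | simp at hg
    · have := ih (fun j hj => hi j (by simp [hj])) h
      omega

/-- The two statements are proved together: once the middle item has been met, the rest of the list
contributes only legs. -/
lemma map_headD_A_run : (cores is = 0 → (run is a b c t).A.map (fun l => l.headD 0) =
      headsU is a b c t) ∧ (cores is = 1 → (run is a b c t).edgesU = headsU is a b c t) := by
  induction is generalizing a b c t with
  | nil => simp [run, headsU]
  | cons i is ih =>
    obtain ⟨ih1, ih2⟩ := @ih (a + i.x) (b + i.y) (c + i.w) (t + i.z)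
    rw [cores_cons, headsU, run]
    rcases hp : i.place
    · refine ⟨fun h => ?_, fun h => ?_⟩
      · rw [← ih1 (by simpa using h)]
        simp only [append, Item.labeling, hp, Multiset.map_add, Multiset.map_singleton,
          Item.headD_list]
      · rw [← ih2 (by simpa using h)]
        simp only [append, edgesU, Item.labeling, hp, Multiset.map_add, Multiset.map_singleton,
          Item.headD_list, List.nil_append, ← Multiset.singleton_add]
        abel
    · refine ⟨fun h => ?_, fun h => ?_⟩
      · rw [← ih1 (by simpa using h)]
        simp only [append, Item.labeling, hp, zero_add]
      · rw [← ih2 (by simpa using h)]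
        simp only [append, edgesU, Item.labeling, hp, zero_add, List.nil_append]
    · refine ⟨fun h => by simp at h, fun h => ?_⟩
      have h0 : cores is = 0 := by simpa using h
      rw [← ih1 h0]
      simp only [append, edgesU, Item.labeling, hp, zero_add, C_run h0, List.append_nil,
        Item.headD_list, Multiset.singleton_add]

lemma map_headD_B_run : (cores is = 0 → (run is a b c t).B.map (fun l => l.headD 0) =
      headsV is a b c t) ∧ (cores is = 1 → (run is a b c t).edgesV = headsV is a b c t) := by
  induction is generalizing a b c t with
  | nil => simp [run, headsV]
  | cons i is ih =>
    obtain ⟨ih1, ih2⟩ := @ih (a + i.x) (b + i.y) (c + i.w) (t + i.z)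
    rw [cores_cons, headsV, run]
    rcases hp : i.place
    · refine ⟨fun h => ?_, fun h => ?_⟩
      · rw [← ih1 (by simpa using h)]
        simp only [append, Item.labeling, hp, zero_add]
      · rw [← ih2 (by simpa using h)]
        simp only [append, edgesV, Item.labeling, hp, zero_add, List.nil_append]
    · refine ⟨fun h => ?_, fun h => ?_⟩
      · rw [← ih1 (by simpa using h)]
        simp only [append, Item.labeling, hp, Multiset.map_add, Multiset.map_singleton,
          Item.headD_list]
      · rw [← ih2 (by simpa using h)]
        simp only [append, edgesV, Item.labeling, hp, Multiset.map_add, Multiset.map_singleton,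
          Item.headD_list, List.nil_append, ← Multiset.singleton_add]
        abel
    · refine ⟨fun h => by simp at h, fun h => ?_⟩
      have h0 : cores is = 0 := by simpa using h
      rw [← ih1 h0]
      simp only [append, edgesV, Item.labeling, hp, zero_add, C_run h0, List.append_nil,
        Item.getLastD_list, Multiset.singleton_add]

lemma shape_run : Shape (run is a b c t) (lensU is) (lensV is) (lensC is) := by
  induction is generalizing a b c t with
  | nil => simp [run, Shape, lensU, lensV, lensC]
  | cons i is ih =>
    obtain ⟨h1, h2, h3⟩ := @ih (a + i.x) (b + i.y) (c + i.w) (t + i.z)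
    simp only [Shape, run, append, Multiset.map_add, h1, h2, h3, List.length_append, lensU, lensV,
      lensC, Item.labeling]
    rcases i.place <;> simp [Item.length_list]

lemma wf_run (h : cores is = 1) : (run is a b c t).WF := by
  have key : ∀ l, l ∈ (run is a b c t).A ∨ l ∈ (run is a b c t).B → l ≠ [] := by
    intro l hl
    clear h
    induction is generalizing a b c t with
    | nil => simp [run] at hl
    | cons i is ih =>
      simp only [run, append, Multiset.mem_add] at hl
      by_cases h : l ∈ (i.labeling a b c t).A ∨ l ∈ (i.labeling a b c t).B
      · unfold Item.labeling at h
        rcases hp : i.place <;> simp [hp] at h <;> subst h <;> exact i.list_ne_nil a b c t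
      · exact @ih (a + i.x) (b + i.y) (c + i.w) (t + i.z) (by tauto)
  refine ⟨?_, fun l hl => key l (.inl hl), fun l hl => key l (.inr hl)⟩
  clear key
  induction is generalizing a b c t with
  | nil => simp at h
  | cons i is ih =>
    rw [cores_cons] at h
    simp only [run, append]
    rcases hp : i.place
    · simp [ih (by simpa [hp] using h)]
    · simp [ih (by simpa [hp] using h)]
    · simp [Item.labeling, hp, i.list_ne_nil]

open Labeling

/-! ### Counting the large labels at the branch vertices -/

namespace Item

/-- Whether the first entry of `list` is large. -/
def rootLarge (i : Item) : Bool := match i.extra with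
  | .front => true
  | .two => false
  | _ => i.hdLarge

/-- Whether the last entry of `list` is large. -/
def leafLarge (i : Item) : Bool := match i.extra with
  | .back => true
  | _ => i.tlLarge

lemma root_large_iff (i : Item) {a b c t s : ℕ} (ha : a + i.x ≤ s + 1) (hc : c + i.w ≤ s + 1)
    (hb : s < b) (ht : s < t) : s < i.root a b c t ↔ i.rootLarge = true := by
  unfold root rootLarge
  have h1 := i.hd_large a b
  have h2 := i.hd_small a b
  unfold w at hc
  rcases he : i.extra <;> simp only [he] at hc ⊢ <;> rcases hl : i.hdLarge <;>
    simp only [hl] at h1 h2 <;> simp at h1 h2 ⊢ <;> omega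

lemma leaf_large_iff (i : Item) {a b t s : ℕ} (ha : a + i.x ≤ s + 1)
    (hb : s < b) (ht : s < t) : s < i.leaf a b t ↔ i.leafLarge = true := by
  unfold leaf leafLarge
  have h1 := i.tl_large a b
  have h2 := i.tl_small a b
  rcases he : i.extra <;> simp only <;> rcases hl : i.tlLarge <;>
    simp only [hl] at h1 h2 <;> simp at h1 h2 ⊢ <;> omega

end Item

/-- The number of labels at `u` that are not small. -/
def largeU : List Item → ℕ
  | [] => 0
  | i :: is => (match i.place with
    | .atV => 0
    | _ => i.rootLarge.toNat) + largeU is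

/-- The number of labels at `v` that are not small. -/
def largeV : List Item → ℕ
  | [] => 0
  | i :: is => (match i.place with
    | .atU => 0
    | .atV => i.rootLarge.toNat
    | .core => i.leafLarge.toNat) + largeV is

variable {is : List Item} {a b c t s : ℕ}

lemma countP_headsU (ha : a + sx is ≤ s + 1) (hc : c + sw is ≤ s + 1) (hb : s < b) (ht : s < t) :
    (headsU is a b c t).countP (s < ·) = largeU is := by
  induction is generalizing a b c t with
  | nil => simp [headsU, largeU]
  | cons i is ih =>
    simp only [sx_cons, sw_cons] at ha hc
    rw [headsU, largeU, Multiset.countP_add, ih (by omega) (by omega) (by omega) (by omega)]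
    have := i.root_large_iff (a := a) (b := b) (c := c) (t := t) (s := s) (by omega) (by omega)
      hb ht
    congr 1
    rcases i.place <;> simp only [Multiset.countP_zero, ← Multiset.cons_zero, Multiset.countP_cons,
      this] <;> rcases i.rootLarge <;> rfl

lemma countP_headsV (ha : a + sx is ≤ s + 1) (hc : c + sw is ≤ s + 1) (hb : s < b) (ht : s < t) :
    (headsV is a b c t).countP (s < ·) = largeV is := by
  induction is generalizing a b c t with
  | nil => simp [headsV, largeV]
  | cons i is ih =>
    simp only [sx_cons, sw_cons] at ha hc
    rw [headsV, largeV, Multiset.countP_add, ih (by omega) (by omega) (by omega) (by omega)]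
    have h1 := i.root_large_iff (a := a) (b := b) (c := c) (t := t) (s := s) (by omega) (by omega)
      hb ht
    have h2 := i.leaf_large_iff (a := a) (b := b) (t := t) (s := s) (by omega) hb ht
    congr 1
    rcases i.place <;> simp only [Multiset.countP_zero, ← Multiset.cons_zero, Multiset.countP_cons,
      h1, h2]
    · rcases i.rootLarge <;> rfl
    · rcases i.leafLarge <;> rfl

/-! ### Assembling a labeling from items and pendant edges -/

/-- Pendant edges at `u` with consecutive labels. -/
def singles (m r : ℕ) : Labeling := ⟨(List.range' m r : Multiset ℕ).map fun x => [x], 0, []⟩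

lemma labels_singles (m r : ℕ) : (singles m r).labels = List.range' m r := by
  simp only [singles, labels]
  generalize (List.range' m r : Multiset ℕ) = M
  simp only [Multiset.bind_map, Multiset.coe_singleton, Multiset.zero_bind, add_zero,
    Multiset.coe_nil]
  exact (Multiset.bind_singleton M id).trans (Multiset.map_id M)

lemma inner_singles (m r : ℕ) : (singles m r).inner = 0 := by
  simp only [singles, Labeling.inner]
  generalize (List.range' m r : Multiset ℕ) = M
  simp [Multiset.bind_map]

lemma leaves_singles (m r : ℕ) : (singles m r).leaves = List.range' m r := by
  simp only [singles, leaves]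
  generalize (List.range' m r : Multiset ℕ) = M
  simp [Function.comp_def]

lemma edgesU_singles_append (m r : ℕ) (D : Labeling) :
    ((singles m r).append D).edgesU = List.range' m r + D.edgesU := by
  simp only [edgesU, append, singles, List.nil_append, Multiset.map_add, Multiset.map_map,
    ← Multiset.singleton_add]
  generalize (List.range' m r : Multiset ℕ) = M
  simp [Function.comp_def, add_left_comm, -Multiset.singleton_add]

lemma edgesV_singles_append (m r : ℕ) (D : Labeling) :
    ((singles m r).append D).edgesV = D.edgesV := by
  simp [edgesV, append, singles]

lemma shape_singles_append {m r : ℕ} {D : Labeling} {U V : Multiset ℕ} {l : ℕ}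
    (h : Shape D U V l) :
    Shape ((singles m r).append D) (Multiset.replicate r 1 + U) V l := by
  obtain ⟨rfl, rfl, rfl⟩ := h
  refine ⟨?_, by simp [append, singles], by simp [append, singles]⟩
  simp only [append, singles, Multiset.map_add, Multiset.map_map]
  congr 1
  simp [Multiset.eq_replicate]

lemma wf_singles_append {m r : ℕ} {D : Labeling} (h : D.WF) : ((singles m r).append D).WF := by
  refine ⟨by simpa [append, singles] using h.1, ?_, by simpa [append, singles] using h.2.2⟩
  intro l hl
  simp only [append, singles, Multiset.mem_add, Multiset.mem_map] at hl
  rcases hl with ⟨x, _, rfl⟩ | hl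
  · simp
  · exact h.2.1 l hl

/-- The labeling in which the items use the small, middle, large, and top labels in this order, and
`r` pendant edges at `u` get the labels between the middle and the large ones. -/
def build (is : List Item) (r : ℕ) : Labeling :=
  (singles (sx is + sw is + 1) r).append
    (run is 1 (sx is + sw is + r + 1) (sx is + 1) (sx is + sw is + r + sy is + 1))

/-- The middle pairs in `build`. -/
def buildMid (is : List Item) (r : ℕ) : Multiset (ℕ × ℕ) :=
  midPairs is (sx is + 1) (sx is + sw is + r + sy is + 1)

/-- The top pairs in `build`. -/
def buildTop (is : List Item) (r : ℕ) : Multiset (ℕ × ℕ) :=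
  topPairs is 1 (sx is + sw is + r + 1) (sx is + sw is + r + sy is + 1)

/-- The labels at `u` in `build`, except for the pendant edges. -/
def buildU (is : List Item) (r : ℕ) : Multiset ℕ :=
  headsU is 1 (sx is + sw is + r + 1) (sx is + 1) (sx is + sw is + r + sy is + 1)

/-- The labels at `v` in `build`. -/
def buildV (is : List Item) (r : ℕ) : Multiset ℕ :=
  headsV is 1 (sx is + sw is + r + 1) (sx is + 1) (sx is + sw is + r + sy is + 1)

section build

variable {r : ℕ}

lemma full_build : Full (build is r).labels := by
  intro x hx hx'
  rw [build, labels_append, labels_singles, Multiset.card_add, Multiset.coe_card,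
    List.length_range', card_labels_run] at hx'
  rw [build, labels_append, labels_singles, Multiset.mem_add, Multiset.mem_coe,
    List.mem_range'_1]
  by_cases h : sx is + sw is + 1 ≤ x ∧ x < sx is + sw is + 1 + r
  · exact Or.inl h
  · exact Or.inr (mem_labels_run (by omega))

lemma inner_build (h : cores is = 1) : (build is r).inner =
    chainPairs is 1 (sx is + sw is + r + 1) + (buildMid is r + buildTop is r) := by
  rw [build, inner_append (Or.inl rfl), inner_singles, zero_add, inner_run h.le, add_assoc]
  rfl

/-- The threshold `sx is + sw is + r` sits just below the large labels, so a middle label is small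
and a top label large. The sum already beats the largest small plus the largest large label. -/
lemma mid_build {p : ℕ × ℕ} (h : p ∈ buildMid is r) :
    big (sx is + sw is + r) p = 1 ∧ sx is + (sx is + sw is + r) + sy is < psum p := by
  have := midPairs_bound h
  simp only [big, psum]
  refine ⟨?_, by omega⟩
  split_ifs <;> omega

lemma top_build (hg : ∀ i ∈ is, i.Good) {p : ℕ × ℕ} (h : p ∈ buildTop is r) :
    big (sx is + sw is + r) p = 2 ∧ sx is + (sx is + sw is + r) + sy is < psum p := by
  have := topPairs_bound hg h
  simp only [big, psum]
  refine ⟨?_, by omega⟩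
  split_ifs <;> omega

lemma chain_build {p : ℕ × ℕ} (h : p ∈ chainPairs is 1 (sx is + sw is + r + 1)) :
    big (sx is + sw is + r) p = 1 ∧ sx is + sw is + r < psum p ∧
      psum p ≤ sx is + (sx is + sw is + r) + sy is := by
  have := chainPairs_bound h
  exact ⟨chainPairs_big h (by omega) (by omega), by omega, by omega⟩

lemma nodup_build (hc : cores is = 1) (hg : ∀ i ∈ is, i.Good)
    (hmt : ∀ p ∈ buildMid is r, ∀ q ∈ buildTop is r, psum p < psum q) :
    ((build is r).inner.map psum).Nodup := by
  rw [inner_build hc]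
  refine nodup_attach chainPairs_nodup
    (nodup_attach midPairs_nodup (topPairs_nodup hg) hmt) fun n hn p hp => ?_
  have := chain_build hn
  rcases Multiset.mem_add.1 hp with hp | hp
  · have := mid_build hp; omega
  · have := top_build hg hp; omega

lemma leaf_build (hg : ∀ i ∈ is, i.Good) {x : ℕ} (hx : x ∈ (build is r).leaves) :
    x ≤ sx is + sw is + r := by
  rw [build, leaves_append, leaves_singles, Multiset.mem_add, Multiset.mem_coe,
    List.mem_range'_1] at hx
  rcases hx with hx | hx
  · omega
  · have := leaves_run hg hx
    omega

lemma high_build (hc : cores is = 1) {S : ℕ} (hS : sx is + (sx is + sw is + r) + sy is < S)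
    (hm : ∀ p ∈ buildMid is r, psum p < S) (ht : ∀ p ∈ buildTop is r, psum p < S) :
    ∀ p ∈ (build is r).inner, psum p < S := by
  rw [inner_build hc]
  intro p hp
  rcases Multiset.mem_add.1 hp with hp | hp
  · have := chain_build hp; omega
  rcases Multiset.mem_add.1 hp with hp | hp
  · exact hm p hp
  · exact ht p hp

lemma low_build (hc : cores is = 1) (hg : ∀ i ∈ is, i.Good) {p : ℕ × ℕ}
    (hp : p ∈ (build is r).inner) :
    sx is + sw is + r < psum p ∧ 1 ≤ big (sx is + sw is + r) p := by
  rw [inner_build hc] at hp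
  rcases Multiset.mem_add.1 hp with hp | hp
  · have := chain_build hp; omega
  rcases Multiset.mem_add.1 hp with hp | hp
  · have := mid_build hp; omega
  · have := top_build hg hp; omega

lemma edgesU_build (hc : cores is = 1) :
    (build is r).edgesU = (List.range' (sx is + sw is + 1) r : Multiset ℕ) + buildU is r := by
  rw [build, edgesU_singles_append, map_headD_A_run.2 hc]; rfl

lemma edgesV_build (hc : cores is = 1) : (build is r).edgesV = buildV is r := by
  rw [build, edgesV_singles_append, map_headD_B_run.2 hc]; rfl

/-- The sums come in the order alternating paths, middle pairs, top pairs, with one, one and two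
large entries, which gives both distinctness and the class condition. What depends on the chosen
items is left as hypotheses: middle sums below top sums, and the size of the branch sums. -/
lemma hasInsertable_build (hc : cores is = 1) (hg : ∀ i ∈ is, i.Good)
    (hmt : ∀ p ∈ buildMid is r, ∀ q ∈ buildTop is r, psum p < psum q)
    (hS : sx is + (sx is + sw is + r) + sy is < (buildV is r).sum)
    (hm : ∀ p ∈ buildMid is r, psum p < (buildV is r).sum)
    (ht : ∀ p ∈ buildTop is r, psum p < (buildV is r).sum)
    (hlt : (buildV is r).sum < (List.range' (sx is + sw is + 1) r).sum + (buildU is r).sum)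
    (h1 : 1 ≤ largeV is) (h2 : largeV is ≤ largeU is + 2) :
    HasInsertable (Multiset.replicate r 1 + lensU is) (lensV is) (lensC is) := by
  have hU := edgesU_build (r := r) hc
  have hV := edgesV_build (r := r) hc
  have hnV : (buildV is r).countP (sx is + sw is + r < ·) = largeV is :=
    countP_headsV (by omega) (by omega) (by omega) (by omega)
  have hnU : (buildU is r).countP (sx is + sw is + r < ·) = largeU is :=
    countP_headsU (by omega) (by omega) (by omega) (by omega)
  refine ⟨sx is + sw is + r, build is r, ⟨⟨wf_singles_append (wf_run hc), full_build, ?_,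
    nodup_build hc hg hmt, ?_, fun x hx => leaf_build hg hx, fun p hp => (low_build hc hg hp).1,
    ?_, ?_, ?_, ?_⟩, fun p hp => (low_build hc hg hp).2, ?_, ?_⟩, shape_singles_append shape_run⟩
  · rw [build, labels_append, labels_singles, Multiset.card_add, Multiset.coe_card,
      List.length_range', card_labels_run]
    omega
  · rw [inner_build hc]
    refine cls_attach ?_ (cls_attach ?_ ?_ ?_ hmt) ?_ ?_
    · intro p hp q hq h
      rw [(chain_build hp).1, (chain_build hq).1] at h; omega
    · intro p hp q hq h
      rw [(mid_build hp).1, (mid_build hq).1] at h; omega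
    · intro p hp q hq h
      rw [(top_build hg hp).1, (top_build hg hq).1] at h; omega
    · intro p hp q hq
      rw [(mid_build hp).1, (top_build hg hq).1]; omega
    · intro p hp q hq
      rw [(chain_build hp).1]
      rcases Multiset.mem_add.1 hq with hq | hq
      · rw [(mid_build hq).1]
      · rw [(top_build hg hq).1]; omega
    · intro n hn p hp
      have := chain_build hn
      rcases Multiset.mem_add.1 hp with hp | hp
      · have := mid_build hp; omega
      · have := top_build hg hp; omega
  · rw [hV]; omega
  · rw [hV]; exact high_build hc hS hm ht
  · rw [hU, hV, Multiset.sum_add, Multiset.sum_coe]; exact hlt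
  · rw [hU, hV, Multiset.countP_add, hnV, hnU]; omega
  · rw [hV, hnV]; exact h1
  · rw [hU, hV, Multiset.countP_add, hnV, hnU]; omega

lemma hasBalanced_build (hc : cores is = 1) (hg : ∀ i ∈ is, i.Good)
    (hmt : ∀ p ∈ buildMid is 0, ∀ q ∈ buildTop is 0, psum p < psum q)
    (hS : sx is + (sx is + sw is) + sy is < (buildV is 0).sum)
    (hS' : sx is + (sx is + sw is) + sy is < (buildU is 0).sum)
    (hm : ∀ p ∈ buildMid is 0, psum p < (buildV is 0).sum ∧ psum p < (buildU is 0).sum)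
    (ht : ∀ p ∈ buildTop is 0, psum p < (buildV is 0).sum ∧ psum p < (buildU is 0).sum)
    (hne : (buildV is 0).sum ≠ (buildU is 0).sum) :
    HasBalanced (lensU is) (lensV is) (lensC is) := by
  have hU := edgesU_build (r := 0) hc
  have hV := edgesV_build (r := 0) hc
  rw [List.range'_zero, Multiset.coe_nil, zero_add] at hU
  have hl : ∀ x ∈ (build is 0).leaves, x ≤ sx is + sw is := fun x hx => leaf_build hg hx
  refine ⟨build is 0, ⟨wf_singles_append (wf_run hc), full_build, nodup_build hc hg hmt,
    ?_, ?_, ?_, ?_, ?_, ?_⟩, ?_⟩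
  · intro x hx p hp
    exact (hl x hx).trans_lt (low_build hc hg hp).1
  · rw [hU]
    intro x hx
    have := hl x hx
    omega
  · rw [hV]
    intro x hx
    have := hl x hx
    omega
  · rw [hU]; exact high_build hc hS' (fun p hp => (hm p hp).2) (fun p hp => (ht p hp).2)
  · rw [hV]; exact high_build hc hS (fun p hp => (hm p hp).1) (fun p hp => (ht p hp).1)
  · rw [hU, hV]; exact hne.symm
  · have := shape_singles_append (m := sx is + sw is + 1) (r := 0)
      (shape_run (is := is) (a := 1) (b := sx is + sw is + 0 + 1) (c := sx is + 1)
        (t := sx is + sw is + 0 + sy is + 1))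
    simpa [build] using this

end build

open Labeling

/-! ### Recipes for few legs -/

/-- The conditions under which the items give an insertable labeling. -/
def InsertableCond (is : List Item) : Prop :=
  buildMid is 0 = 0 ∧ sx is + (sx is + sw is) + sy is < (buildV is 0).sum ∧
    (∀ p ∈ buildTop is 0, psum p < (buildV is 0).sum) ∧
    (buildV is 0).sum < (buildU is 0).sum ∧ 1 ≤ largeV is ∧ largeV is ≤ largeU is + 2

/-- The conditions under which the items give a balanced labeling. -/
def BalancedCond (is : List Item) : Prop :=
  buildMid is 0 = 0 ∧ sx is + (sx is + sw is) + sy is < (buildV is 0).sum ∧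
    sx is + (sx is + sw is) + sy is < (buildU is 0).sum ∧
    (∀ p ∈ buildTop is 0, psum p < (buildV is 0).sum ∧ psum p < (buildU is 0).sum) ∧
    (buildV is 0).sum ≠ (buildU is 0).sum

variable {U V : Multiset ℕ} {l : ℕ}

lemma HasInsertable.of_items (is : List Item) (h : InsertableCond is) (hc : cores is = 1)
    (hg : ∀ i ∈ is, i.Good) (hU : lensU is = U) (hV : lensV is = V) (hl : lensC is = l) :
    HasInsertable U V l := by
  subst hU hV hl
  obtain ⟨h1, h2, h3, h4, h5, h6⟩ := h
  simpa using hasInsertable_build (r := 0) hc hg (by simp [h1]) h2 (by simp [h1]) h3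
    (by simpa using h4) h5 h6

lemma HasBalanced.of_items (is : List Item) (h : BalancedCond is) (hc : cores is = 1)
    (hg : ∀ i ∈ is, i.Good) (hU : lensU is = U) (hV : lensV is = V) (hl : lensC is = l) :
    HasBalanced U V l := by
  subst hU hV hl
  obtain ⟨h1, h2, h3, h4, h5⟩ := h
  exact hasBalanced_build hc hg (by simp [h1]) h2 h3 (by simp [h1]) h4 h5

lemma full_of_forall {M : Multiset ℕ} (h : ∀ x ∈ Finset.Icc 1 M.card, x ∈ M) : Full M :=
  fun x h1 h2 => h x (Finset.mem_Icc.2 ⟨h1, h2⟩)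

section recipes

attribute [local simp] Item.hd Item.tl Item.x Item.y Item.z Item.w Item.root Item.leaf
  Item.hdLarge Item.tlLarge Item.rootLarge Item.leafLarge Item.mids Item.tops Item.len Item.Good
  lensU lensV lensC cores_cons headsU headsV largeU largeV buildU buildV buildMid buildTop
  midPairs topPairs psum

attribute [-simp] Multiset.singleton_add

/-- The names of the recipes list the parities (odd or even) of the legs at `u`, of the legs at `v`,
and of the middle path. A recipe is an order in which the paths consume the labels. All conditions
then become linear inequalities in the half-lengths. The last hypothesis excludes the spider of
`plain_small`. -/
lemma insertable_ooo_ee_o {a b c d e f : ℕ} (h1 : a = 0) (h2 : b ≤ c) (h3 : d ≤ e)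
    (h4 : a + b + c + d + e + f ≠ 0) :
    HasInsertable ({2 * a + 1} + {2 * b + 1} + {2 * c + 1}) ({2 * d + 2} + {2 * e + 2})
      (2 * f + 1) := by
  by_cases h1' : InsertableCond
    [⟨.atV, .none, false, false, false, d⟩, ⟨.atV, .none, false, false, false, e⟩,
      ⟨.core, .none, false, true, true, f⟩, ⟨.atU, .none, true, true, true, c⟩,
      ⟨.atU, .none, true, true, true, b⟩, ⟨.atU, .none, true, false, true, a⟩]
  · refine .of_items _ h1' ?_ ?_ ?_ ?_ ?_ <;> simp <;>
      first | omega | (ring_nf; done) | (ring_nf; abel)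
  -- The failure of the first recipe is a linear inequality among the half-lengths, and the later
  -- recipes are checked under it.
  simp [InsertableCond] at h1'
  by_cases h2' : InsertableCond
    [⟨.atV, .none, false, false, false, d⟩, ⟨.atV, .none, false, false, false, e⟩,
      ⟨.core, .none, true, false, true, f⟩, ⟨.atU, .none, true, true, true, c⟩,
      ⟨.atU, .none, true, true, true, a⟩, ⟨.atU, .none, true, false, true, b⟩]
  · refine .of_items _ h2' ?_ ?_ ?_ ?_ ?_ <;> simp <;>
      first | omega | (ring_nf; done) | (ring_nf; abel)
  simp [InsertableCond] at h2'
  refine .of_items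
    [⟨.atV, .none, false, false, false, d⟩, ⟨.atV, .none, true, true, false, e⟩,
      ⟨.core, .none, true, false, true, f⟩, ⟨.atU, .none, true, true, true, c⟩,
      ⟨.atU, .none, true, true, true, b⟩, ⟨.atU, .none, true, true, true, a⟩]
    ?_ ?_ ?_ ?_ ?_ ?_ <;> simp [InsertableCond] <;> first | omega | (ring_nf; done) | (ring_nf; abel)

lemma insertable_ooo_oe_o {a b c d e f : ℕ} (h2 : a ≤ b) (h3 : b ≤ c) :
    HasInsertable ({2 * a + 1} + {2 * b + 1} + {2 * c + 1}) ({2 * d + 1} + {2 * e + 2})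
      (2 * f + 1) := by
  refine .of_items
    [⟨.atU, .none, true, true, true, c⟩, ⟨.atV, .none, true, false, true, d⟩,
      ⟨.atV, .none, false, false, false, e⟩, ⟨.core, .none, false, false, true, f⟩,
      ⟨.atU, .none, true, false, true, a⟩, ⟨.atU, .none, true, true, true, b⟩]
    ?_ ?_ ?_ ?_ ?_ ?_ <;> simp [InsertableCond] <;> first | omega | (ring_nf; done) | (ring_nf; abel)

lemma insertable_ooe_oo_o {a b c d e f : ℕ} (h2 : a ≤ b) (h3 : d ≤ e) :
    HasInsertable ({2 * a + 1} + {2 * b + 1} + {2 * c + 2}) ({2 * d + 1} + {2 * e + 1})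
      (2 * f + 1) := by
  refine .of_items
    [⟨.atU, .none, false, false, false, c⟩, ⟨.atU, .none, true, true, true, b⟩,
      ⟨.atV, .none, true, true, true, e⟩, ⟨.core, .none, false, false, true, f⟩,
      ⟨.atU, .none, true, false, true, a⟩, ⟨.atV, .none, true, true, true, d⟩]
    ?_ ?_ ?_ ?_ ?_ ?_ <;> simp [InsertableCond] <;> first | omega | (ring_nf; done) | (ring_nf; abel)

lemma insertable_ooe_oe_o {a b c d e f : ℕ} (h2 : a ≤ b) :
    HasInsertable ({2 * a + 1} + {2 * b + 1} + {2 * c + 2}) ({2 * d + 1} + {2 * e + 2})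
      (2 * f + 1) := by
  refine .of_items
    [⟨.core, .none, false, false, true, f⟩, ⟨.atU, .none, true, false, true, b⟩,
      ⟨.atU, .none, true, true, false, c⟩, ⟨.atV, .none, true, false, true, d⟩,
      ⟨.atV, .none, true, true, false, e⟩, ⟨.atU, .none, true, true, true, a⟩]
    ?_ ?_ ?_ ?_ ?_ ?_ <;> simp [InsertableCond] <;> first | omega | (ring_nf; done) | (ring_nf; abel)

lemma insertable_ooe_ee_o {a b c d e f : ℕ} (h1 : a = 0) :
    HasInsertable ({2 * a + 1} + {2 * b + 1} + {2 * c + 2}) ({2 * d + 2} + {2 * e + 2})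
      (2 * f + 1) := by
  refine .of_items
    [⟨.atV, .none, false, false, false, d⟩, ⟨.atU, .none, true, false, true, a⟩,
      ⟨.atV, .none, true, true, false, e⟩, ⟨.atU, .none, true, true, true, b⟩,
      ⟨.core, .none, false, true, true, f⟩, ⟨.atU, .none, true, true, false, c⟩]
    ?_ ?_ ?_ ?_ ?_ ?_ <;> simp [InsertableCond] <;> first | omega | (ring_nf; done) | (ring_nf; abel)

lemma insertable_oee_oo_o {a b c d e f : ℕ} (h2 : b ≤ c) (h3 : d ≤ e) :
    HasInsertable ({2 * a + 1} + {2 * b + 2} + {2 * c + 2}) ({2 * d + 1} + {2 * e + 1})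
      (2 * f + 1) := by
  refine .of_items
    [⟨.atU, .none, true, true, false, c⟩, ⟨.atU, .none, false, false, false, b⟩,
      ⟨.atU, .none, true, false, true, a⟩, ⟨.atV, .none, true, true, true, e⟩,
      ⟨.core, .none, false, false, true, f⟩, ⟨.atV, .none, true, true, true, d⟩]
    ?_ ?_ ?_ ?_ ?_ ?_ <;> simp [InsertableCond] <;> first | omega | (ring_nf; done) | (ring_nf; abel)

lemma insertable_oee_oe_o {a b c d e f : ℕ} :
    HasInsertable ({2 * a + 1} + {2 * b + 2} + {2 * c + 2}) ({2 * d + 1} + {2 * e + 2})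
      (2 * f + 1) := by
  refine .of_items
    [⟨.atU, .none, false, false, false, b⟩, ⟨.atV, .none, true, true, true, d⟩,
      ⟨.core, .none, false, true, true, f⟩, ⟨.atU, .none, false, false, false, c⟩,
      ⟨.atU, .none, true, true, true, a⟩, ⟨.atV, .none, true, true, false, e⟩]
    ?_ ?_ ?_ ?_ ?_ ?_ <;> simp [InsertableCond] <;> first | omega | (ring_nf; done) | (ring_nf; abel)

lemma insertable_oee_ee_o {a b c d e f : ℕ} (h1 : a = 0) :
    HasInsertable ({2 * a + 1} + {2 * b + 2} + {2 * c + 2}) ({2 * d + 2} + {2 * e + 2})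
      (2 * f + 1) := by
  refine .of_items
    [⟨.atV, .none, false, false, false, d⟩, ⟨.atU, .none, true, true, true, a⟩,
      ⟨.atU, .none, true, true, false, c⟩, ⟨.atV, .none, true, true, false, e⟩,
      ⟨.core, .none, false, false, true, f⟩, ⟨.atU, .none, false, false, false, b⟩]
    ?_ ?_ ?_ ?_ ?_ ?_ <;> simp [InsertableCond] <;> first | omega | (ring_nf; done) | (ring_nf; abel)

lemma insertable_eee_oo_o {a b c d e f : ℕ} (h1 : d = 0) (h4 : b ≤ c) (h3 : d ≤ e) :
    HasInsertable ({2 * a + 2} + {2 * b + 2} + {2 * c + 2}) ({2 * d + 1} + {2 * e + 1})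
      (2 * f + 1) := by
  refine .of_items
    [⟨.atU, .none, false, false, false, a⟩, ⟨.atU, .none, false, false, false, c⟩,
      ⟨.core, .none, false, true, true, f⟩, ⟨.atV, .none, true, true, true, e⟩,
      ⟨.atU, .none, false, false, false, b⟩, ⟨.atV, .none, true, false, true, d⟩]
    ?_ ?_ ?_ ?_ ?_ ?_ <;> simp [InsertableCond] <;> first | omega | (ring_nf; done) | (ring_nf; abel)

lemma insertable_eee_oe_o {a b c d e f : ℕ} (h1 : d = 0) (h2 : a ≤ b) :
    HasInsertable ({2 * a + 2} + {2 * b + 2} + {2 * c + 2}) ({2 * d + 1} + {2 * e + 2})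
      (2 * f + 1) := by
  refine .of_items
    [⟨.atU, .none, false, false, false, b⟩, ⟨.core, .none, false, false, true, f⟩,
      ⟨.atU, .none, true, true, false, c⟩, ⟨.atV, .none, false, false, false, e⟩,
      ⟨.atV, .none, true, false, true, d⟩, ⟨.atU, .none, true, true, false, a⟩]
    ?_ ?_ ?_ ?_ ?_ ?_ <;> simp [InsertableCond] <;> first | omega | (ring_nf; done) | (ring_nf; abel)

lemma insertable_ooo_oe_e {a b c d e f : ℕ} (h2 : a ≤ b) (h3 : b ≤ c) :
    HasInsertable ({2 * a + 1} + {2 * b + 1} + {2 * c + 1}) ({2 * d + 1} + {2 * e + 2})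
      (2 * f + 2) := by
  refine .of_items
    [⟨.core, .back, false, true, true, f⟩, ⟨.atV, .none, true, false, true, d⟩,
      ⟨.atV, .none, true, true, false, e⟩, ⟨.atU, .none, true, true, true, c⟩,
      ⟨.atU, .none, true, true, true, b⟩, ⟨.atU, .none, true, true, true, a⟩]
    ?_ ?_ ?_ ?_ ?_ ?_ <;> simp [InsertableCond] <;> first | omega | (ring_nf; done) | (ring_nf; abel)

lemma insertable_ooo_ee_e {a b c d e f : ℕ} (h1 : a = 0) (h2 : b ≤ c) :
    HasInsertable ({2 * a + 1} + {2 * b + 1} + {2 * c + 1}) ({2 * d + 2} + {2 * e + 2})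
      (2 * f + 2) := by
  refine .of_items
    [⟨.core, .none, true, true, false, f⟩, ⟨.atU, .none, true, true, true, c⟩,
      ⟨.atV, .none, false, false, false, d⟩, ⟨.atV, .none, true, true, false, e⟩,
      ⟨.atU, .none, true, false, true, b⟩, ⟨.atU, .none, true, false, true, a⟩]
    ?_ ?_ ?_ ?_ ?_ ?_ <;> simp [InsertableCond] <;> first | omega | (ring_nf; done) | (ring_nf; abel)

lemma insertable_ooe_oo_e {a b c d e f : ℕ} (h2 : a ≤ b) :
    HasInsertable ({2 * a + 1} + {2 * b + 1} + {2 * c + 2}) ({2 * d + 1} + {2 * e + 1})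
      (2 * f + 2) := by
  refine .of_items
    [⟨.core, .back, false, true, true, f⟩, ⟨.atU, .none, true, false, true, b⟩,
      ⟨.atU, .none, true, true, false, c⟩, ⟨.atV, .none, true, false, true, d⟩,
      ⟨.atV, .none, true, true, true, e⟩, ⟨.atU, .none, true, true, true, a⟩]
    ?_ ?_ ?_ ?_ ?_ ?_ <;> simp [InsertableCond] <;> first | omega | (ring_nf; done) | (ring_nf; abel)

lemma insertable_ooe_oe_e {a b c d e f : ℕ} (h2 : a ≤ b) :
    HasInsertable ({2 * a + 1} + {2 * b + 1} + {2 * c + 2}) ({2 * d + 1} + {2 * e + 2})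
      (2 * f + 2) := by
  refine .of_items
    [⟨.atU, .none, true, false, true, b⟩, ⟨.core, .front, false, true, true, f⟩,
      ⟨.atV, .none, true, true, true, d⟩, ⟨.atU, .none, false, false, false, c⟩,
      ⟨.atU, .none, true, true, true, a⟩, ⟨.atV, .none, true, true, false, e⟩]
    ?_ ?_ ?_ ?_ ?_ ?_ <;> simp [InsertableCond] <;> first | omega | (ring_nf; done) | (ring_nf; abel)

lemma insertable_ooe_ee_e {a b c d e f : ℕ} (h1 : a = 0) :
    HasInsertable ({2 * a + 1} + {2 * b + 1} + {2 * c + 2}) ({2 * d + 2} + {2 * e + 2})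
      (2 * f + 2) := by
  refine .of_items
    [⟨.atU, .none, false, false, false, c⟩, ⟨.core, .none, true, true, false, f⟩,
      ⟨.atV, .none, true, true, false, e⟩, ⟨.atU, .none, true, true, true, b⟩,
      ⟨.atV, .none, true, true, false, d⟩, ⟨.atU, .none, true, false, true, a⟩]
    ?_ ?_ ?_ ?_ ?_ ?_ <;> simp [InsertableCond] <;> first | omega | (ring_nf; done) | (ring_nf; abel)

lemma insertable_oee_oo_e {a b c d e f : ℕ} (h2 : b ≤ c) (h3 : d ≤ e) :
    HasInsertable ({2 * a + 1} + {2 * b + 2} + {2 * c + 2}) ({2 * d + 1} + {2 * e + 1})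
      (2 * f + 2) := by
  refine .of_items
    [⟨.atU, .none, false, false, false, c⟩, ⟨.atV, .none, true, true, true, e⟩,
      ⟨.atU, .none, true, true, true, a⟩, ⟨.core, .none, true, false, false, f⟩,
      ⟨.atU, .none, true, true, false, b⟩, ⟨.atV, .none, true, true, true, d⟩]
    ?_ ?_ ?_ ?_ ?_ ?_ <;> simp [InsertableCond] <;> first | omega | (ring_nf; done) | (ring_nf; abel)

lemma insertable_oee_oe_e {a b c d e f : ℕ} (h2 : b ≤ c) :
    HasInsertable ({2 * a + 1} + {2 * b + 2} + {2 * c + 2}) ({2 * d + 1} + {2 * e + 2})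
      (2 * f + 2) := by
  refine .of_items
    [⟨.atU, .none, true, true, true, a⟩, ⟨.atV, .none, true, true, true, d⟩,
      ⟨.atU, .none, true, true, false, c⟩, ⟨.atV, .none, false, false, false, e⟩,
      ⟨.core, .none, true, false, false, f⟩, ⟨.atU, .none, false, false, false, b⟩]
    ?_ ?_ ?_ ?_ ?_ ?_ <;> simp [InsertableCond] <;> first | omega | (ring_nf; done) | (ring_nf; abel)

lemma insertable_oee_ee_e {a b c d e f : ℕ} (h1 : a = 0) :
    HasInsertable ({2 * a + 1} + {2 * b + 2} + {2 * c + 2}) ({2 * d + 2} + {2 * e + 2})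
      (2 * f + 2) := by
  refine .of_items
    [⟨.atU, .none, true, true, true, a⟩, ⟨.atU, .none, true, true, false, b⟩,
      ⟨.atU, .none, true, true, false, c⟩, ⟨.atV, .none, false, false, false, d⟩,
      ⟨.atV, .none, true, true, false, e⟩, ⟨.core, .none, false, false, false, f⟩]
    ?_ ?_ ?_ ?_ ?_ ?_ <;> simp [InsertableCond] <;> first | omega | (ring_nf; done) | (ring_nf; abel)

lemma insertable_eee_oo_e {a b c d e f : ℕ} (h1 : d = 0) (h3 : d ≤ e) :
    HasInsertable ({2 * a + 2} + {2 * b + 2} + {2 * c + 2}) ({2 * d + 1} + {2 * e + 1})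
      (2 * f + 2) := by
  refine .of_items
    [⟨.atU, .none, false, false, false, b⟩, ⟨.atU, .none, false, false, false, a⟩,
      ⟨.atV, .none, true, true, true, e⟩, ⟨.atU, .none, true, true, false, c⟩,
      ⟨.core, .none, true, false, false, f⟩, ⟨.atV, .none, true, false, true, d⟩]
    ?_ ?_ ?_ ?_ ?_ ?_ <;> simp [InsertableCond] <;> first | omega | (ring_nf; done) | (ring_nf; abel)

lemma insertable_eee_oe_e {a b c d e f : ℕ} (h1 : d = 0) :
    HasInsertable ({2 * a + 2} + {2 * b + 2} + {2 * c + 2}) ({2 * d + 1} + {2 * e + 2})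
      (2 * f + 2) := by
  refine .of_items
    [⟨.atU, .none, true, true, false, a⟩, ⟨.atU, .none, false, false, false, b⟩,
      ⟨.atV, .none, true, true, false, e⟩, ⟨.atU, .none, false, false, false, c⟩,
      ⟨.core, .none, false, false, false, f⟩, ⟨.atV, .none, true, true, true, d⟩]
    ?_ ?_ ?_ ?_ ?_ ?_ <;> simp [InsertableCond] <;> first | omega | (ring_nf; done) | (ring_nf; abel)

/-- An odd leg of length at least three is treated as an even alternating path with a top label in
front, which gives `u` a very large label. -/
lemma insertable_ooo_oo_o_of_pos {a b c d e f : ℕ} (h2 : a ≤ b)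
    (h3 : d ≤ e) :
    HasInsertable ({2 * a + 1} + {2 * b + 1} + {2 * (c + 1) + 1}) ({2 * d + 1} + {2 * e + 1})
      (2 * f + 1) := by
  refine .of_items
    [⟨.atU, .front, true, true, false, c⟩, ⟨.atU, .none, true, false, true, b⟩,
      ⟨.atV, .none, true, true, true, e⟩, ⟨.atU, .none, true, false, true, a⟩,
      ⟨.core, .none, false, false, true, f⟩, ⟨.atV, .none, true, true, true, d⟩]
    ?_ ?_ ?_ ?_ ?_ ?_ <;> simp [InsertableCond] <;> first | omega | (ring_nf; done) | (ring_nf; abel)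

lemma insertable_ooo_oo_o_of_zero {a b c d e f : ℕ} (h1 : a = 0) (h2 : b = 0) (h4 : c = 0)
    (h3 : d ≤ e) :
    HasInsertable ({2 * a + 1} + {2 * b + 1} + {2 * c + 1}) ({2 * d + 1} + {2 * e + 1})
      (2 * f + 1) := by
  refine .of_items
    [⟨.atU, .none, true, true, true, c⟩, ⟨.atV, .none, true, true, true, e⟩,
      ⟨.core, .none, false, false, true, f⟩, ⟨.atU, .none, true, true, true, a⟩,
      ⟨.atV, .none, true, true, true, d⟩, ⟨.atU, .none, true, true, true, b⟩]
    ?_ ?_ ?_ ?_ ?_ ?_ <;> simp [InsertableCond] <;> first | omega | (ring_nf; done) | (ring_nf; abel)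

lemma insertable_ooo_oo_e_of_pos {a b c d e f : ℕ} (h2 : a ≤ b)
    (h3 : d ≤ e) :
    HasInsertable ({2 * a + 1} + {2 * b + 1} + {2 * (c + 1) + 1}) ({2 * d + 1} + {2 * e + 1})
      (2 * f + 2) := by
  refine .of_items
    [⟨.atU, .front, true, true, false, c⟩, ⟨.atU, .none, true, true, true, b⟩,
      ⟨.atV, .none, true, true, true, e⟩, ⟨.core, .none, true, false, false, f⟩,
      ⟨.atU, .none, true, true, true, a⟩, ⟨.atV, .none, true, true, true, d⟩]
    ?_ ?_ ?_ ?_ ?_ ?_ <;> simp [InsertableCond] <;> first | omega | (ring_nf; done) | (ring_nf; abel)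

lemma insertable_ooo_oo_e_of_zero {a b c d e f : ℕ} (h1 : a = 0) (h2 : b = 0) (h4 : c = 0)
    (h3 : d ≤ e + 1) :
    HasInsertable ({2 * a + 1} + {2 * b + 1} + {2 * c + 1}) ({2 * d + 1} + {2 * (e + 1) + 1})
      (2 * f + 2) := by
  refine .of_items
    [⟨.atV, .front, false, false, false, e⟩, ⟨.atU, .none, true, true, true, c⟩,
      ⟨.atU, .none, true, false, true, a⟩, ⟨.core, .none, true, true, false, f⟩,
      ⟨.atV, .none, true, false, true, d⟩, ⟨.atU, .none, true, false, true, b⟩]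
    ?_ ?_ ?_ ?_ ?_ ?_ <;> simp [InsertableCond] <;> first | omega | (ring_nf; done) | (ring_nf; abel)

lemma insertable_ooo_oo_e_of_zero' {a b c d e f : ℕ} (h4 : c = 0) (h3 : d = 0)
    (h5 : e = 0) (h6 : f ≠ 0) :
    HasInsertable ({2 * a + 1} + {2 * b + 1} + {2 * c + 1}) ({2 * d + 1} + {2 * e + 1})
      (2 * f + 2) := by
  refine .of_items
    [⟨.core, .back, false, true, true, f⟩, ⟨.atV, .none, true, true, true, e⟩,
      ⟨.atU, .none, true, false, true, a⟩, ⟨.atU, .none, true, true, true, b⟩,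
      ⟨.atU, .none, true, true, true, c⟩, ⟨.atV, .none, true, true, true, d⟩]
    ?_ ?_ ?_ ?_ ?_ ?_ <;> simp [InsertableCond] <;> first | omega | (ring_nf; done) | (ring_nf; abel)

/-- In the balanced recipes one leg at `v` is a single edge. The names list the parities of the legs
at `u`, of the other leg at `v`, and of the middle path. -/
lemma balanced_oo_o_o_of_pos {a b d e : ℕ} (h1 : a ≤ b + 1) :
    HasBalanced ({2 * a + 1} + {2 * (b + 1) + 1}) ({1} + {2 * d + 1})
      (2 * e + 1) := by
  refine .of_items
    [⟨.atU, .front, true, true, false, b⟩, ⟨.core, .none, false, true, true, e⟩,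
      ⟨.atU, .none, true, true, true, a⟩, ⟨.atV, .none, true, true, true, d⟩,
      ⟨.atV, .none, true, true, true, 0⟩]
    ?_ ?_ ?_ ?_ ?_ ?_ <;> simp [BalancedCond] <;> first | omega | (ring_nf; done) | (ring_nf; abel)

lemma balanced_oo_o_o_of_zero {a b d e : ℕ} (h1 : a = 0) (h2 : b = 0) (h3 : d + e ≠ 0) :
    HasBalanced ({2 * a + 1} + {2 * b + 1}) ({1} + {2 * d + 1})
      (2 * e + 1) := by
  by_cases h1' : BalancedCond
    [⟨.atV, .none, true, false, true, d⟩, ⟨.core, .none, false, false, true, e⟩,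
      ⟨.atU, .none, true, true, true, a⟩, ⟨.atU, .none, true, true, true, b⟩,
      ⟨.atV, .none, true, true, true, 0⟩]
  · refine .of_items _ h1' ?_ ?_ ?_ ?_ ?_ <;> simp <;>
      first | omega | (ring_nf; done) | (ring_nf; abel)
  simp [BalancedCond] at h1'
  refine .of_items
    [⟨.core, .none, false, true, true, e⟩, ⟨.atV, .none, true, true, true, d⟩,
      ⟨.atU, .none, true, true, true, a⟩, ⟨.atU, .none, true, true, true, b⟩,
      ⟨.atV, .none, true, true, true, 0⟩]
    ?_ ?_ ?_ ?_ ?_ ?_ <;> simp [BalancedCond] <;> first | omega | (ring_nf; done) | (ring_nf; abel)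

lemma balanced_oe_o_o {a b d e : ℕ} :
    HasBalanced ({2 * a + 1} + {2 * b + 2}) ({1} + {2 * d + 1})
      (2 * e + 1) := by
  by_cases h1' : BalancedCond
    [⟨.atV, .none, true, false, true, d⟩, ⟨.atU, .none, true, true, false, b⟩,
      ⟨.atU, .none, true, true, true, a⟩, ⟨.core, .none, false, false, true, e⟩,
      ⟨.atV, .none, true, true, true, 0⟩]
  · refine .of_items _ h1' ?_ ?_ ?_ ?_ ?_ <;> simp <;>
      first | omega | (ring_nf; done) | (ring_nf; abel)
  simp [BalancedCond] at h1'
  refine .of_items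
    [⟨.core, .none, false, false, true, e⟩, ⟨.atU, .none, true, true, false, b⟩,
      ⟨.atU, .none, true, true, true, a⟩, ⟨.atV, .none, true, true, true, 0⟩,
      ⟨.atV, .none, true, true, true, d⟩]
    ?_ ?_ ?_ ?_ ?_ ?_ <;> simp [BalancedCond] <;> first | omega | (ring_nf; done) | (ring_nf; abel)

lemma balanced_ee_o_o {a b d e : ℕ} (h1 : a ≤ b) :
    HasBalanced ({2 * a + 2} + {2 * b + 2}) ({1} + {2 * d + 1})
      (2 * e + 1) := by
  refine .of_items
    [⟨.atU, .none, true, true, false, b⟩, ⟨.atV, .none, true, true, true, d⟩,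
      ⟨.core, .none, false, false, true, e⟩, ⟨.atU, .none, true, true, false, a⟩,
      ⟨.atV, .none, true, true, true, 0⟩]
    ?_ ?_ ?_ ?_ ?_ ?_ <;> simp [BalancedCond] <;> first | omega | (ring_nf; done) | (ring_nf; abel)

lemma balanced_oo_e_o {a b d e : ℕ} (h1 : a ≤ b) :
    HasBalanced ({2 * a + 1} + {2 * b + 1}) ({1} + {2 * d + 2})
      (2 * e + 1) := by
  refine .of_items
    [⟨.atV, .none, true, true, false, d⟩, ⟨.atU, .none, true, true, true, b⟩,
      ⟨.core, .none, false, true, true, e⟩, ⟨.atU, .none, true, true, true, a⟩,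
      ⟨.atV, .none, true, true, true, 0⟩]
    ?_ ?_ ?_ ?_ ?_ ?_ <;> simp [BalancedCond] <;> first | omega | (ring_nf; done) | (ring_nf; abel)

lemma balanced_oe_e_o {a b d e : ℕ} :
    HasBalanced ({2 * a + 1} + {2 * b + 2}) ({1} + {2 * d + 2})
      (2 * e + 1) := by
  refine .of_items
    [⟨.core, .none, false, false, true, e⟩, ⟨.atV, .none, true, true, false, d⟩,
      ⟨.atU, .none, true, false, true, a⟩, ⟨.atU, .none, true, true, false, b⟩,
      ⟨.atV, .none, true, true, true, 0⟩]
    ?_ ?_ ?_ ?_ ?_ ?_ <;> simp [BalancedCond] <;> first | omega | (ring_nf; done) | (ring_nf; abel)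

lemma balanced_ee_e_o {a b d e : ℕ} :
    HasBalanced ({2 * a + 2} + {2 * b + 2}) ({1} + {2 * d + 2})
      (2 * e + 1) := by
  refine .of_items
    [⟨.atU, .none, true, true, false, a⟩, ⟨.atU, .none, true, true, false, b⟩,
      ⟨.atV, .none, true, true, true, 0⟩, ⟨.atV, .none, true, true, false, d⟩,
      ⟨.core, .none, false, false, true, e⟩]
    ?_ ?_ ?_ ?_ ?_ ?_ <;> simp [BalancedCond] <;> first | omega | ring_nf

lemma balanced_oe_o_e {a b d e : ℕ} :
    HasBalanced ({2 * a + 1} + {2 * b + 2}) ({1} + {2 * d + 1})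
      (2 * e + 2) := by
  refine .of_items
    [⟨.core, .back, false, true, true, e⟩, ⟨.atU, .none, true, true, false, b⟩,
      ⟨.atV, .none, true, false, true, d⟩, ⟨.atU, .none, true, true, true, a⟩,
      ⟨.atV, .none, true, true, true, 0⟩]
    ?_ ?_ ?_ ?_ ?_ ?_ <;> simp [BalancedCond] <;> first | omega | (ring_nf; done) | (ring_nf; abel)

lemma balanced_ee_o_e {a b d e : ℕ} (h1 : a ≤ b) :
    HasBalanced ({2 * a + 2} + {2 * b + 2}) ({1} + {2 * d + 1})
      (2 * e + 2) := by
  refine .of_items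
    [⟨.atU, .none, true, true, false, b⟩, ⟨.atV, .none, true, true, true, d⟩,
      ⟨.core, .none, true, false, false, e⟩, ⟨.atU, .none, true, true, false, a⟩,
      ⟨.atV, .none, true, true, true, 0⟩]
    ?_ ?_ ?_ ?_ ?_ ?_ <;> simp [BalancedCond] <;> first | omega | (ring_nf; done) | (ring_nf; abel)

lemma balanced_oo_e_e_of_zero {a b d e : ℕ} (h1 : a = 0) (h2 : b = 0) :
    HasBalanced ({2 * a + 1} + {2 * b + 1}) ({1} + {2 * d + 2})
      (2 * e + 2) := by
  by_cases h1' : BalancedCond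
    [⟨.core, .front, false, false, true, e⟩, ⟨.atV, .none, true, true, false, d⟩,
      ⟨.atU, .none, true, false, true, a⟩, ⟨.atU, .none, true, true, true, b⟩,
      ⟨.atV, .none, true, true, true, 0⟩]
  · refine .of_items _ h1' ?_ ?_ ?_ ?_ ?_ <;> simp <;>
      first | omega | (ring_nf; done) | (ring_nf; abel)
  simp [BalancedCond] at h1'
  refine .of_items
    [⟨.atV, .none, true, true, false, d⟩, ⟨.atV, .none, true, true, true, 0⟩,
      ⟨.atU, .none, true, true, true, a⟩, ⟨.atU, .none, true, true, true, b⟩,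
      ⟨.core, .none, false, false, false, e⟩]
    ?_ ?_ ?_ ?_ ?_ ?_ <;> simp [BalancedCond] <;> first | omega | (ring_nf; done) | (ring_nf; abel)

lemma balanced_oo_o_e_of_pos {a b d e : ℕ} (h1 : a ≤ b + 1) (h2 : d = 0 → a + 1 ≤ b)
    (h3 : d = 1 → a ≤ b) :
    HasBalanced ({2 * a + 1} + {2 * (b + 1) + 1}) ({1} + {2 * d + 1})
      (2 * e + 2) := by
  refine .of_items
    [⟨.atU, .front, false, false, false, b⟩, ⟨.atV, .none, true, true, true, d⟩,
      ⟨.core, .none, true, false, false, e⟩, ⟨.atU, .none, true, true, true, a⟩,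
      ⟨.atV, .none, true, true, true, 0⟩]
    ?_ ?_ ?_ ?_ ?_ ?_ <;> simp [BalancedCond] <;> first | omega | (ring_nf; done) | (ring_nf; abel)

lemma balanced_oo_o_e_of_two_le {a b d e : ℕ} (h1 : 2 ≤ b)
    (h2 : d = 0 ∧ b ≤ a + 2 ∨ d = 1 ∧ b = a + 1) :
    HasBalanced ({2 * (a + 1) + 1} + {2 * b + 1}) ({1} + {2 * d + 1})
      (2 * e + 2) := by
  refine .of_items
    [⟨.atU, .front, false, false, false, a⟩, ⟨.atU, .none, true, true, true, b⟩,
      ⟨.core, .none, false, true, false, e⟩, ⟨.atV, .none, true, true, true, 0⟩,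
      ⟨.atV, .none, true, true, true, d⟩]
    ?_ ?_ ?_ ?_ ?_ ?_ <;> simp [BalancedCond] <;> first | omega | ring_nf

lemma balanced_oo_o_e_of_one {a b d e : ℕ} (h1 : b = 1)
    (h2 : a = 0 ∧ d = 0 ∧ 2 ≤ e ∨ a = 1 ∧ d = 0 ∧ 2 ≤ e ∨ a = 1 ∧ d = 1 ∧ 3 ≤ e) :
    HasBalanced ({2 * a + 1} + {2 * b + 1}) ({1} + {2 * d + 1})
      (2 * e + 2) := by
  refine .of_items
    [⟨.core, .front, false, false, true, e⟩, ⟨.atU, .none, true, true, true, b⟩,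
      ⟨.atU, .none, true, true, true, a⟩, ⟨.atV, .none, true, true, true, 0⟩,
      ⟨.atV, .none, true, true, true, d⟩]
    ?_ ?_ ?_ ?_ ?_ ?_ <;> simp [BalancedCond] <;> first | omega | (ring_nf; done) | (ring_nf; abel)

lemma balanced_oo_o_e_of_one' {a b d e : ℕ} (h1 : b = 1) (h2 : a = 0)
    (h3 : d = 0 ∧ e = 0 ∨ d = 1 ∧ e ≤ 1) :
    HasBalanced ({2 * (a + 1) + 1} + {2 * b + 1}) ({1} + {2 * d + 1})
      (2 * e + 2) := by
  refine .of_items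
    [⟨.atU, .front, true, true, false, a⟩, ⟨.atU, .none, true, true, true, b⟩,
      ⟨.atV, .none, true, true, true, d⟩, ⟨.core, .none, false, true, false, e⟩,
      ⟨.atV, .none, true, true, true, 0⟩]
    ?_ ?_ ?_ ?_ ?_ ?_ <;> simp [BalancedCond] <;> first | omega | (ring_nf; done) | (ring_nf; abel)

lemma balanced_oo_o_e_of_one_one {a b d e : ℕ} (h1 : a = 1) (h2 : b = 1) (h4 : e = 2) :
    HasBalanced ({2 * a + 1} + {2 * b + 1}) ({1} + {2 * d + 1})
      (2 * e + 2) := by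
  refine .of_items
    [⟨.core, .front, false, false, true, e⟩, ⟨.atU, .none, true, true, true, a⟩,
      ⟨.atV, .none, true, true, true, d⟩, ⟨.atU, .none, true, true, true, b⟩,
      ⟨.atV, .none, true, true, true, 0⟩]
    ?_ ?_ ?_ ?_ ?_ ?_ <;> simp [BalancedCond] <;> first | omega | (ring_nf; done) | (ring_nf; abel)

lemma balanced_oo_o_e_of_zero {a b d e : ℕ} (h1 : a = 0) (h2 : b = 0)
    (h3 : d ≠ 3) (h4 : 2 ≤ d + e) (h5 : d = 1 → e ≠ 1) (h6 : d = 2 → e ≠ 0) :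
    HasBalanced ({2 * a + 1} + {2 * b + 1}) ({1} + {2 * d + 1})
      (2 * e + 2) := by
  by_cases h1' : BalancedCond
    [⟨.core, .back, false, true, true, e⟩, ⟨.atV, .none, true, true, true, d⟩,
      ⟨.atV, .none, true, true, true, 0⟩, ⟨.atU, .none, true, true, true, a⟩,
      ⟨.atU, .none, true, true, true, b⟩]
  · refine .of_items _ h1' ?_ ?_ ?_ ?_ ?_ <;> simp <;>
      first | omega | (ring_nf; done) | (ring_nf; abel)
  simp [BalancedCond] at h1'
  refine .of_items
    [⟨.core, .front, false, false, true, e⟩, ⟨.atU, .none, true, true, true, a⟩,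
      ⟨.atV, .none, true, true, true, 0⟩, ⟨.atU, .none, true, true, true, b⟩,
      ⟨.atV, .none, true, true, true, d⟩]
    ?_ ?_ ?_ ?_ ?_ ?_ <;> simp [BalancedCond] <;> first | omega | ring_nf

lemma balanced_oo_o_e_of_zero' {a b d e : ℕ} (h1 : a = 0) (h2 : b = 0) (h3 : 1 ≤ d) :
    HasBalanced ({2 * a + 1} + {2 * b + 1}) ({1} + {2 * (d + 1) + 1})
      (2 * e + 2) := by
  refine .of_items
    [⟨.atV, .front, false, false, false, d⟩, ⟨.atU, .none, true, true, true, a⟩,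
      ⟨.core, .none, true, true, false, e⟩, ⟨.atV, .none, true, true, true, 0⟩,
      ⟨.atU, .none, true, true, true, b⟩]
    ?_ ?_ ?_ ?_ ?_ ?_ <;> simp [BalancedCond] <;> first | omega | (ring_nf; done) | (ring_nf; abel)

lemma balanced_oo_e_e_of_pos {a b d e : ℕ} :
    HasBalanced ({2 * a + 1} + {2 * (b + 1) + 1}) ({1} + {2 * d + 2})
      (2 * e + 2) := by
  by_cases h1' : BalancedCond
    [⟨.core, .front, false, false, true, e⟩, ⟨.atV, .none, true, true, false, d⟩,
      ⟨.atU, .none, true, false, true, a⟩, ⟨.atU, .none, true, true, true, b + 1⟩,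
      ⟨.atV, .none, true, true, true, 0⟩]
  · refine .of_items _ h1' ?_ ?_ ?_ ?_ ?_ <;> simp <;>
      first | omega | (ring_nf; done) | (ring_nf; abel)
  simp [BalancedCond] at h1'
  refine .of_items
    [⟨.atU, .front, true, true, false, b⟩, ⟨.atU, .none, true, true, true, a⟩,
      ⟨.atV, .none, true, true, true, 0⟩, ⟨.atV, .none, true, true, false, d⟩,
      ⟨.core, .none, false, true, false, e⟩]
    ?_ ?_ ?_ ?_ ?_ ?_ <;> simp [BalancedCond] <;> first | omega | (ring_nf; done) | (ring_nf; abel)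

lemma balanced_oe_e_e {a b d e : ℕ} :
    HasBalanced ({2 * a + 1} + {2 * b + 2}) ({1} + {2 * d + 2})
      (2 * e + 2) := by
  refine .of_items
    [⟨.atV, .none, true, true, false, d⟩, ⟨.atU, .none, false, false, false, b⟩,
      ⟨.atU, .none, true, true, true, a⟩, ⟨.atV, .none, true, true, true, 0⟩,
      ⟨.core, .back, false, true, true, e⟩]
    ?_ ?_ ?_ ?_ ?_ ?_ <;> simp [BalancedCond] <;> first | omega | (ring_nf; done) | (ring_nf; abel)

lemma balanced_ee_e_e {a b d e : ℕ} :
    HasBalanced ({2 * a + 2} + {2 * b + 2}) ({1} + {2 * d + 2})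
      (2 * e + 2) := by
  refine .of_items
    [⟨.atV, .none, true, true, false, d⟩, ⟨.core, .none, false, true, false, e⟩,
      ⟨.atU, .none, true, true, false, a⟩, ⟨.atU, .none, true, true, false, b⟩,
      ⟨.atV, .none, true, true, true, 0⟩]
    ?_ ?_ ?_ ?_ ?_ ?_ <;> simp [BalancedCond] <;> first | omega | (ring_nf; done) | (ring_nf; abel)

/-- Explicit labelings for the spiders that the recipes leave out. Here the pair `(5, 2)` has no
entry above `6`, so the labeling is not insertable at this threshold. -/
lemma plain_small : HasPlain {1, 1, 1} {2, 2} 1 :=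
  ⟨6, ⟨{[6], [4], [3]}, {[5, 2], [7, 1]}, [8]⟩,
    ⟨by unfold Labeling.WF; decide, full_of_forall (by decide), by decide, by decide, by decide,
      by decide, by decide, by decide, by decide, by decide, by decide⟩, by unfold Shape; decide⟩

lemma insertable_small : HasInsertable {1, 1, 1, 1} {2, 2} 1 :=
  ⟨6, ⟨{[3], [4], [5], [6]}, {[7, 1], [8, 2]}, [9]⟩,
    ⟨⟨by unfold Labeling.WF; decide, full_of_forall (by decide), by decide, by decide, by decide,
      by decide, by decide, by decide, by decide, by decide, by decide⟩, by decide, by decide, by decide⟩, by unfold Shape; decide⟩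

lemma insertable_small' : HasInsertable {1, 1, 1} {1, 1} 2 :=
  ⟨6, ⟨{[3], [5], [6]}, {[2], [4]}, [1, 7]⟩,
    ⟨⟨by unfold Labeling.WF; decide, full_of_forall (by decide), by decide, by decide, by decide,
      by decide, by decide, by decide, by decide, by decide, by decide⟩, by decide, by decide, by decide⟩, by unfold Shape; decide⟩

lemma balanced_small_odd : HasBalanced {1, 1} {1, 1} 1 :=
  ⟨⟨{[3], [5]}, {[4], [1]}, [2]⟩,
    ⟨by unfold Labeling.WF; decide, full_of_forall (by decide), by decide, by decide, by decide,
      by decide, by decide, by decide, by decide⟩, by unfold Shape; decide⟩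

/-- The digits in these names are the values of `a`, `b`, `d`, `e` in `balanced_oo_o_e`. -/
lemma balanced_small_even_0100 : HasBalanced {1, 3} {1, 1} 2 :=
  ⟨⟨{[3], [8, 1, 6]}, {[2], [4]}, [5, 7]⟩,
    ⟨by unfold Labeling.WF; decide, full_of_forall (by decide), by decide, by decide, by decide,
      by decide, by decide, by decide, by decide⟩, by unfold Shape; decide⟩

lemma balanced_small_even_0101 : HasBalanced {1, 3} {1, 1} 4 :=
  ⟨⟨{[2], [8, 6, 1]}, {[5], [4]}, [7, 9, 3, 10]⟩,
    ⟨by unfold Labeling.WF; decide, full_of_forall (by decide), by decide, by decide, by decide,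
      by decide, by decide, by decide, by decide⟩, by unfold Shape; decide⟩

lemma balanced_small_even_1101 : HasBalanced {3, 3} {1, 1} 4 :=
  ⟨⟨{[10, 9, 5], [4, 7, 1]}, {[3], [6]}, [11, 2, 8, 12]⟩,
    ⟨by unfold Labeling.WF; decide, full_of_forall (by decide), by decide, by decide, by decide,
      by decide, by decide, by decide, by decide⟩, by unfold Shape; decide⟩

lemma balanced_small_even_0000 : HasBalanced {1, 1} {1, 1} 2 :=
  ⟨⟨{[2], [5]}, {[4], [1]}, [3, 6]⟩,
    ⟨by unfold Labeling.WF; decide, full_of_forall (by decide), by decide, by decide, by decide,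
      by decide, by decide, by decide, by decide⟩, by unfold Shape; decide⟩

lemma balanced_small_even_0001 : HasBalanced {1, 1} {1, 1} 4 :=
  ⟨⟨{[6], [2]}, {[5], [3]}, [8, 1, 7, 4]⟩,
    ⟨by unfold Labeling.WF; decide, full_of_forall (by decide), by decide, by decide, by decide,
      by decide, by decide, by decide, by decide⟩, by unfold Shape; decide⟩

lemma balanced_small_even_0010 : HasBalanced {1, 1} {1, 3} 2 :=
  ⟨⟨{[2], [5]}, {[6], [3, 7, 1]}, [8, 4]⟩,
    ⟨by unfold Labeling.WF; decide, full_of_forall (by decide), by decide, by decide, by decide,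
      by decide, by decide, by decide, by decide⟩, by unfold Shape; decide⟩

lemma balanced_small_even_0011 : HasBalanced {1, 1} {1, 3} 4 :=
  ⟨⟨{[5], [2]}, {[4], [8, 6, 1]}, [10, 3, 9, 7]⟩,
    ⟨by unfold Labeling.WF; decide, full_of_forall (by decide), by decide, by decide, by decide,
      by decide, by decide, by decide, by decide⟩, by unfold Shape; decide⟩

end recipes

/-! ### Covering all cases of few legs -/

lemma exists_two_mul {x : ℕ} (h : x ≠ 0) : ∃ k, x = 2 * k + 1 ∨ x = 2 * k + 2 :=
  ⟨(x - 1) / 2, by omega⟩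

lemma sort_two {M : Multiset ℕ} (hM : M.card = 2) (h0 : 0 ∉ M) :
    ∃ a b, (a ≤ b ∧ M = {2 * a + 1} + {2 * b + 1}) ∨ M = {2 * a + 1} + {2 * b + 2} ∨
      (a ≤ b ∧ M = {2 * a + 2} + {2 * b + 2}) := by
  obtain ⟨x, y, rfl⟩ := Multiset.card_eq_two.1 hM
  simp only [Multiset.insert_eq_cons, Multiset.mem_cons, Multiset.mem_singleton, not_or] at h0
  obtain ⟨a, ha⟩ := exists_two_mul (Ne.symm h0.1)
  obtain ⟨b, hb⟩ := exists_two_mul (Ne.symm h0.2)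
  rcases ha with rfl | rfl <;> rcases hb with rfl | rfl
  · rcases le_total a b with h | h
    · exact ⟨a, b, .inl ⟨h, rfl⟩⟩
    · exact ⟨b, a, .inl ⟨h, Multiset.pair_comm _ _⟩⟩
  · exact ⟨a, b, .inr (.inl rfl)⟩
  · exact ⟨b, a, .inr (.inl (Multiset.pair_comm _ _))⟩
  · rcases le_total a b with h | h
    · exact ⟨a, b, .inr (.inr ⟨h, rfl⟩)⟩
    · exact ⟨b, a, .inr (.inr ⟨h, Multiset.pair_comm _ _⟩)⟩

lemma sort_three {M : Multiset ℕ} (hM : M.card = 3) (h0 : 0 ∉ M) :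
    ∃ a b c, (a ≤ b ∧ b ≤ c ∧ M = {2 * a + 1} + {2 * b + 1} + {2 * c + 1}) ∨
      (a ≤ b ∧ M = {2 * a + 1} + {2 * b + 1} + {2 * c + 2}) ∨
      (b ≤ c ∧ M = {2 * a + 1} + {2 * b + 2} + {2 * c + 2}) ∨
      (a ≤ b ∧ b ≤ c ∧ M = {2 * a + 2} + {2 * b + 2} + {2 * c + 2}) := by
  obtain ⟨x, y, z, rfl⟩ := Multiset.card_eq_three.1 hM
  simp only [Multiset.insert_eq_cons, Multiset.mem_cons, Multiset.mem_singleton, not_or] at h0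
  obtain ⟨c, hc⟩ := exists_two_mul (Ne.symm h0.1)
  obtain ⟨a, b, h⟩ := sort_two (M := {y, z}) rfl (by
    simp only [Multiset.insert_eq_cons, Multiset.mem_cons, Multiset.mem_singleton]; tauto)
  rw [Multiset.insert_eq_cons, ← Multiset.singleton_add]
  rcases hc with rfl | rfl <;> rcases h with ⟨hab, h⟩ | h | ⟨hab, h⟩ <;> rw [h]
  · rcases le_total c a with hc | hc
    · exact ⟨c, a, b, .inl ⟨hc, hab, by abel⟩⟩
    rcases le_total c b with hb | hb
    · exact ⟨a, c, b, .inl ⟨hc, hb, by abel⟩⟩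
    · exact ⟨a, b, c, .inl ⟨hab, hb, by abel⟩⟩
  · rcases le_total c a with hc | hc
    · exact ⟨c, a, b, .inr (.inl ⟨hc, by abel⟩)⟩
    · exact ⟨a, c, b, .inr (.inl ⟨hc, by abel⟩)⟩
  · exact ⟨c, a, b, .inr (.inr (.inl ⟨hab, by abel⟩))⟩
  · exact ⟨a, b, c, .inr (.inl ⟨hab, by abel⟩)⟩
  · rcases le_total c b with hc | hc
    · exact ⟨a, c, b, .inr (.inr (.inl ⟨hc, by abel⟩))⟩
    · exact ⟨a, b, c, .inr (.inr (.inl ⟨hc, by abel⟩))⟩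
  · rcases le_total c a with hc | hc
    · exact ⟨c, a, b, .inr (.inr (.inr ⟨hc, hab, by abel⟩))⟩
    rcases le_total c b with hb | hb
    · exact ⟨a, c, b, .inr (.inr (.inr ⟨hc, hb, by abel⟩))⟩
    · exact ⟨a, b, c, .inr (.inr (.inr ⟨hab, hb, by abel⟩))⟩

/-- The legs are sorted by parity and then by size, which matches one recipe for each parity
pattern. The assumption on single edges gives a zero half-length where a recipe asks for one and
rules out that all five legs are even. -/
lemma insertable_three_two {U V : Multiset ℕ} {l : ℕ} (hU : U.card = 3) (hV : V.card = 2)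
    (hU0 : 0 ∉ U) (hV0 : 0 ∉ V) (hl : l ≠ 0) (h1 : 1 ∈ U ∨ 1 ∈ V)
    (hex : ¬ (U = {1, 1, 1} ∧ V = {2, 2} ∧ l = 1)) : HasInsertable U V l := by
  obtain ⟨f, hf⟩ := exists_two_mul hl
  obtain ⟨a, b, c, hU⟩ := sort_three hU hU0
  obtain ⟨d, e, hV⟩ := sort_two hV hV0
  rcases hU with ⟨hab, hbc, rfl⟩ | ⟨hab, rfl⟩ | ⟨hbc, rfl⟩ | ⟨hab, hbc, rfl⟩ <;>
    rcases hV with ⟨hde, rfl⟩ | rfl | ⟨hde, rfl⟩ <;>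
    simp only [Multiset.mem_add, Multiset.mem_singleton] at h1 <;>
    rcases hf with rfl | rfl
  · rcases c with _ | c
    · exact insertable_ooo_oo_o_of_zero (by omega) (by omega) rfl hde
    · exact insertable_ooo_oo_o_of_pos hab hde
  · rcases c with _ | c
    · obtain rfl : a = 0 := by omega
      obtain rfl : b = 0 := by omega
      rcases e with _ | e
      · obtain rfl : d = 0 := by omega
        rcases eq_or_ne f 0 with rfl | hf
        · exact insertable_small'
        · exact insertable_ooo_oo_e_of_zero' rfl rfl rfl hf
      · exact insertable_ooo_oo_e_of_zero rfl rfl rfl hde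
    · exact insertable_ooo_oo_e_of_pos hab hde
  · exact insertable_ooo_oe_o hab hbc
  · exact insertable_ooo_oe_e hab hbc
  · refine insertable_ooo_ee_o (by omega) hbc hde fun h => hex ?_
    obtain ⟨rfl, rfl, rfl, rfl, rfl, rfl⟩ : a = 0 ∧ b = 0 ∧ c = 0 ∧ d = 0 ∧ e = 0 ∧ f = 0 := by
      omega
    exact ⟨rfl, rfl, rfl⟩
  · exact insertable_ooo_ee_e (by omega) hbc
  · exact insertable_ooe_oo_o hab hde
  · exact insertable_ooe_oo_e hab
  · exact insertable_ooe_oe_o hab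
  · exact insertable_ooe_oe_e hab
  · exact insertable_ooe_ee_o (by omega)
  · exact insertable_ooe_ee_e (by omega)
  · exact insertable_oee_oo_o hbc hde
  · exact insertable_oee_oo_e hbc hde
  · exact insertable_oee_oe_o
  · exact insertable_oee_oe_e hbc
  · exact insertable_oee_ee_o (by omega)
  · exact insertable_oee_ee_e (by omega)
  · exact insertable_eee_oo_o (by omega) hbc hde
  · exact insertable_eee_oo_e (by omega) hde
  · exact insertable_eee_oe_o (by omega) hab
  · exact insertable_eee_oe_e (by omega)
  · omega
  · omega

/-- This is the parity pattern with the most exceptions: for very short legs the branch sums of a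
recipe may coincide or be too small, so other orders or explicit labelings take over. -/
lemma balanced_oo_o_e {a b d e : ℕ} (h : a ≤ b) :
    HasBalanced ({2 * a + 1} + {2 * b + 1}) ({1} + {2 * d + 1}) (2 * e + 2) := by
  rcases b with _ | b
  · obtain rfl : a = 0 := by omega
    by_cases h1 : d = 3 ∨ d = 2 ∧ e = 0
    · obtain ⟨d, rfl⟩ : ∃ d', d = d' + 1 := ⟨d - 1, by omega⟩
      exact balanced_oo_o_e_of_zero' rfl rfl (by omega)
    by_cases h2 : d ≤ 1 ∧ e ≤ 1
    · obtain ⟨hd, he⟩ := h2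
      interval_cases d <;> interval_cases e
      · exact balanced_small_even_0000
      · exact balanced_small_even_0001
      · exact balanced_small_even_0010
      · exact balanced_small_even_0011
    · exact balanced_oo_o_e_of_zero rfl rfl (by omega) (by omega) (by omega) (by omega)
  by_cases h1 : (d = 0 → a + 1 ≤ b) ∧ (d = 1 → a ≤ b)
  · exact balanced_oo_o_e_of_pos h h1.1 h1.2
  rcases Nat.eq_zero_or_pos b with rfl | hb
  · by_cases h2 : a = 0 ∧ d = 0 ∧ 2 ≤ e ∨ a = 1 ∧ d = 0 ∧ 2 ≤ e ∨ a = 1 ∧ d = 1 ∧ 3 ≤ e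
    · exact balanced_oo_o_e_of_one rfl h2
    rcases a with _ | a
    · obtain rfl : d = 0 := by omega
      have he : e ≤ 1 := by omega
      interval_cases e
      · exact balanced_small_even_0100
      · exact balanced_small_even_0101
    · obtain rfl : a = 0 := by omega
      by_cases h3 : d = 0 ∧ e = 0 ∨ d = 1 ∧ e ≤ 1
      · exact balanced_oo_o_e_of_one' rfl rfl h3
      rcases d with _ | d
      · obtain rfl : e = 1 := by omega
        exact balanced_small_even_1101
      · obtain rfl : d = 0 := by omega
        exact balanced_oo_o_e_of_one_one rfl rfl (by omega)
  · obtain ⟨a, rfl⟩ : ∃ a', a = a' + 1 := ⟨a - 1, by omega⟩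
    exact balanced_oo_o_e_of_two_le (by omega) (by omega)

lemma balanced_two_two {U V : Multiset ℕ} {l : ℕ} (hU : U.card = 2) (hV : V.card = 2)
    (hU0 : 0 ∉ U) (hV0 : 0 ∉ V) (hl : l ≠ 0) (h1 : 1 ∈ V) : HasBalanced U V l := by
  obtain ⟨e, he⟩ := exists_two_mul hl
  obtain ⟨a, b, hU⟩ := sort_two hU hU0
  obtain ⟨V, rfl⟩ := Multiset.exists_cons_of_mem h1
  rw [Multiset.card_cons, Nat.add_right_cancel_iff, Multiset.card_eq_one] at hV
  obtain ⟨x, rfl⟩ := hV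
  obtain ⟨d, hd⟩ := exists_two_mul (x := x) (by rintro rfl; simp at hV0)
  rw [← Multiset.singleton_add]
  rcases hU with ⟨hab, rfl⟩ | rfl | ⟨hab, rfl⟩ <;> rcases hd with rfl | rfl <;>
    rcases he with rfl | rfl
  · rcases b with _ | b
    · obtain rfl : a = 0 := by omega
      rcases eq_or_ne (d + e) 0 with h | h
      · obtain ⟨rfl, rfl⟩ : d = 0 ∧ e = 0 := by omega
        exact balanced_small_odd
      · exact balanced_oo_o_o_of_zero rfl rfl h
    · exact balanced_oo_o_o_of_pos hab
  · exact balanced_oo_o_e hab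
  · exact balanced_oo_e_o hab
  · rcases b with _ | b
    · exact balanced_oo_e_e_of_zero (by omega) rfl
    · exact balanced_oo_e_e_of_pos
  · exact balanced_oe_o_o
  · exact balanced_oe_o_e
  · exact balanced_oe_e_o
  · exact balanced_oe_e_e
  · exact balanced_ee_o_o hab
  · exact balanced_ee_o_e hab
  · exact balanced_ee_e_o
  · exact balanced_ee_e_e

/-! ### Many legs, all even at the vertex with fewer legs -/

section append

variable (l₁ l₂ : List Item) (a b c t : ℕ)

lemma sx_append : sx (l₁ ++ l₂) = sx l₁ + sx l₂ := by simp [sx]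
lemma sy_append : sy (l₁ ++ l₂) = sy l₁ + sy l₂ := by simp [sy]
lemma sz_append : sz (l₁ ++ l₂) = sz l₁ + sz l₂ := by simp [sz]
lemma sw_append : sw (l₁ ++ l₂) = sw l₁ + sw l₂ := by simp [sw]
lemma cores_append : cores (l₁ ++ l₂) = cores l₁ + cores l₂ := by simp [cores]

lemma lensU_append : lensU (l₁ ++ l₂) = lensU l₁ + lensU l₂ := by
  induction l₁ with
  | nil => simp [lensU]
  | cons i l₁ ih => rw [List.cons_append, lensU, lensU, ih, add_assoc]

lemma lensV_append : lensV (l₁ ++ l₂) = lensV l₁ + lensV l₂ := by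
  induction l₁ with
  | nil => simp [lensV]
  | cons i l₁ ih => rw [List.cons_append, lensV, lensV, ih, add_assoc]

lemma lensC_append : lensC (l₁ ++ l₂) = lensC l₁ + lensC l₂ := by
  induction l₁ with
  | nil => simp [lensC]
  | cons i l₁ ih => rw [List.cons_append, lensC, lensC, ih, add_assoc]

lemma largeU_append : largeU (l₁ ++ l₂) = largeU l₁ + largeU l₂ := by
  induction l₁ with
  | nil => simp [largeU]
  | cons i l₁ ih => rw [List.cons_append, largeU, largeU, ih, add_assoc]

lemma largeV_append : largeV (l₁ ++ l₂) = largeV l₁ + largeV l₂ := by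
  induction l₁ with
  | nil => simp [largeV]
  | cons i l₁ ih => rw [List.cons_append, largeV, largeV, ih, add_assoc]

lemma headsU_append : headsU (l₁ ++ l₂) a b c t = headsU l₁ a b c t +
    headsU l₂ (a + sx l₁) (b + sy l₁) (c + sw l₁) (t + sz l₁) := by
  induction l₁ generalizing a b c t with
  | nil => simp [headsU]
  | cons i l₁ ih => simp only [List.cons_append, headsU, ih, sx_cons, sy_cons, sz_cons, sw_cons,
      add_assoc]

lemma headsV_append : headsV (l₁ ++ l₂) a b c t = headsV l₁ a b c t +
    headsV l₂ (a + sx l₁) (b + sy l₁) (c + sw l₁) (t + sz l₁) := by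
  induction l₁ generalizing a b c t with
  | nil => simp [headsV]
  | cons i l₁ ih => simp only [List.cons_append, headsV, ih, sx_cons, sy_cons, sz_cons, sw_cons,
      add_assoc]

lemma topPairs_append : topPairs (l₁ ++ l₂) a b t = topPairs l₁ a b t +
    topPairs l₂ (a + sx l₁) (b + sy l₁) (t + sz l₁) := by
  induction l₁ generalizing a b t with
  | nil => simp [topPairs]
  | cons i l₁ ih => simp only [List.cons_append, topPairs, ih, sx_cons, sy_cons, sz_cons,
      add_assoc]

end append

/-- The item of a leg whose alternating path has length `2 * n + 2` and starts with its smallest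
large label. -/
def evenItem (p : Place) (e : Extra) (n : ℕ) : Item := ⟨p, e, false, false, false, n⟩

/-- Several items as in `evenItem`. -/
def block (p : Place) (e : Extra) (L : List ℕ) : List Item := L.map (evenItem p e)

section block

variable (p : Place) (e : Extra) (L : List ℕ) (a b c t : ℕ)

lemma sx_block : sx (block p e L) = L.sum + L.length := by
  induction L with
  | nil => rfl
  | cons n L ih =>
    rw [block, List.map_cons, sx_cons, ← block, ih, List.sum_cons, List.length_cons]
    simp only [evenItem, Item.x]; ring

lemma sy_block : sy (block p e L) = L.sum + L.length := by
  induction L with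
  | nil => rfl
  | cons n L ih =>
    rw [block, List.map_cons, sy_cons, ← block, ih, List.sum_cons, List.length_cons]
    simp only [evenItem, Item.y]; ring

/-- The item `i` only carries the extra `e`: the number of top labels depends on nothing else, so
any item with this extra may be supplied. -/
lemma sz_block (i : Item) (hi : i.extra = e) : sz (block p e L) = i.z * L.length := by
  induction L with
  | nil => simp [block]
  | cons n L ih =>
    rw [block, List.map_cons, sz_cons, ← block, ih, List.length_cons]
    simp only [evenItem, Item.z, hi]; ring

lemma sw_block (i : Item) (hi : i.extra = e) : sw (block p e L) = i.w * L.length := by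
  induction L with
  | nil => simp [block]
  | cons n L ih =>
    rw [block, List.map_cons, sw_cons, ← block, ih, List.length_cons]
    simp only [evenItem, Item.w, hi]; ring

lemma cores_block (hp : p ≠ .core) : cores (block p e L) = 0 := by
  simp [cores, block, evenItem, hp]

lemma headsU_block_atV : headsU (block .atV e L) a b c t = 0 := by
  induction L generalizing a b c t with
  | nil => rfl
  | cons n L ih => rw [block, List.map_cons, headsU, ← block, ih]; rfl

lemma headsV_block_atU : headsV (block .atU e L) a b c t = 0 := by
  induction L generalizing a b c t with
  | nil => rfl
  | cons n L ih => rw [block, List.map_cons, headsV, ← block, ih]; rfl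

lemma card_headsU_block : (headsU (block .atU e L) a b c t).card = L.length := by
  induction L generalizing a b c t with
  | nil => rfl
  | cons n L ih =>
    rw [block, List.map_cons, headsU, ← block, Multiset.card_add, ih, List.length_cons, add_comm]
    rfl

lemma card_headsV_block : (headsV (block .atV e L) a b c t).card = L.length := by
  induction L generalizing a b c t with
  | nil => rfl
  | cons n L ih =>
    rw [block, List.map_cons, headsV, ← block, Multiset.card_add, ih, List.length_cons, add_comm]
    rfl

variable {e L a b c t}

lemma mem_headsV_block {x : ℕ} (h : x ∈ headsV (block .atV .none L) a b c t) :
    b ≤ x ∧ x + 1 ≤ b + (L.sum + L.length) := by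
  induction L generalizing a b c t with
  | nil => simp [block, headsV] at h
  | cons n L ih =>
    rw [block, List.map_cons, headsV, ← block, Multiset.mem_add] at h
    simp only [List.sum_cons, List.length_cons]
    rcases h with h | h
    · rw [evenItem, Multiset.mem_singleton] at h
      simp only [Item.root, Item.hd] at h
      omega
    · have := ih h
      simp only [evenItem, Item.y] at this
      omega

lemma mem_headsV_block_two {x : ℕ} (h : x ∈ headsV (block .atV .two L) a b c t) :
    c ≤ x ∧ x + 1 ≤ c + L.length := by
  induction L generalizing a b c t with
  | nil => simp [block, headsV] at h
  | cons n L ih =>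
    rw [block, List.map_cons, headsV, ← block, Multiset.mem_add] at h
    simp only [List.length_cons]
    rcases h with h | h
    · rw [evenItem, Multiset.mem_singleton] at h
      simp only [Item.root] at h
      omega
    · have := ih h
      simp only [evenItem, Item.w] at this
      omega

lemma mem_headsU_block {x : ℕ} (h : x ∈ headsU (block .atU .none L) a b c t) : b ≤ x := by
  induction L generalizing a b c t with
  | nil => simp [block, headsU] at h
  | cons n L ih =>
    rw [block, List.map_cons, headsU, ← block, Multiset.mem_add] at h
    rcases h with h | h
    · rw [evenItem, Multiset.mem_singleton] at h
      simp only [Item.root, Item.hd] at h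
      omega
    · have := ih h
      omega

lemma mem_headsU_block_front {x : ℕ} (h : x ∈ headsU (block .atU .front L) a b c t) : t ≤ x := by
  induction L generalizing a b c t with
  | nil => simp [block, headsU] at h
  | cons n L ih =>
    rw [block, List.map_cons, headsU, ← block, Multiset.mem_add] at h
    rcases h with h | h
    · rw [evenItem, Multiset.mem_singleton] at h
      simp only [Item.root] at h
      omega
    · have := ih h
      omega

lemma topPairs_block_none : topPairs (block p .none L) a b t = 0 := by
  induction L generalizing a b t with
  | nil => rfl
  | cons n L ih => rw [block, List.map_cons, topPairs, ← block, ih]; rfl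

lemma lensU_block_atU (f : ℕ → ℕ) (hf : ∀ n, (evenItem .atU e n).len = f n) :
    lensU (block .atU e L) = (L.map f : List ℕ) := by
  induction L with
  | nil => rfl
  | cons n L ih =>
    rw [block, List.map_cons, lensU, ← block, ih, List.map_cons, ← Multiset.cons_coe,
      ← Multiset.singleton_add, hf]
    rfl

lemma lensU_block_atV : lensU (block .atV e L) = 0 := by
  induction L with
  | nil => rfl
  | cons n L ih => rw [block, List.map_cons, lensU, ← block, ih]; rfl

lemma lensV_block_atV (f : ℕ → ℕ) (hf : ∀ n, (evenItem .atV e n).len = f n) :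
    lensV (block .atV e L) = (L.map f : List ℕ) := by
  induction L with
  | nil => rfl
  | cons n L ih =>
    rw [block, List.map_cons, lensV, ← block, ih, List.map_cons, ← Multiset.cons_coe,
      ← Multiset.singleton_add, hf]
    rfl

lemma lensV_block_atU : lensV (block .atU e L) = 0 := by
  induction L with
  | nil => rfl
  | cons n L ih => rw [block, List.map_cons, lensV, ← block, ih]; rfl

lemma lensC_block (hp : p ≠ .core) : lensC (block p e L) = 0 := by
  induction L with
  | nil => rfl
  | cons n L ih =>
    rw [block, List.map_cons, lensC, ← block, ih]
    rcases p <;> first | rfl | exact absurd rfl hp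

lemma largeU_block_atV : largeU (block .atV e L) = 0 := by
  induction L with
  | nil => rfl
  | cons n L ih => rw [block, List.map_cons, largeU, ← block, ih]; rfl

lemma largeV_block_atU : largeV (block .atU e L) = 0 := by
  induction L with
  | nil => rfl
  | cons n L ih => rw [block, List.map_cons, largeV, ← block, ih]; rfl

lemma largeU_block_atU (he : e ≠ .two) : largeU (block .atU e L) = L.length := by
  induction L with
  | nil => rfl
  | cons n L ih =>
    rw [block, List.map_cons, largeU, ← block, ih, List.length_cons, add_comm]
    rcases e <;> first | rfl | exact absurd rfl he

lemma largeV_block_two : largeV (block .atV .two L) = 0 := by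
  induction L with
  | nil => rfl
  | cons n L ih => rw [block, List.map_cons, largeV, ← block, ih]; rfl

lemma largeV_block_none : largeV (block .atV .none L) = L.length := by
  induction L with
  | nil => rfl
  | cons n L ih =>
    rw [block, List.map_cons, largeV, ← block, ih, List.length_cons, add_comm]
    rfl

lemma good_block (he : e ≠ .back) {i : Item} (h : i ∈ block p e L) : i.Good := by
  obtain ⟨n, -, rfl⟩ := List.mem_map.1 h
  exact ⟨fun _ => ⟨he, rfl⟩, fun h => absurd h he, fun _ => rfl⟩

end block

/-- All `r + 1` terms are at least `m`, and all but the first exceed `m`. This weak linear bound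
suffices. -/
lemma le_sum_range' (m r : ℕ) : r * m + (m + r) ≤ (List.range' m (r + 1)).sum := by
  induction r with
  | zero => simp
  | succ r ih =>
    rw [List.range'_1_concat, List.sum_append, List.sum_singleton, Nat.succ_mul]
    omega

lemma headsV_block_cons (n : ℕ) (L : List ℕ) (a b c t : ℕ) :
    headsV (block .atV .none (n :: L)) a b c t =
      b ::ₘ headsV (block .atV .none L) (a + (n + 1)) (b + (n + 1)) c t := by
  rw [← Multiset.singleton_add]; rfl

lemma sum_le_card_mul {M : Multiset ℕ} {k B : ℕ} (hk : M.card = k) (h : ∀ x ∈ M, x ≤ B) :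
    M.sum ≤ k * B := by
  have := Multiset.sum_le_card_nsmul M B h
  rwa [hk, smul_eq_mul] at this

lemma card_mul_le_sum {M : Multiset ℕ} {k B : ℕ} (hk : M.card = k) (h : ∀ x ∈ M, B ≤ x) :
    k * B ≤ M.sum := by
  have := Multiset.card_nsmul_le_sum (s := M) (a := B) h
  rwa [hk, smul_eq_mul] at this

/-- The items of a labeling for a double spider in which all legs at `v` are even: even legs at `v`,
even and odd legs at `u`, further even legs at `v`, and the path between the branch vertices. -/
def evenItems (A E O K : List ℕ) (core : Item) : List Item :=
  block .atV .none A ++ (block .atU .none E ++ (block .atU .front O ++ (block .atV .two K ++ [core])))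

/-- The sums at `u` and `v` are compared leg by leg. The legs in `A` come first and put the lowest
large labels at `v`; the legs in `E` and `O` put later ones or top ones at `u`. The legs in `K` put
middle labels at `v`, which are below the labels of the pendant edges at `u`. The alternatives in
`hr` say how many legs of each sort are matched; the leftover labels are the first large label and
the label of the middle path at `v`, against that of the middle path and pendant edges at `u`. -/
lemma insertable_evenItems {n₀ n r : ℕ} {A E O K : List ℕ} {e : Extra}
    (hA : ∀ m ∈ n₀ :: A, 1 ≤ m) (he : e = .none ∨ e = .front) (hk : 2 ≤ A.length + K.length)
    (hr : A.length = E.length + O.length ∧ r = K.length + 1 ∨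
      A.length + 1 = E.length + O.length ∧ r = 0 ∧ K = []) :
    HasInsertable
      (Multiset.replicate (r + 1) 1 + 
        (((E.map (2 * · + 2) : List ℕ) : Multiset ℕ) + ((O.map (2 * · + 3) : List ℕ) : Multiset ℕ)))
      ((((n₀ :: A).map (2 * · + 2) : List ℕ) : Multiset ℕ) +
        ((K.map (2 * · + 4) : List ℕ) : Multiset ℕ))
      ((⟨.core, e, false, false, true, n⟩ : Item).len) := by
  set core : Item := ⟨.core, e, false, false, true, n⟩ with hcore
  set is := evenItems (n₀ :: A) E O K core with his
  have hlA : A.length ≤ A.sum := by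
    have : ∀ L : List ℕ, (∀ m ∈ L, 1 ≤ m) → L.length ≤ L.sum := by
      intro L hL
      simpa using List.card_nsmul_le_sum L 1 hL
    exact this A fun m hm => hA m (List.mem_cons_of_mem _ hm)
  have hn₀ : 1 ≤ n₀ := hA n₀ List.mem_cons_self
  have hcx : core.x = n := rfl
  have hcy : core.y = n + 1 := rfl
  have hcw : core.w = 0 := by rcases he with rfl | rfl <;> rfl
  have hcz : core.z ≤ 1 := by rcases he with rfl | rfl <;> simp [hcore, Item.z]
  -- `T` is the number of large labels used by the first block: `s + T` separates the labels at `v`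
  -- from those that the longer legs put at `u`. Below, `X` is the number of small labels, there is
  -- one more large label than small ones, and `s` is the threshold.
  obtain ⟨T, hT⟩ : ∃ T, T = n₀ + 1 + (A.sum + A.length) := ⟨_, rfl⟩
  obtain ⟨X, hX⟩ : ∃ X, X = T + (E.sum + E.length) + (O.sum + O.length) + (K.sum + K.length) + n :=
    ⟨_, rfl⟩
  have hsx : sx is = X := by
    simp only [his, evenItems, sx_append, sx_block, sx_cons, sx_nil, hcx, List.sum_cons,
      List.length_cons]
    omega
  have hsy : sy is = X + 1 := by
    simp only [his, evenItems, sy_append, sy_block, sy_cons, sy_nil, hcy, List.sum_cons,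
      List.length_cons]
    omega
  have hz1 : ∀ L, sz (block .atV .none L) = 0 := fun L => by
    rw [sz_block _ _ _ ⟨.atV, .none, true, true, true, 0⟩ rfl]; simp [Item.z]
  have hz2 : ∀ L, sz (block .atU .none L) = 0 := fun L => by
    rw [sz_block _ _ _ ⟨.atV, .none, true, true, true, 0⟩ rfl]; simp [Item.z]
  have hz3 : ∀ L, sz (block .atU .front L) = L.length := fun L => by
    rw [sz_block _ _ _ ⟨.atV, .front, true, true, true, 0⟩ rfl]; simp [Item.z]
  have hz4 : ∀ L, sz (block .atV .two L) = L.length := fun L => by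
    rw [sz_block _ _ _ ⟨.atV, .two, true, true, true, 0⟩ rfl]; simp [Item.z]
  have hw1 : ∀ L, sw (block .atV .none L) = 0 := fun L => by
    rw [sw_block _ _ _ ⟨.atV, .none, true, true, true, 0⟩ rfl]; simp [Item.w]
  have hw2 : ∀ L, sw (block .atU .none L) = 0 := fun L => by
    rw [sw_block _ _ _ ⟨.atV, .none, true, true, true, 0⟩ rfl]; simp [Item.w]
  have hw3 : ∀ L, sw (block .atU .front L) = 0 := fun L => by
    rw [sw_block _ _ _ ⟨.atV, .front, true, true, true, 0⟩ rfl]; simp [Item.w]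
  have hw4 : ∀ L, sw (block .atV .two L) = L.length := fun L => by
    rw [sw_block _ _ _ ⟨.atV, .two, true, true, true, 0⟩ rfl]; simp [Item.w]
  have hsz : sz is ≤ O.length + K.length + 1 := by
    simp only [his, evenItems, sz_append, hz1, hz2, hz3, hz4, sz_cons, sz_nil]
    omega
  have hsw : sw is = K.length := by
    simp only [his, evenItems, sw_append, hw1, hw2, hw3, hw4, sw_cons, sw_nil, hcw]
    omega
  have hcores : cores is = 1 := by
    simp only [his, evenItems, cores_append, cores_block _ _ _ (show Place.atU ≠ .core by decide),
      cores_block _ _ _ (show Place.atV ≠ .core by decide), cores_cons, cores_nil]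
    rfl
  have hgood : ∀ i ∈ is, i.Good := by
    intro i hi
    simp only [his, evenItems, List.mem_append, List.mem_singleton] at hi
    rcases hi with hi | hi | hi | hi | rfl
    · exact good_block _ (by decide) hi
    · exact good_block _ (by decide) hi
    · exact good_block _ (by decide) hi
    · exact good_block _ (by decide) hi
    · refine ⟨fun h => absurd rfl h, fun _ => rfl, fun _ => rfl⟩
  obtain ⟨s, hs⟩ : ∃ s, s = X + K.length + (r + 1) := ⟨_, rfl⟩
  have hleaf : ∀ a b t, core.leaf a b t = b + n := by
    intro a b t
    rcases he with rfl | rfl <;> rfl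
  obtain ⟨VA, VK, W, hV, hVA, hVA', hcA, hVK, hcK, hW⟩ :
      ∃ VA VK : Multiset ℕ, ∃ W : ℕ,
      (buildV is (r + 1)).sum = s + 1 + (VA.sum + (VK.sum + W)) ∧
      (∀ x ∈ VA, X + 1 ≤ x) ∧ (∀ x ∈ VA, x ≤ s + T) ∧ VA.card = A.length ∧
      (∀ x ∈ VK, X + 1 ≤ x ∧ x ≤ X + K.length) ∧ VK.card = K.length ∧
      W = s + X + 1 := by
    have : buildV is (r + 1) = headsV is 1 (s + 1) (X + 1) (s + (X + 1) + 1) := by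
      rw [buildV, hsx, hsy, hsw, hs]
    rw [this, his, evenItems, headsV_append, headsV_append, headsV_append, headsV_append,
      headsV_block_atU, headsV_block_atU, headsV_block_cons]
    simp only [hw1, hw2, hw3, sy_block, hz1, hz2, hz3, hz4, List.sum_cons, List.length_cons,
      headsV, hcore, Multiset.sum_add, Multiset.sum_cons, Multiset.sum_singleton,
      zero_add, add_zero]
    rw [← hcore, hleaf]
    refine ⟨_, _, _, add_assoc _ _ _, fun x hx => ?_, fun x hx => ?_, card_headsV_block _ _ _ _ _ _,
      fun x hx => ?_, card_headsV_block _ _ _ _ _ _, ?_⟩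
    · have := mem_headsV_block hx; omega
    · have := mem_headsV_block hx; omega
    · have := mem_headsV_block_two hx; omega
    · omega
  obtain ⟨UE, UO, R, hU, hUE, hcE, hUO, hcO, hR⟩ : ∃ UE UO : Multiset ℕ, ∃ R : ℕ,
      (buildU is (r + 1)).sum = UE.sum + (UO.sum + R) ∧
      (∀ x ∈ UE, s + T + 1 ≤ x) ∧ UE.card = E.length ∧
      (∀ x ∈ UO, s + T + 1 ≤ x) ∧ UO.card = O.length ∧ s + 1 + X ≤ R + n := by
    have : buildU is (r + 1) = headsU is 1 (s + 1) (X + 1) (s + (X + 1) + 1) := by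
      rw [buildU, hsx, hsy, hsw, hs]
    rw [this, his, evenItems, headsU_append, headsU_append, headsU_append, headsU_append,
      headsU_block_atV, headsU_block_atV]
    simp only [hw1, hw2, hw3, hw4, sy_block, hz1, hz2, hz3, hz4, List.sum_cons, List.length_cons,
      headsU, hcore, Multiset.sum_add, Multiset.sum_singleton, zero_add,
      add_zero]
    rw [← hcore]
    refine ⟨_, _, _, rfl, fun x hx => ?_, card_headsU_block _ _ _ _ _ _,
      fun x hx => ?_, card_headsU_block _ _ _ _ _ _, ?_⟩
    · have := mem_headsU_block hx; omega
    · have := mem_headsU_block_front hx; omega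
    · rcases he with rfl | rfl <;> simp only [hcore, Item.root, Item.hd] <;> omega
  have hvA := card_mul_le_sum hcA hVA
  have hvA' := sum_le_card_mul hcA hVA'
  have hvK := card_mul_le_sum hcK fun x hx => (hVK x hx).1
  have hvK' := sum_le_card_mul hcK fun x hx => (hVK x hx).2
  have huE := card_mul_le_sum hcE hUE
  have huO := card_mul_le_sum hcO hUO
  have hsing := le_sum_range' (X + K.length + 1) r
  have hVbig : s + 1 + 2 * (X + 1) + (s + X + 1) ≤ (buildV is (r + 1)).sum := by
    have := Nat.mul_le_mul_right (X + 1) hk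
    rw [add_mul] at this
    omega
  have htop : ∀ p ∈ buildTop is (r + 1), psum p < (buildV is (r + 1)).sum := by
    intro p hp
    have := topPairs_bound hgood hp
    rw [hsx, hsy, hsw] at this
    simp only [psum]
    omega
  -- Top labels are attached only after the blocks `A` and `E` have used their large labels. Since
  -- the legs in the first block have length at least four, `T` is large enough to put these sums
  -- above all middle sums.
  have htop' : ∀ p ∈ buildTop is (r + 1), s + 1 + T + (E.sum + E.length) + (s + X + 2) ≤ psum p := by
    intro p hp
    rw [buildTop, hsx, hsy, hsw, his, evenItems, topPairs_append, topPairs_block_none, zero_add,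
      topPairs_append, topPairs_block_none, zero_add, sy_block, sy_block, hz1, hz2] at hp
    have := topPairs_bound (fun i hi => hgood i (by
      rw [his, evenItems]
      exact List.mem_append_right _ (List.mem_append_right _ hi))) hp
    simp only [List.sum_cons, List.length_cons] at this
    simp only [psum]
    omega
  have hmid : ∀ p ∈ buildMid is (r + 1),
      psum p + 1 ≤ X + K.length + (s + X + 1 + (O.length + K.length + 1)) + 1 := by
    intro p hp
    have := midPairs_bound hp
    rw [hsx, hsy, hsw] at this
    simp only [psum]
    omega
  have hfin := hasInsertable_build (is := is) (r := r + 1) hcores hgood ?_ ?_ ?_ htop ?_ ?_ ?_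
  · have hU' : lensU is = (E.map (2 * · + 2) : List ℕ) + (O.map (2 * · + 3) : List ℕ) := by
      rw [his, evenItems, lensU_append, lensU_append, lensU_append, lensU_append, lensU_block_atV,
        lensU_block_atV, lensU_block_atU (2 * · + 2) fun n => ?_,
        lensU_block_atU (2 * · + 3) fun n => ?_]
      · simp [lensU, hcore]
      · simp only [evenItem, Item.len, Item.x, Item.y, Item.z, Item.w]; omega
      · simp only [evenItem, Item.len, Item.x, Item.y, Item.z, Item.w]; omega
    have hV' : lensV is =
        ((n₀ :: A).map (2 * · + 2) : List ℕ) + (K.map (2 * · + 4) : List ℕ) := by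
      rw [his, evenItems, lensV_append, lensV_append, lensV_append, lensV_append, lensV_block_atU,
        lensV_block_atU, lensV_block_atV (2 * · + 2) fun n => ?_,
        lensV_block_atV (2 * · + 4) fun n => ?_]
      · simp [lensV, hcore]
      · simp only [evenItem, Item.len, Item.x, Item.y, Item.z, Item.w]; omega
      · simp only [evenItem, Item.len, Item.x, Item.y, Item.z, Item.w]; omega
    have hC' : lensC is = core.len := by
      rw [his, evenItems, lensC_append, lensC_append, lensC_append, lensC_append,
        lensC_block _ (by decide), lensC_block _ (by decide), lensC_block _ (by decide),
        lensC_block _ (by decide)]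
      simp [lensC, hcore]
    rwa [hU', hV', hC'] at hfin
  · intro p hp q hq
    have := hmid p hp
    have := htop' q hq
    have : r = 0 → K.length = 0 := by rcases hr with ⟨-, h⟩ | ⟨-, -, h⟩ <;> simp [h]
    omega
  · rw [hsx, hsy, hsw]; omega
  · intro p hp
    have := hmid p hp
    omega
  · rw [hU, hV, hsx, hsw]
    have hcase : (E.length + O.length) * (s + T + 1) =
      E.length * (s + T + 1) + O.length * (s + T + 1) := add_mul _ _ _
    rcases hr with ⟨h1, h2⟩ | ⟨h1, h2, h3⟩
    · rw [← h1, mul_add, mul_one] at hcase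
      rw [h2, add_mul, one_mul, mul_add, mul_one] at hsing
      rw [h2]
      omega
    · rw [← h1, mul_add, mul_one, add_mul, one_mul] at hcase
      rw [h3, List.length_nil, zero_mul] at hvK'
      rw [h2, zero_mul] at hsing
      have : K.length = 0 := by rw [h3]; rfl
      rw [h2]
      omega
  · rw [his, evenItems, largeV_append, largeV_append, largeV_append, largeV_append,
      largeV_block_none]
    simp
    omega
  · rw [his, evenItems, largeV_append, largeV_append, largeV_append, largeV_append,
      largeV_block_none, largeV_block_atU, largeV_block_atU, largeV_block_two, largeU_append,
      largeU_append, largeU_append, largeU_append, largeU_block_atV, largeU_block_atV,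
      largeU_block_atU (by decide), largeU_block_atU (by decide), List.length_cons]
    have : largeV [core] ≤ largeU [core] := by rcases he with rfl | rfl <;>
      simp [hcore, largeV, largeU, Item.leafLarge, Item.rootLarge, Item.tlLarge, Item.hdLarge]
    omega

lemma exists_lists {U : Multiset ℕ} (hU : 0 ∉ U) : ∃ (r : ℕ) (E O : List ℕ),
    U = Multiset.replicate r 1 + (((E.map (2 * · + 2) : List ℕ) : Multiset ℕ) +
      ((O.map (2 * · + 3) : List ℕ) : Multiset ℕ)) := by
  induction U using Multiset.induction with
  | empty => exact ⟨0, [], [], rfl⟩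
  | cons x U ih =>
    obtain ⟨r, E, O, rfl⟩ := ih fun h => hU (Multiset.mem_cons_of_mem h)
    have hx : x ≠ 0 := fun h => hU (h ▸ Multiset.mem_cons_self _ _)
    rcases Nat.lt_or_ge x 2 with h | h
    · obtain rfl : x = 1 := by omega
      exact ⟨r + 1, E, O, by rw [Multiset.replicate_succ, Multiset.cons_add]⟩
    rcases Nat.even_or_odd' x with ⟨n, rfl | rfl⟩
    · refine ⟨r, (n - 1) :: E, O, ?_⟩
      rw [List.map_cons, ← Multiset.cons_coe, Multiset.cons_add, Multiset.add_cons,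
        show 2 * (n - 1) + 2 = 2 * n by omega]
    · refine ⟨r, E, (n - 1) :: O, ?_⟩
      rw [List.map_cons, ← Multiset.cons_coe, Multiset.add_cons, Multiset.add_cons,
        show 2 * (n - 1) + 3 = 2 * n + 1 by omega]

/-- Base case of the induction: there is a pendant edge at `u`, and all legs at `v` are even. -/
lemma insertable_of_even {U V : Multiset ℕ} {l : ℕ} (hUV : U.card = V.card + 1) (hV : 3 ≤ V.card)
    (hV' : ∀ x ∈ V, 4 ≤ x ∧ Even x) (hU0 : 0 ∉ U) (h1 : 1 ∈ U) (hl : l ≠ 0) :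
    HasInsertable U V l := by
  obtain ⟨e, n, he, rfl⟩ : ∃ (e : Extra) (n : ℕ), (e = .none ∨ e = .front) ∧
      l = (⟨.core, e, false, false, true, n⟩ : Item).len := by
    rcases Nat.even_or_odd' l with ⟨n, rfl | rfl⟩
    · refine ⟨.front, n - 1, .inr rfl, ?_⟩
      simp only [Item.len, Item.x, Item.y, Item.z, Item.w]; omega
    · refine ⟨.none, n, .inl rfl, ?_⟩
      simp only [Item.len, Item.x, Item.y, Item.z, Item.w]; omega
  obtain ⟨L, rfl, hL⟩ : ∃ L : List ℕ, V = ((L.map (2 * · + 2) : List ℕ) : Multiset ℕ) ∧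
      ∀ m ∈ L, 1 ≤ m := by
    refine ⟨V.toList.map (· / 2 - 1), ?_, ?_⟩
    · rw [List.map_map, ← Multiset.map_coe, Multiset.coe_toList]
      conv_lhs => rw [← Multiset.map_id V]
      refine Multiset.map_congr rfl fun x hx => ?_
      obtain ⟨h4, y, rfl⟩ := hV' x hx
      simp only [id, Function.comp]; omega
    · intro m hm
      obtain ⟨x, hx, rfl⟩ := List.mem_map.1 hm
      have := (hV' x (Multiset.mem_toList.1 hx)).1
      omega
  obtain ⟨r, E, O, rfl⟩ := exists_lists hU0
  obtain ⟨r, rfl⟩ : ∃ r', r = r' + 1 := by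
    refine Nat.exists_eq_succ_of_ne_zero ?_
    rintro rfl
    simp at h1
  simp only [Multiset.card_add, Multiset.card_replicate, Multiset.coe_card,
    List.length_map] at hUV hV
  obtain ⟨n₀, L, rfl⟩ := List.exists_cons_of_length_pos (by omega : 0 < L.length)
  rw [List.length_cons] at hUV hV
  -- If `u` has more long legs than `L` has members, then `u` has exactly one pendant edge and no
  -- middle labels are needed. Otherwise as many legs at `v` as there are long legs at `u` go into
  -- the first block, and the rest begin with a middle label.
  rcases Nat.lt_or_ge L.length (E.length + O.length) with h | h
  · have := insertable_evenItems (n₀ := n₀) (n := n) (r := r) (A := L) (E := E) (O := O) (K := [])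
      hL he (by simp; omega) (.inr ⟨by omega, by omega, rfl⟩)
    simpa using this
  · set h' := E.length + O.length
    have := insertable_evenItems (n₀ := n₀) (n := n) (r := r) (A := L.take h') (E := E) (O := O)
      (K := (L.drop h').map (· - 1)) (e := e) (fun m hm => hL m ?_) he (by simp; omega)
      (.inl ⟨by simp; omega, by simp; omega⟩)
    · convert this using 1
      rw [Multiset.coe_add, Multiset.coe_eq_coe, List.map_cons, List.map_cons, List.cons_append]
      refine .of_eq (congrArg _ ?_)
      conv_lhs => rw [← List.take_append_drop h' L]
      rw [List.map_append, List.map_map]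
      congr 1
      refine List.map_congr_left fun m hm => ?_
      have := hL m (List.mem_cons_of_mem _ (List.mem_of_mem_drop hm))
      simp only [Function.comp]; omega
    · rcases List.mem_cons.1 hm with rfl | hm
      · exact List.mem_cons_self
      · exact List.mem_cons_of_mem _ (List.mem_of_mem_take hm)

open Labeling

variable {U V : Multiset ℕ} {l : ℕ}

/-! ### The inductions -/

lemma HasInsertable.hasPlain (h : HasInsertable U V l) : HasPlain U V l := by
  obtain ⟨τ, D, hD, hs⟩ := h
  exact ⟨τ, D, hD.toPlain, hs⟩

lemma exists_map_succ {U : Multiset ℕ} (hU0 : 0 ∉ U) (hU1 : 1 ∉ U) :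
    ∃ U' : Multiset ℕ, 0 ∉ U' ∧ U = U'.map (· + 1) := by
  refine ⟨U.map (· - 1), fun h => ?_, ?_⟩
  · obtain ⟨x, hx, h⟩ := Multiset.mem_map.1 h
    rcases Nat.lt_or_ge x 2 with h' | h'
    · interval_cases x <;> contradiction
    · omega
  · rw [Multiset.map_map]
    conv_lhs => rw [← Multiset.map_id U]
    refine Multiset.map_congr rfl fun x hx => ?_
    have : x ≠ 0 := fun h => hU0 (h ▸ hx)
    simp only [id, Function.comp]; omega

lemma sum_map_succ (U : Multiset ℕ) : (U.map (· + 1)).sum = U.sum + U.card := by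
  simp [Multiset.sum_map_add]

/-- The one small double spider that has a plain, but no insertable labeling. -/
def Exceptional (U V : Multiset ℕ) (l : ℕ) : Prop := U = {1, 1, 1} ∧ V = {2, 2} ∧ l = 1

/-- If removing some leg leaves the exceptional spider, then a leg of length one can be removed
instead. This fails only when the removed leg itself has length one. -/
lemma exists_cons_not_exceptional {U V : Multiset ℕ} {l : ℕ} (hU : U ≠ 0)
    (h : ¬(U = {1, 1, 1, 1} ∧ V = {2, 2} ∧ l = 1)) :
    ∃ n U', U = n ::ₘ U' ∧ ¬Exceptional U' V l := by
  obtain ⟨m, hm⟩ := Multiset.exists_mem_of_ne_zero hU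
  obtain ⟨U', rfl⟩ := Multiset.exists_cons_of_mem hm
  by_cases he : Exceptional U' V l
  · obtain ⟨rfl, rfl, rfl⟩ := he
    refine ⟨1, m ::ₘ {1, 1}, Multiset.cons_swap _ _ _, fun he => h ⟨?_, rfl, rfl⟩⟩
    have : m ∈ ({1, 1, 1} : Multiset ℕ) := he.1 ▸ Multiset.mem_cons_self _ _
    simp only [Multiset.insert_eq_cons, Multiset.mem_cons, Multiset.mem_singleton, or_self] at this
    subst this
    rfl
  · exact ⟨m, U', rfl, he⟩

/-- The two claims feed each other: removing single legs needs an insertable labeling of the rest,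
while cutting off all leaves or removing a `1`-leg and a `2`-leg needs only a plain one. The
excluded configuration is the one treated by `HasPlain.add_one_two`; if it is absent, it stays
absent when legs are removed. -/
lemma plain_and_insertable (hVU : V.card < U.card) (hV : 2 ≤ V.card) (hU0 : 0 ∉ U) (hV0 : 0 ∉ V)
    (hl : l ≠ 0) : HasPlain U V l ∧
      (¬(3 ≤ V.card ∧ 2 ∈ V ∧ 1 ∈ U) → ¬Exceptional U V l → HasInsertable U V l) := by
  induction hN : U.sum + V.sum using Nat.strong_induction_on generalizing U V with
  | _ N ih =>
  by_cases h1 : 1 ∉ U ∧ 1 ∉ V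
  · obtain ⟨U', hU', rfl⟩ := exists_map_succ hU0 h1.1
    obtain ⟨V', hV', rfl⟩ := exists_map_succ hV0 h1.2
    rw [sum_map_succ, sum_map_succ] at hN
    rw [Multiset.card_map, Multiset.card_map] at hVU
    rw [Multiset.card_map] at hV
    have := (ih _ (by omega) hVU hV hU' hV' rfl).1.extend hVU (by omega)
    exact ⟨this.hasPlain, fun _ _ => this⟩
  by_cases h2 : 3 ≤ V.card ∧ 2 ∈ V ∧ 1 ∈ U
  · refine ⟨?_, fun h => absurd h2 h⟩
    obtain ⟨h3, h2, h1⟩ := h2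
    obtain ⟨U, rfl⟩ := Multiset.exists_cons_of_mem h1
    obtain ⟨V, rfl⟩ := Multiset.exists_cons_of_mem h2
    simp only [Multiset.card_cons, Multiset.sum_cons] at hVU h3 hN
    exact (ih _ (by omega) (by omega) (by omega) (fun h => hU0 (Multiset.mem_cons_of_mem h))
      (fun h => hV0 (Multiset.mem_cons_of_mem h)) rfl).1.add_one_two (by omega) (by omega)
  suffices h : ¬Exceptional U V l → HasInsertable U V l by
    by_cases he : Exceptional U V l
    · refine ⟨?_, fun _ h => absurd he h⟩
      obtain ⟨rfl, rfl, rfl⟩ := he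
      exact plain_small
    · exact ⟨(h he).hasPlain, fun _ => h⟩
  intro he
  -- With at least two more legs at `u`, any leg at `u` may be removed without losing `V.card <
  -- U.card`; only the exceptional remainder has to be avoided.
  rcases Nat.lt_or_ge (V.card + 1) U.card with hp | hp
  · by_cases hs : U = {1, 1, 1, 1} ∧ V = {2, 2} ∧ l = 1
    · obtain ⟨rfl, rfl, rfl⟩ := hs
      exact insertable_small
    obtain ⟨n, U, rfl, hn⟩ := exists_cons_not_exceptional (by rintro rfl; simp at hVU) hs
    have hn0 : n ≠ 0 := fun h => hU0 (h ▸ Multiset.mem_cons_self _ _)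
    simp only [Multiset.card_cons, Multiset.sum_cons] at hp hN
    refine ((ih _ (by omega) (by omega) hV (fun h => hU0 (Multiset.mem_cons_of_mem h))
      hV0 rfl).2 (fun h => h2 ⟨h.1, h.2.1, Multiset.mem_cons_of_mem h.2.2⟩) hn).addU (by omega) hV
      (by omega)
  replace hp : U.card = V.card + 1 := by omega
  rcases Nat.lt_or_ge V.card 3 with hq | hq
  · exact insertable_three_two (by omega) (by omega) hU0 hV0 hl (by tauto) he
  -- Only odd legs can be inserted at `v`. If there are none, the pendant edge must be at `u`, so no
  -- leg at `v` has length two, and all have even length at least four.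
  by_cases ho : ∃ x ∈ V, Odd x
  · obtain ⟨_, hx, k, rfl⟩ := ho
    obtain ⟨V, rfl⟩ := Multiset.exists_cons_of_mem hx
    simp only [Multiset.card_cons, Multiset.sum_cons] at hp hN hq
    refine ((ih _ (by omega) (by omega) (by omega) hU0 (fun h => hV0 (Multiset.mem_cons_of_mem h))
      rfl).2 (fun h => h2 ⟨by simp; omega, Multiset.mem_cons_of_mem h.2.1, h.2.2⟩)
      fun h => ?_).addV (by omega) (by omega) k
    rw [h.1] at hp
    simp at hp
    omega
  push Not at ho
  have h1U : 1 ∈ U := by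
    by_contra h
    exact h1 ⟨h, fun h => Nat.not_odd_iff_even.2 (ho 1 h |> Nat.not_odd_iff_even.1) odd_one⟩
  refine insertable_of_even hp hq (fun x hx => ?_) hU0 h1U hl
  have hx' := Nat.not_odd_iff_even.1 (ho x hx)
  have h0 : x ≠ 0 := fun h => hV0 (h ▸ hx)
  have h2 : x ≠ 2 := fun h => h2 ⟨hq, h ▸ hx, h1U⟩
  obtain ⟨y, rfl⟩ := hx'
  exact ⟨by omega, y, rfl⟩

lemma hasPlain (hVU : V.card < U.card) (hV : 2 ≤ V.card) (hU0 : 0 ∉ U) (hV0 : 0 ∉ V)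
    (hl : l ≠ 0) : HasPlain U V l :=
  (plain_and_insertable hVU hV hU0 hV0 hl).1

/-- Removing the pendant edge at `v` leaves a spider with more legs at `u`, to which the plain
result applies. With only two legs at `v` it would leave a single leg there, so that case is done by
recipes. -/
lemma hasBalanced_of_mem (hVU : V.card = U.card) (hV : 2 ≤ V.card) (hU0 : 0 ∉ U) (hV0 : 0 ∉ V)
    (hl : l ≠ 0) (h1 : 1 ∈ V) : HasBalanced U V l := by
  rcases Nat.lt_or_ge V.card 3 with hq | hq
  · exact balanced_two_two (by omega) (by omega) hU0 hV0 hl h1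
  · obtain ⟨V, rfl⟩ := Multiset.exists_cons_of_mem h1
    rw [Multiset.card_cons] at hVU hq
    exact (hasPlain (by omega) (by omega) hU0 (fun h => hV0 (Multiset.mem_cons_of_mem h))
      hl).balance (by omega) (by omega)

lemma hasBalanced (hVU : V.card = U.card) (hV : 2 ≤ V.card) (hU0 : 0 ∉ U) (hV0 : 0 ∉ V)
    (hl : l ≠ 0) : HasBalanced U V l := by
  induction hN : U.sum using Nat.strong_induction_on generalizing U V with
  | _ N ih =>
  by_cases h1 : 1 ∈ V
  · exact hasBalanced_of_mem hVU hV hU0 hV0 hl h1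
  by_cases h2 : 1 ∈ U
  · exact (hasBalanced_of_mem hVU.symm (by omega) hV0 hU0 hl h2).swap
  obtain ⟨U', hU', rfl⟩ := exists_map_succ hU0 h2
  obtain ⟨V', hV', rfl⟩ := exists_map_succ hV0 h1
  rw [sum_map_succ] at hN
  rw [Multiset.card_map, Multiset.card_map] at hVU
  rw [Multiset.card_map] at hV
  exact (ih _ (by omega) hVU hV hU' hV' rfl).extend hVU (by omega)

/-! ### Cutting a double spider into paths -/

section decomposition

variable {V : Type*} {G : SimpleGraph V}

/-- An interior vertex of a path has two neighbors on it, and `y` is a third one. -/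
lemma two_lt_degree [Fintype V] [DecidableRel G.Adj] {a x y : V} {w : List V} (hc : (a :: w).IsChain G.Adj) (hn : (a :: w).Nodup)
    (hx : x ∈ w) (hl : w.getLast? ≠ some x) (hxy : G.Adj x y) (hy : y ∉ a :: w) :
    2 < G.degree x := by
  induction w generalizing a with
  | nil => simp at hx
  | cons b w ih =>
    rw [List.isChain_cons_cons] at hc
    rw [List.nodup_cons] at hn
    by_cases hxb : x = b
    · subst hxb
      cases w with
      | nil => simp at hl
      | cons c w =>
        rw [List.isChain_cons_cons] at hc
        rw [← G.card_neighborFinset_eq_degree, Finset.two_lt_card_iff]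
        simp only [List.mem_cons, not_or] at hn hy
        refine ⟨a, c, y, ?_, ?_, ?_, hn.1.2.1, Ne.symm hy.1, Ne.symm hy.2.2.1⟩ <;>
          rw [SimpleGraph.mem_neighborFinset]
        exacts [hc.1.symm, hc.2.1, hxy]
    · have hx' : x ∈ w := (List.mem_cons.1 hx).resolve_left hxb
      refine ih hc.2 hn.2 hx' ?_ fun h => hy (List.mem_cons_of_mem _ h)
      cases w with
      | nil => simp at hx'
      | cons c w => rwa [List.getLast?_cons_cons] at hl

variable (G) in
/-- Part of a double spider: a path from `u` to `v` with the list `C` of interior vertices, and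
paths starting in `u` or `v`, which are given by their root and the list of the other vertices. -/
structure IsDecomp (u v : V) (C : List V) (L : List (V × List V)) : Prop where
  core : (u :: (C ++ [v])).IsChain G.Adj
  root : ∀ p ∈ L, p.1 = u ∨ p.1 = v
  ne_nil : ∀ p ∈ L, p.2 ≠ []
  chain : ∀ p ∈ L, (p.1 :: p.2).IsChain G.Adj
  nodup : (u :: (C ++ v :: L.flatMap Prod.snd)).Nodup

/-- If `x` is a branch vertex, the edge to `y` starts a new leg. If `x` is the end of a leg, this
leg is prolonged. Elsewhere `x` would have degree greater than two. -/
lemma IsDecomp.grow [Fintype V] [DecidableEq V] [DecidableRel G.Adj] {u v x y : V} {C : List V} {L : List (V × List V)}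
    (h : IsDecomp G u v C L)
    (hdeg : ∀ x, 2 < G.degree x → x = u ∨ x = v) (hx : x ∈ u :: (C ++ v :: L.flatMap Prod.snd))
    (hy : y ∉ u :: (C ++ v :: L.flatMap Prod.snd)) (hxy : G.Adj x y) :
    ∃ L', IsDecomp G u v C L' ∧ (L'.flatMap Prod.snd).length = (L.flatMap Prod.snd).length + 1 := by
  have hnew : ∀ M : List V, M.Perm (y :: L.flatMap Prod.snd) → (u :: (C ++ v :: M)).Nodup := by
    intro M hM
    have : (u :: (C ++ v :: M)).Perm (y :: (u :: (C ++ v :: L.flatMap Prod.snd))) := by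
      refine (((hM.cons v).append_left C).cons u).trans ?_
      refine (((List.Perm.swap _ _ _).append_left C).cons u).trans ?_
      refine (List.perm_middle.cons u).trans ?_
      exact List.Perm.swap _ _ _
    rw [this.nodup_iff]
    exact List.nodup_cons.2 ⟨hy, h.nodup⟩
  by_cases hroot : x = u ∨ x = v
  · refine ⟨(x, [y]) :: L, ⟨h.core, ?_, ?_, ?_, hnew _ (.refl _)⟩, by simp⟩
    · exact List.forall_mem_cons.2 ⟨hroot, h.root⟩
    · exact List.forall_mem_cons.2 ⟨by simp, h.ne_nil⟩
    · exact List.forall_mem_cons.2 ⟨by simpa using hxy, h.chain⟩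
  have hn := h.nodup
  have hsmall : ¬ 2 < G.degree x := fun hd => hroot (hdeg x hd)
  simp only [List.mem_cons, List.mem_append, not_or] at hx hy
  rcases hx with rfl | hx | rfl | hx
  · exact absurd (.inl rfl) hroot
  · refine absurd (two_lt_degree h.core ?_ (List.mem_append_left _ hx) ?_ hxy ?_) hsmall
    · refine hn.sublist (.cons_cons _ (.append_left ?_ _))
      simp
    · simp only [List.getLast?_append, List.getLast?_singleton, Option.some_or, ne_eq,
        Option.some.injEq]
      exact fun h => hroot (.inr h.symm)
    · simp only [List.mem_cons, List.mem_append, List.not_mem_nil, or_false, not_or]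
      exact ⟨hy.1, hy.2.1, hy.2.2.1⟩
  · exact absurd (.inr rfl) hroot
  obtain ⟨⟨a, w⟩, hp, hx⟩ := List.mem_flatMap.1 hx
  have hyw : y ∉ w := fun hyw => hy.2.2.2 (List.mem_flatMap.2 ⟨_, hp, hyw⟩)
  have hwn : w.Nodup := by
    have := (List.nodup_cons.1 (List.nodup_append.1 (List.nodup_cons.1 hn).2).2.1).2
    exact (List.nodup_flatMap.1 this).1 _ hp
  have haw : a ∉ w := by
    intro haw
    have : a ∈ L.flatMap Prod.snd := List.mem_flatMap.2 ⟨_, hp, haw⟩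
    rw [List.nodup_cons, List.nodup_append, List.nodup_cons] at hn
    rcases h.root _ hp with rfl | rfl
    · exact hn.1 (List.mem_append_right _ (List.mem_cons_of_mem _ this))
    · exact hn.2.2.1.1 this
  have hay : y ≠ a := by
    rcases h.root _ hp with rfl | rfl
    exacts [hy.1, hy.2.2.1]
  by_cases hl : w.getLast? = some x
  · have hperm := List.perm_cons_erase hp
    have hperm' : ((a, w ++ [y]) :: L.erase (a, w)).flatMap Prod.snd |>.Perm
        (y :: L.flatMap Prod.snd) := by
      refine .trans ?_ ((hperm.flatMap_right _).symm.cons y)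
      simp only [List.flatMap_cons, List.append_assoc, List.singleton_append]
      exact List.perm_middle
    refine ⟨(a, w ++ [y]) :: L.erase (a, w), ⟨h.core, ?_, ?_, ?_, hnew _ hperm'⟩, ?_⟩
    · exact List.forall_mem_cons.2 ⟨h.root (a, w) hp, fun p hp => h.root p (List.mem_of_mem_erase hp)⟩
    · exact List.forall_mem_cons.2 ⟨by simp, fun p hp => h.ne_nil p (List.mem_of_mem_erase hp)⟩
    · refine List.forall_mem_cons.2 ⟨?_, fun p hp => h.chain p (List.mem_of_mem_erase hp)⟩
      rw [← List.cons_append, List.isChain_append]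
      refine ⟨h.chain _ hp, List.isChain_singleton _, fun z hz z' hz' => ?_⟩
      have hne := h.ne_nil _ hp
      rw [List.getLast?_cons_of_ne_nil hne, hl] at hz
      simp at hz hz'
      rwa [← hz, ← hz']
    · rw [hperm'.length_eq]; rfl
  · refine absurd (two_lt_degree (h.chain _ hp) (List.nodup_cons.2 ⟨haw, hwn⟩) hx hl hxy ?_) hsmall
    simp [hay, hyw]

/-- While a vertex is missing, a walk from `u` to it leaves the decomposition along some edge, at
which the decomposition grows. -/
lemma IsDecomp.exists_spanning [Fintype V] [DecidableEq V] [DecidableRel G.Adj] {u v : V} {C : List V} {L : List (V × List V)}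
    (hG : G.Connected)
    (h : IsDecomp G u v C L) (hdeg : ∀ x, 2 < G.degree x → x = u ∨ x = v) :
    ∃ L', IsDecomp G u v C L' ∧ ∀ x, x ∈ u :: (C ++ v :: L'.flatMap Prod.snd) := by
  induction hN : Fintype.card V - (L.flatMap Prod.snd).length using Nat.strong_induction_on
    generalizing L with
  | _ N ih =>
  by_cases hall : ∀ x, x ∈ u :: (C ++ v :: L.flatMap Prod.snd)
  · exact ⟨L, h, hall⟩
  push Not at hall
  obtain ⟨y, hy⟩ := hall
  obtain ⟨p⟩ := hG.preconnected u y
  obtain ⟨d, -, hd1, hd2⟩ := p.exists_boundary_dart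
    {x | x ∈ u :: (C ++ v :: L.flatMap Prod.snd)} List.mem_cons_self hy
  obtain ⟨L', h', hL'⟩ := h.grow hdeg hd1 hd2 d.adj
  have hlen := h'.nodup.length_le_card
  simp only [List.length_cons, List.length_append] at hlen
  exact ih _ (by omega) h' rfl

lemma exists_isDecomp {u v : V} (hG : G.Connected) (huv : u ≠ v) : ∃ C, IsDecomp G u v C [] := by
  obtain ⟨p, hp⟩ := hG.exists_isPath u v
  have h1 := p.isChain_adj_support
  have h2 := hp.support_nodup
  rw [← p.cons_tail_support] at h1 h2
  have hne : p.support.tail ≠ [] := by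
    intro h
    have := p.getLast_support
    have h3 := p.cons_tail_support.symm
    rw [h] at h3
    simp [h3] at this
    exact huv this
  have h3 : p.support.tail = p.support.tail.dropLast ++ [v] := by
    conv_lhs => rw [← List.dropLast_append_getLast hne]
    rw [List.getLast_tail, p.getLast_support]
  rw [h3] at h1 h2
  exact ⟨_, h1, by simp, by simp, by simp, by simpa using h2⟩

end decomposition

/-! ### Sums of edge labels along a path -/

section paths

variable {α : Type*}

/-- The edges of a path, given by its first vertex and the list of the other vertices. -/
def edges : α → List α → List (Sym2 α)
  | _, [] => []
  | a, b :: w => s(a, b) :: edges b w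

@[simp] lemma length_edges (a : α) (w : List α) : (edges a w).length = w.length := by
  induction w generalizing a with
  | nil => rfl
  | cons b w ih => simp [edges, ih]

lemma exists_mem_of_mem_edges {a : α} {w : List α} {e : Sym2 α} (h : e ∈ edges a w) :
    ∃ y ∈ w, y ∈ e := by
  induction w generalizing a with
  | nil => simp [edges] at h
  | cons b w ih =>
    rcases List.mem_cons.1 h with rfl | h
    · exact ⟨b, by simp, by simp⟩
    · obtain ⟨y, hy, hye⟩ := ih h
      exact ⟨y, List.mem_cons_of_mem _ hy, hye⟩

lemma mem_of_mem_edges {a x : α} {w : List α} {e : Sym2 α} (h : e ∈ edges a w) (hx : x ∈ e) :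
    x ∈ a :: w := by
  induction w generalizing a with
  | nil => simp [edges] at h
  | cons b w ih =>
    rcases List.mem_cons.1 h with rfl | h
    · rcases Sym2.mem_iff.1 hx with rfl | rfl <;> simp
    · exact List.mem_cons_of_mem _ (ih h)

lemma nodup_edges {a : α} {w : List α} (h : (a :: w).Nodup) : (edges a w).Nodup := by
  induction w generalizing a with
  | nil => simp [edges]
  | cons b w ih =>
    rw [List.nodup_cons] at h
    exact List.nodup_cons.2 ⟨fun he => h.1 (mem_of_mem_edges he (by simp)), ih h.2⟩

lemma disjoint_edges {a b : α} {w w' : List α} (h : ∀ x ∈ w', x ∉ a :: w) :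
    List.Disjoint (edges a w) (edges b w') := by
  intro e he he'
  obtain ⟨y, hy, hye⟩ := exists_mem_of_mem_edges he'
  exact h y hy (mem_of_mem_edges he hye)

lemma mem_edgeSet_of_mem_edges {G : SimpleGraph α} {a : α} {w : List α}
    (h : (a :: w).IsChain G.Adj) {e : Sym2 α} (he : e ∈ edges a w) : e ∈ G.edgeSet := by
  induction w generalizing a with
  | nil => simp [edges] at he
  | cons b w ih =>
    rw [List.isChain_cons_cons] at h
    rcases List.mem_cons.1 he with rfl | he
    · exact h.1
    · exact ih h.2 he

variable [DecidableEq α] (g : Sym2 α → ℕ)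

/-- The sum of the labels of those edges in a list that are incident to `x`. -/
def incSum (es : List (Sym2 α)) (x : α) : ℕ := (es.map fun e => if x ∈ e then g e else 0).sum

variable {g}

lemma incSum_edges_of_notMem {a x : α} {w : List α} (h : x ∉ a :: w) :
    incSum g (edges a w) x = 0 := by
  refine List.sum_eq_zero fun n hn => ?_
  obtain ⟨e, he, rfl⟩ := List.mem_map.1 hn
  exact if_neg fun hx => h (mem_of_mem_edges he hx)

lemma incSum_edges_root {a : α} {w : List α} (h : a ∉ w) :
    incSum g (edges a w) a = ((edges a w).map g).headD 0 := by
  cases w with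
  | nil => rfl
  | cons b w =>
    have := incSum_edges_of_notMem (g := g) h
    simp only [incSum] at this ⊢
    simp [edges, this]

/-- After the root, each vertex but the last lies on two consecutive edges, and the last lies on
one. -/
lemma map_incSum_edges {a : α} {w : List α} (h : (a :: w).Nodup) (hw : w ≠ []) :
    w.map (incSum g (edges a w)) =
      (pairs ((edges a w).map g)).map psum ++ [((edges a w).map g).getLastD 0] := by
  induction w generalizing a with
  | nil => exact absurd rfl hw
  | cons b w ih =>
    have hn := h
    rw [List.nodup_cons, List.nodup_cons] at h
    have key : ∀ x, incSum g (edges a (b :: w)) x =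
        (if x ∈ s(a, b) then g s(a, b) else 0) + incSum g (edges b w) x := by
      intro x; simp [incSum, edges]
    have hrest : w.map (incSum g (edges a (b :: w))) = w.map (incSum g (edges b w)) := by
      refine List.map_congr_left fun x hx => ?_
      rw [key, if_neg, zero_add]
      rw [Sym2.mem_iff, not_or]
      exact ⟨fun hxa => h.1 (hxa ▸ List.mem_cons_of_mem _ hx), fun hxb => h.2.1 (hxb ▸ hx)⟩
    rw [List.map_cons, hrest, key, incSum_edges_root h.2.1, if_pos (by simp)]
    cases w with
    | nil => simp [edges]
    | cons c w =>
      rw [ih (List.nodup_cons.2 h.2) (by simp)]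
      simp [edges, psum]

lemma map_incSum_dropLast {a : α} {w : List α} (h : (a :: w).Nodup) :
    w.dropLast.map (incSum g (edges a w)) = (pairs ((edges a w).map g)).map psum := by
  rcases eq_or_ne w [] with rfl | hw
  · rfl
  rw [List.map_dropLast, map_incSum_edges h hw, List.dropLast_concat]

lemma incSum_getLast {a : α} {w : List α} (h : (a :: w).Nodup) (hw : w ≠ []) :
    incSum g (edges a w) (w.getLast hw) = ((edges a w).map g).getLastD 0 := by
  have := map_incSum_edges (g := g) h hw
  have h2 := congrArg (fun l => l.getLastD 0) this
  simp only [List.getLastD_concat] at h2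
  rw [← h2, List.getLastD_eq_getLast?, List.getLast?_map, List.getLast?_eq_some_getLast hw]
  rfl

end paths

lemma exists_map_eq {α : Type*} {l : List α} {l' : List ℕ} (h : l.Nodup)
    (hl : l.length = l'.length) : ∃ f : α → ℕ, l.map f = l' := by
  classical
  induction l generalizing l' with
  | nil => exact ⟨fun _ => 0, (List.eq_nil_of_length_eq_zero hl.symm).symm⟩
  | cons a l ih =>
    obtain ⟨b, l', rfl⟩ := List.exists_cons_of_length_pos (l := l') (by simp at hl; omega)
    rw [List.nodup_cons] at h
    obtain ⟨f, rfl⟩ := ih (l' := l') h.2 (by simpa using hl)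
    refine ⟨Function.update f a b, ?_⟩
    rw [List.map_cons, Function.update_self]
    congr 1
    refine List.map_congr_left fun x hx => Function.update_of_ne ?_ _ _
    rintro rfl
    exact h.1 hx

/-- It orders the legs of an abstract labeling so that their lengths match those of the legs of the
graph one by one. -/
lemma exists_coe_eq {α β : Type*} {f : α → β} {M : Multiset α} {l : List β}
    (h : M.map f = (l : Multiset β)) : ∃ l' : List α, M = l' ∧ l'.map f = l := by
  induction l generalizing M with
  | nil => exact ⟨[], Multiset.map_eq_zero.1 h, rfl⟩
  | cons b l ih =>
    have hb : b ∈ M.map f := by rw [h]; simp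
    obtain ⟨a, ha, rfl⟩ := Multiset.mem_map.1 hb
    obtain ⟨M, rfl⟩ := Multiset.exists_cons_of_mem ha
    rw [Multiset.map_cons, ← Multiset.cons_coe, Multiset.cons_inj_right] at h
    obtain ⟨l', rfl, rfl⟩ := ih h
    exact ⟨a :: l', rfl, rfl⟩

open Labeling

variable {V : Type*} {G : SimpleGraph V} {u v : V} {C : List V} {L : List (V × List V)}

namespace IsDecomp

lemma notMem_root (h : IsDecomp G u v C L) {p : V × List V} (hp : p ∈ L) {x : V} (hx : x ∈ p.2) :
    x ∉ u :: (C ++ [v]) := by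
  have hx' : x ∈ L.flatMap Prod.snd := List.mem_flatMap.2 ⟨p, hp, hx⟩
  have hn := h.nodup
  rw [List.nodup_cons, List.nodup_append, List.nodup_cons] at hn
  intro hxc
  simp only [List.mem_cons, List.mem_append, List.not_mem_nil, or_false] at hxc
  rcases hxc with rfl | hxc | rfl
  · exact hn.1 (by simp [hx'])
  · exact hn.2.2.2 x hxc x (List.mem_cons_of_mem _ hx') rfl
  · exact hn.2.2.1.1 hx'

lemma ne_root (h : IsDecomp G u v C L) {p q : V × List V} (hp : p ∈ L) {x : V} (hx : x ∈ p.2)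
    (hq : q ∈ L) : x ≠ q.1 := by
  have := h.notMem_root hp hx
  simp only [List.mem_cons, List.mem_append, not_or] at this
  rcases h.root q hq with h' | h' <;> rw [h']
  exacts [this.1, this.2.2.1]

lemma nodup_leg (h : IsDecomp G u v C L) {p : V × List V} (hp : p ∈ L) : (p.1 :: p.2).Nodup := by
  refine List.nodup_cons.2 ⟨fun h' => h.ne_root hp h' hp rfl, ?_⟩
  have := (List.nodup_cons.1 (List.nodup_append.1 (List.nodup_cons.1 h.nodup).2).2.1).2
  exact (List.nodup_flatMap.1 this).1 _ hp

lemma nodup_core (h : IsDecomp G u v C L) : (u :: (C ++ [v])).Nodup := by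
  refine h.nodup.sublist (.cons_cons _ (.append_left ?_ _))
  simp

lemma pairwise_legs (h : IsDecomp G u v C L) :
    L.Pairwise fun p q => List.Disjoint p.2 q.2 := by
  have := (List.nodup_cons.1 (List.nodup_append.1 (List.nodup_cons.1 h.nodup).2).2.1).2
  exact (List.nodup_flatMap.1 this).2

end IsDecomp

/-! ### Vertex sums of a spanning decomposition -/

/-- The paths that make up a decomposition. -/
def items (u v : V) (C : List V) (L : List (V × List V)) : List (V × List V) := (u, C ++ [v]) :: L

/-- The edges in a decomposition. -/
def allEdges (u v : V) (C : List V) (L : List (V × List V)) : List (Sym2 V) :=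
  (items u v C L).flatMap fun p => edges p.1 p.2

lemma IsDecomp.nodup_allEdges (h : IsDecomp G u v C L) : (allEdges u v C L).Nodup := by
  refine List.nodup_flatMap.2 ⟨?_, ?_⟩
  · exact List.forall_mem_cons.2 ⟨nodup_edges h.nodup_core, fun p hp => nodup_edges (h.nodup_leg hp)⟩
  · refine List.pairwise_cons.2 ⟨fun p hp => disjoint_edges fun x hx => h.notMem_root hp hx, ?_⟩
    refine h.pairwise_legs.imp_of_mem fun {p q} hp hq hd => disjoint_edges fun x hx hx' => ?_
    rcases List.mem_cons.1 hx' with rfl | hx'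
    · exact h.ne_root hq hx hp rfl
    · exact hd hx' hx

lemma length_allEdges : (allEdges u v C L).length = C.length + 1 + (L.flatMap Prod.snd).length := by
  simp [allEdges, items, List.length_flatMap]

/-- The paths have one edge fewer than there are vertices, as does the tree, so no edge is missing.
-/
lemma IsDecomp.toFinset_allEdges [Fintype V] [DecidableEq V] [DecidableRel G.Adj]
    (h : IsDecomp G u v C L) (hG : G.IsTree) (hall : ∀ x, x ∈ u :: (C ++ v :: L.flatMap Prod.snd)) :
    (allEdges u v C L).toFinset = G.edgeFinset := by
  have hcard : Fintype.card V = (u :: (C ++ v :: L.flatMap Prod.snd)).length := by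
    rw [← List.toFinset_card_of_nodup h.nodup, ← Finset.card_univ]
    congr 1
    ext x
    exact iff_of_true (Finset.mem_univ x) (List.mem_toFinset.2 (hall x))
  refine Finset.eq_of_subset_of_card_le (fun e he => ?_) ?_
  · obtain ⟨p, hp, he⟩ := List.mem_flatMap.1 (List.mem_toFinset.1 he)
    rw [SimpleGraph.mem_edgeFinset]
    rcases List.mem_cons.1 hp with rfl | hp
    · exact mem_edgeSet_of_mem_edges h.core he
    · exact mem_edgeSet_of_mem_edges (h.chain p hp) he
  · have := hG.card_edgeFinset
    rw [List.toFinset_card_of_nodup h.nodup_allEdges, length_allEdges]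
    simp only [List.length_cons, List.length_append] at hcard
    omega

lemma IsDecomp.vertexSum_eq [Fintype V] [DecidableEq V] [DecidableRel G.Adj]
    (h : IsDecomp G u v C L) (hG : G.IsTree) (hall : ∀ x, x ∈ u :: (C ++ v :: L.flatMap Prod.snd))
    (g : Sym2 V → ℕ) (x : V) : G.vertexSum g x =
      incSum g (edges u (C ++ [v])) x + (L.map fun p => incSum g (edges p.1 p.2) x).sum := by
  have : G.vertexSum g x = ((allEdges u v C L).map fun e => if x ∈ e then g e else 0).sum := by
    rw [SimpleGraph.vertexSum, SimpleGraph.incidenceFinset_eq_filter, Finset.sum_filter,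
      ← h.toFinset_allEdges hG hall, List.sum_toFinset _ h.nodup_allEdges]
  rw [this, allEdges, items, List.flatMap_cons, List.map_append, List.sum_append, List.map_flatMap,
    List.flatMap_def, List.sum_flatten, List.map_map]
  rfl

/-- The labels of the edges in a decomposition. -/
def labelingOf [DecidableEq V] (u v : V) (C : List V) (L : List (V × List V)) (g : Sym2 V → ℕ) :
    Labeling :=
  ⟨((L : Multiset (V × List V)).filter (·.1 = u)).map fun p => (edges p.1 p.2).map g,
    ((L : Multiset (V × List V)).filter (¬ ·.1 = u)).map fun p => (edges p.1 p.2).map g,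
    (edges u (C ++ [v])).map g⟩

lemma sum_map_ite {α : Type*} (L : List α) (P : α → Prop) [DecidablePred P] {f k : α → ℕ}
    (hf : ∀ p ∈ L, f p = if P p then k p else 0) :
    (L.map f).sum = (((L : Multiset α).filter P).map k).sum := by
  rw [List.map_congr_left hf]
  clear hf
  induction L with
  | nil => rfl
  | cons p L ih =>
    rw [List.map_cons, List.sum_cons, ih, ← Multiset.cons_coe]
    by_cases h : P p <;> simp [h]

lemma bind_filter {α β : Type*} (L : Multiset α) (P : α → Prop) [DecidablePred P]
    (k : α → Multiset β) :
    (L.filter P).bind k + (L.filter (¬ P ·)).bind k = L.bind k := by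
  rw [← Multiset.add_bind, Multiset.filter_add_not]

section sums

variable [Fintype V] [DecidableEq V] [DecidableRel G.Adj]

lemma IsDecomp.vertexSum_leg (h : IsDecomp G u v C L) (hG : G.IsTree)
    (hall : ∀ x, x ∈ u :: (C ++ v :: L.flatMap Prod.snd)) (g : Sym2 V → ℕ) {p : V × List V}
    (hp : p ∈ L) {x : V} (hx : x ∈ p.2) : G.vertexSum g x = incSum g (edges p.1 p.2) x := by
  rw [h.vertexSum_eq hG hall, incSum_edges_of_notMem (h.notMem_root hp hx), zero_add]
  have hL := h.pairwise_legs
  obtain ⟨s, t, hst⟩ := List.append_of_mem hp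
  have hz : ∀ q ∈ s ++ t, incSum g (edges q.1 q.2) x = 0 := by
    intro q hq
    refine incSum_edges_of_notMem fun hx' => ?_
    have hq' : q ∈ L := by
      rw [hst]; simp only [List.mem_append, List.mem_cons] at hq ⊢; tauto
    rcases List.mem_cons.1 hx' with rfl | hx'
    · exact h.ne_root hp hx hq' rfl
    · rw [hst, List.pairwise_append, List.pairwise_cons] at hL
      rcases List.mem_append.1 hq with hq | hq
      · exact hL.2.2 q hq p (by simp) hx' hx
      · exact hL.2.1.1 q hq hx hx'
  have hz' : ∀ l : List (V × List V), (∀ q ∈ l, incSum g (edges q.1 q.2) x = 0) →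
      (l.map fun q => incSum g (edges q.1 q.2) x).sum = 0 := by
    intro l hl
    refine List.sum_eq_zero fun n hn => ?_
    obtain ⟨q, hq, rfl⟩ := List.mem_map.1 hn
    exact hl q hq
  rw [hst, List.map_append, List.map_cons, List.sum_append, List.sum_cons,
    hz' s fun q hq => hz q (List.mem_append_left _ hq),
    hz' t fun q hq => hz q (List.mem_append_right _ hq), zero_add, add_zero]

lemma IsDecomp.vertexSum_core (h : IsDecomp G u v C L) (hG : G.IsTree)
    (hall : ∀ x, x ∈ u :: (C ++ v :: L.flatMap Prod.snd)) (g : Sym2 V → ℕ) {x : V}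
    (hx : x ∈ C) : G.vertexSum g x = incSum g (edges u (C ++ [v])) x := by
  rw [h.vertexSum_eq hG hall, add_eq_left]
  refine List.sum_eq_zero fun n hn => ?_
  obtain ⟨q, hq, rfl⟩ := List.mem_map.1 hn
  refine incSum_edges_of_notMem fun hx' => ?_
  rcases List.mem_cons.1 hx' with rfl | hx'
  · have hn := h.nodup_core
    rw [List.nodup_cons, List.nodup_append] at hn
    rcases h.root q hq with h' | h' <;> rw [h'] at hx
    · exact hn.1 (List.mem_append_left _ hx)
    · exact hn.2.2.2 _ hx v (by simp) rfl
  · exact h.notMem_root hq hx' (by simp [hx])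

lemma IsDecomp.vertexSum_left (h : IsDecomp G u v C L) (hG : G.IsTree)
    (hall : ∀ x, x ∈ u :: (C ++ v :: L.flatMap Prod.snd)) (g : Sym2 V → ℕ) :
    G.vertexSum g u = (labelingOf u v C L g).edgesU.sum := by
  rw [h.vertexSum_eq hG hall, incSum_edges_root (List.nodup_cons.1 h.nodup_core).1, edgesU,
    labelingOf, Multiset.sum_cons, Multiset.map_map]
  congr 1
  refine sum_map_ite L _ fun p hp => ?_
  have hu : u ∉ p.2 := fun hu => h.notMem_root hp hu (by simp)
  split_ifs with hpu
  · rw [Function.comp, hpu, incSum_edges_root hu]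
  · exact incSum_edges_of_notMem (by simp [hu, Ne.symm hpu])

lemma IsDecomp.vertexSum_right (h : IsDecomp G u v C L) (hG : G.IsTree)
    (hall : ∀ x, x ∈ u :: (C ++ v :: L.flatMap Prod.snd)) (g : Sym2 V → ℕ) :
    G.vertexSum g v = (labelingOf u v C L g).edgesV.sum := by
  have hlast := incSum_getLast (g := g) h.nodup_core (by simp)
  rw [List.getLast_concat] at hlast
  have huv : v ≠ u := fun hvu => (List.nodup_cons.1 h.nodup_core).1 (by simp [hvu])
  rw [h.vertexSum_eq hG hall, hlast, edgesV, labelingOf, Multiset.sum_cons, Multiset.map_map]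
  congr 1
  refine sum_map_ite L _ fun p hp => ?_
  have hv : v ∉ p.2 := fun hv => h.notMem_root hp hv (by simp)
  by_cases hpu : p.1 = u
  · rw [if_neg (not_not.2 hpu)]
    exact incSum_edges_of_notMem (by simp [hv, hpu, huv])
  · rw [if_pos hpu, Function.comp, (h.root p hp).resolve_left hpu, incSum_edges_root hv]

/-- The vertices of degree two. -/
def innerVertices (C : List V) (L : List (V × List V)) : List V :=
  C ++ L.flatMap fun p => p.2.dropLast

/-- The vertices of degree one. -/
def leafVertices (u : V) (L : List (V × List V)) : List V := L.map fun p => p.2.getLastD u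

lemma IsDecomp.map_innerVertices (h : IsDecomp G u v C L) (hG : G.IsTree)
    (hall : ∀ x, x ∈ u :: (C ++ v :: L.flatMap Prod.snd)) (g : Sym2 V → ℕ) :
    ((innerVertices C L).map (G.vertexSum g) : Multiset ℕ) =
      (labelingOf u v C L g).inner.map psum := by
  have h1 : C.map (G.vertexSum g) = (pairs ((edges u (C ++ [v])).map g)).map psum := by
    rw [← map_incSum_dropLast h.nodup_core, List.dropLast_concat]
    exact List.map_congr_left fun x hx => h.vertexSum_core hG hall g hx
  have h2 : (L.flatMap fun p => p.2.dropLast).map (G.vertexSum g) =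
      L.flatMap fun p => (pairs ((edges p.1 p.2).map g)).map psum := by
    rw [List.map_flatMap]
    refine List.flatMap_congr fun p hp => ?_
    rw [← map_incSum_dropLast (h.nodup_leg hp)]
    exact List.map_congr_left fun x hx => h.vertexSum_leg hG hall g hp (List.mem_of_mem_dropLast hx)
  rw [innerVertices, List.map_append, h1, h2, ← Multiset.coe_add, add_comm, Labeling.inner,
    labelingOf, Multiset.map_add, Multiset.bind_map, Multiset.bind_map, bind_filter,
    Multiset.map_bind, Multiset.map_coe]
  congr 1
  exact (Multiset.coe_bind L fun p => (pairs ((edges p.1 p.2).map g)).map psum).symm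

lemma IsDecomp.map_leafVertices (h : IsDecomp G u v C L) (hG : G.IsTree)
    (hall : ∀ x, x ∈ u :: (C ++ v :: L.flatMap Prod.snd)) (g : Sym2 V → ℕ) :
    ((leafVertices u L).map (G.vertexSum g) : Multiset ℕ) = (labelingOf u v C L g).leaves := by
  rw [leaves, labelingOf, Multiset.map_map, Multiset.map_map, ← Multiset.map_add,
    Multiset.filter_add_not, Multiset.map_coe, leafVertices, List.map_map]
  congr 1
  refine List.map_congr_left fun p hp => ?_
  have hne := h.ne_nil p hp
  have hlast : p.2.getLastD u = p.2.getLast hne := by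
    rw [List.getLastD_eq_getLast?, List.getLast?_eq_some_getLast hne]; rfl
  rw [Function.comp, Function.comp, hlast, h.vertexSum_leg hG hall g hp (List.getLast_mem hne),
    incSum_getLast (h.nodup_leg hp)]

end sums

lemma IsDecomp.mem_cases (h : IsDecomp G u v C L)
    (hall : ∀ x, x ∈ u :: (C ++ v :: L.flatMap Prod.snd)) (x : V) :
    x = u ∨ x = v ∨ x ∈ innerVertices C L ∨ x ∈ leafVertices u L := by
  have := hall x
  simp only [List.mem_cons, List.mem_append, List.mem_flatMap] at this
  rcases this with rfl | hx | rfl | ⟨p, hp, hx⟩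
  · exact .inl rfl
  · exact .inr (.inr (.inl (List.mem_append_left _ hx)))
  · exact .inr (.inl rfl)
  have hne := h.ne_nil p hp
  have hlast : p.2.getLastD u = p.2.getLast hne := by
    rw [List.getLastD_eq_getLast?, List.getLast?_eq_some_getLast hne]; rfl
  rw [← List.dropLast_append_getLast hne, List.mem_append, List.mem_singleton] at hx
  rcases hx with hx | hx
  · exact .inr (.inr (.inl (List.mem_append_right _ (List.mem_flatMap.2 ⟨p, hp, hx⟩))))
  · exact .inr (.inr (.inr (List.mem_map.2 ⟨p, hp, by rw [hlast, hx]⟩)))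

lemma labels_labelingOf [DecidableEq V] (g : Sym2 V → ℕ) :
    (labelingOf u v C L g).labels = ((allEdges u v C L).map g : Multiset ℕ) := by
  rw [labels, labelingOf, Multiset.bind_map, Multiset.bind_map, bind_filter, allEdges, items,
    List.flatMap_cons, List.map_append, ← Multiset.coe_add, add_comm, List.map_flatMap]
  congr 1
  exact Multiset.coe_bind L fun p => (edges p.1 p.2).map g

/-- The edges of all paths, listed one after the other, are distinct, so a function can take the
prescribed labels on them. Since the pieces have equal lengths, equality of the flattened lists
gives equality piece by piece. -/
lemma IsDecomp.exists_labelingOf_eq [DecidableEq V] (h : IsDecomp G u v C L) {D : Labeling}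
    (hD : Shape D (((L : Multiset (V × List V)).filter (·.1 = u)).map fun p => p.2.length)
      (((L : Multiset (V × List V)).filter (¬ ·.1 = u)).map fun p => p.2.length) (C.length + 1)) :
    ∃ f, labelingOf u v C L f = D := by
  obtain ⟨A, B, c⟩ := D
  obtain ⟨h1, h2, h3⟩ := hD
  simp only [Multiset.filter_coe, Multiset.map_coe] at h1 h2
  obtain ⟨A, rfl, hA⟩ := exists_coe_eq h1
  obtain ⟨B, rfl, hB⟩ := exists_coe_eq h2
  set E : V × List V → List (Sym2 V) := fun p => edges p.1 p.2
  set L₁ := L.filter (·.1 = u)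
  set L₂ := L.filter (¬ ·.1 = u)
  have hperm : ((edges u (C ++ [v]) :: (L₁.map E ++ L₂.map E)).flatten).Perm
      (allEdges u v C L) := by
    rw [allEdges, items, List.flatMap_cons, List.flatten_cons, ← List.map_append,
      ← List.flatMap_def]
    refine .append_left _ (List.Perm.flatMap_right _ ?_)
    rw [← Multiset.coe_eq_coe, ← Multiset.coe_add, ← Multiset.filter_coe, ← Multiset.filter_coe,
      Multiset.filter_add_not]
  have hlen : (edges u (C ++ [v]) :: (L₁.map E ++ L₂.map E)).map List.length =
      (c :: (A ++ B)).map List.length := by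
    simp only [List.map_cons, List.map_append, hA, hB, List.map_map]
    simp only at h3
    simp [h3, E, Function.comp_def]
  obtain ⟨f, hf⟩ := exists_map_eq (l' := (c :: (A ++ B)).flatten)
    (hperm.nodup_iff.2 h.nodup_allEdges) (by rw [List.length_flatten, List.length_flatten, hlen])
  refine ⟨f, ?_⟩
  have key : (edges u (C ++ [v]) :: (L₁.map E ++ L₂.map E)).map (List.map f) = c :: (A ++ B) := by
    rw [List.eq_iff_flatten_eq]
    refine ⟨by rw [← hf, List.map_flatten], ?_⟩
    rw [← hlen, List.map_map]
    exact List.map_congr_left fun l _ => by simp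
  rw [List.map_cons, List.map_append, List.cons.injEq] at key
  obtain ⟨k2, k3⟩ := List.append_inj key.2 (by
    simpa using (congrArg List.length hA).symm)
  rw [List.map_map] at k2 k3
  rw [labelingOf, Multiset.filter_coe, Multiset.filter_coe, Multiset.map_coe, Multiset.map_coe,
    key.1, ← k2, ← k3]
  rfl

open Labeling

/-! ### Degrees and the conclusion -/

lemma Plain.balanced {τ : ℕ} {D : Labeling} (h : Plain τ D) : Balanced D where
  wf := h.wf
  full := h.full
  nodup := h.nodup
  leaf x hx p hp := (h.leaf x hx).trans_lt (h.low p hp)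
  leafU x hx := (h.leaf x hx).trans_lt (h.lowV.trans h.lt)
  leafV x hx := (h.leaf x hx).trans_lt h.lowV
  highU p hp := (h.high p hp).trans h.lt
  highV := h.high
  ne := h.lt.ne'

/-- With all labels equal to `1`, vertex sums are degrees, so the formulas for vertex sums also
yield the degrees. In this form the lemmas on relabeled labelings apply, and every label can be
replaced by `1`. -/
lemma labelingOf_one {V : Type*} [DecidableEq V] {u v : V} {C : List V} {L : List (V × List V)} :
    labelingOf u v C L (fun _ => 1) = (labelingOf u v C L fun _ => 1).map fun _ => 1 := by
  simp [labelingOf, Labeling.map, Function.comp_def]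

lemma IsDecomp.wf {V : Type*} [DecidableEq V] {G : SimpleGraph V} {u v : V} {C : List V}
    {L : List (V × List V)} (h : IsDecomp G u v C L) (g : Sym2 V → ℕ) :
    (labelingOf u v C L g).WF := by
  have key : ∀ p ∈ L, (edges p.1 p.2).map g ≠ [] := fun p hp => by
    rw [← List.length_pos_iff, List.length_map, length_edges]
    exact List.length_pos_iff.2 (h.ne_nil p hp)
  refine ⟨?_, fun l hl => ?_, fun l hl => ?_⟩
  · rw [← List.length_pos_iff, labelingOf, List.length_map, length_edges]
    simp
  all_goals
    simp only [labelingOf] at hl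
    obtain ⟨p, hp, rfl⟩ := Multiset.mem_map.1 hl
    exact key p (Multiset.mem_of_mem_filter hp)

variable {V : Type*} [Fintype V] [DecidableEq V] {G : SimpleGraph V} [DecidableRel G.Adj]
  {u v : V} {C : List V} {L : List (V × List V)}

lemma vertexSum_one (x : V) : G.vertexSum (fun _ => 1) x = G.degree x := by
  rw [SimpleGraph.vertexSum, Finset.sum_const, smul_eq_mul, mul_one,
    G.card_incidenceFinset_eq_degree]

lemma bijOn_of_full {f : Sym2 V → ℕ} {es : List (Sym2 V)} (hes : es.toFinset = G.edgeFinset)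
    (hn : es.Nodup) (hf : Full (es.map f : Multiset ℕ)) :
    Set.BijOn f G.edgeSet (Set.Icc 1 G.edgeFinset.card) := by
  have hmem : ∀ e, e ∈ G.edgeSet ↔ e ∈ es := fun e => by
    rw [← SimpleGraph.mem_edgeFinset, ← hes, List.mem_toFinset]
  have hcard : (es.map f : Multiset ℕ).card = G.edgeFinset.card := by
    rw [Multiset.coe_card, List.length_map, ← hes, List.toFinset_card_of_nodup hn]
  refine ⟨fun e he => ?_, fun e he e' he' hee => ?_, fun n hn' => ?_⟩
  · have := hf.mem_iff.1 (Multiset.mem_coe.2 (List.mem_map_of_mem (f := f) ((hmem e).1 he)))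
    rwa [hcard] at this
  · exact List.inj_on_of_nodup_map (Multiset.coe_nodup.1 hf.nodup) ((hmem e).1 he)
      ((hmem e').1 he') hee
  · have := hf n hn'.1 (hn'.2.trans hcard.ge)
    obtain ⟨e, he, rfl⟩ := List.mem_map.1 (Multiset.mem_coe.1 this)
    exact ⟨e, (hmem e).2 he, rfl⟩

lemma IsDecomp.degree_inner (h : IsDecomp G u v C L) (hG : G.IsTree)
    (hall : ∀ x, x ∈ u :: (C ++ v :: L.flatMap Prod.snd)) {x : V} (hx : x ∈ innerVertices C L) :
    G.degree x = 2 := by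
  have hm := Multiset.mem_coe.2 (List.mem_map_of_mem (f := G.vertexSum fun _ => 1) hx)
  rw [h.map_innerVertices hG hall, labelingOf_one, inner_map, vertexSum_one,
    Multiset.map_map, Multiset.mem_map] at hm
  obtain ⟨p, -, hp⟩ := hm
  exact hp.symm

lemma IsDecomp.degree_leaf (h : IsDecomp G u v C L) (hG : G.IsTree)
    (hall : ∀ x, x ∈ u :: (C ++ v :: L.flatMap Prod.snd)) {x : V} (hx : x ∈ leafVertices u L) :
    G.degree x = 1 := by
  have hm := Multiset.mem_coe.2 (List.mem_map_of_mem (f := G.vertexSum fun _ => 1) hx)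
  rw [h.map_leafVertices hG hall, labelingOf_one, leaves_map _ (h.wf _), vertexSum_one,
    Multiset.mem_map] at hm
  obtain ⟨p, -, hp⟩ := hm
  exact hp.symm

lemma IsDecomp.degree_left (h : IsDecomp G u v C L) (hG : G.IsTree)
    (hall : ∀ x, x ∈ u :: (C ++ v :: L.flatMap Prod.snd)) :
    G.degree u = ((L : Multiset (V × List V)).filter (·.1 = u)).card + 1 := by
  rw [← vertexSum_one, h.vertexSum_left hG hall, labelingOf_one, edgesU_map _ (h.wf _),
    Multiset.map_const', Multiset.sum_replicate, smul_eq_mul, mul_one, edgesU, Multiset.card_cons,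
    Multiset.card_map, labelingOf, Multiset.card_map]

lemma IsDecomp.degree_right (h : IsDecomp G u v C L) (hG : G.IsTree)
    (hall : ∀ x, x ∈ u :: (C ++ v :: L.flatMap Prod.snd)) :
    G.degree v = ((L : Multiset (V × List V)).filter (¬ ·.1 = u)).card + 1 := by
  rw [← vertexSum_one, h.vertexSum_right hG hall, labelingOf_one, edgesV_map _ (h.wf _),
    Multiset.map_const', Multiset.sum_replicate, smul_eq_mul, mul_one, edgesV, Multiset.card_cons,
    Multiset.card_map, labelingOf, Multiset.card_map]

/-- Leaves, vertices of degree two and branch vertices have degree one, two and at least three, and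
their sums are separated in this order. Within the first two classes it remains to see distinctness,
and between `u` and `v` the order is `hlt`. -/
lemma IsDecomp.isStronglyAntimagicLabeling (h : IsDecomp G u v C L) (hG : G.IsTree)
    (hall : ∀ x, x ∈ u :: (C ++ v :: L.flatMap Prod.snd)) (hu : 2 < G.degree u)
    (hv : 2 < G.degree v) (hvu : G.degree v ≤ G.degree u) {f : Sym2 V → ℕ}
    (hb : Balanced (labelingOf u v C L f))
    (hlt : G.degree v < G.degree u →
      (labelingOf u v C L f).edgesV.sum < (labelingOf u v C L f).edgesU.sum) :
    G.IsStronglyAntimagicLabeling f := by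
  have hU := h.vertexSum_left hG hall f
  have hV := h.vertexSum_right hG hall f
  have hI := h.map_innerVertices hG hall f
  have hL := h.map_leafVertices hG hall f
  have inner : ∀ x ∈ innerVertices C L, G.degree x = 2 ∧
      ∃ p ∈ (labelingOf u v C L f).inner, psum p = G.vertexSum f x := fun x hx => by
    refine ⟨h.degree_inner hG hall hx, ?_⟩
    have := Multiset.mem_coe.2 (List.mem_map_of_mem (f := G.vertexSum f) hx)
    rwa [hI, Multiset.mem_map] at this
  have leaf : ∀ x ∈ leafVertices u L, G.degree x = 1 ∧
      G.vertexSum f x ∈ (labelingOf u v C L f).leaves := fun x hx => by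
    refine ⟨h.degree_leaf hG hall hx, ?_⟩
    have := Multiset.mem_coe.2 (List.mem_map_of_mem (f := G.vertexSum f) hx)
    rwa [hL] at this
  have inner_inj : ∀ x ∈ innerVertices C L, ∀ y ∈ innerVertices C L, x ≠ y →
      G.vertexSum f x ≠ G.vertexSum f y := fun x hx y hy hxy he =>
    hxy (List.inj_on_of_nodup_map (Multiset.coe_nodup.1 (hI ▸ hb.nodup)) hx hy he)
  have leaf_inj : ∀ x ∈ leafVertices u L, ∀ y ∈ leafVertices u L, x ≠ y →
      G.vertexSum f x ≠ G.vertexSum f y := fun x hx y hy hxy he =>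
    hxy (List.inj_on_of_nodup_map (Multiset.coe_nodup.1
      (hL ▸ Multiset.nodup_of_le (leaves_le_labels hb.wf) hb.full.nodup)) hx hy he)
  have key : ∀ x y, x ≠ y → G.vertexSum f x ≠ G.vertexSum f y ∧
      (G.degree y < G.degree x → G.vertexSum f y < G.vertexSum f x) := by
    have hne := hb.ne
    rw [← hU, ← hV] at hlt hne
    have inner' : ∀ x ∈ innerVertices C L, G.degree x = 2 ∧ G.vertexSum f x < G.vertexSum f u ∧
        G.vertexSum f x < G.vertexSum f v ∧
        ∀ y ∈ leafVertices u L, G.vertexSum f y < G.vertexSum f x := by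
      intro x hx
      obtain ⟨hd, p, hp, hpx⟩ := inner x hx
      rw [hU, hV, ← hpx]
      exact ⟨hd, hb.highU p hp, hb.highV p hp, fun y hy => hb.leaf _ (leaf y hy).2 p hp⟩
    have leaf' : ∀ x ∈ leafVertices u L, G.degree x = 1 ∧ G.vertexSum f x < G.vertexSum f u ∧
        G.vertexSum f x < G.vertexSum f v := by
      intro x hx
      rw [hU, hV]
      exact ⟨(leaf x hx).1, hb.leafU _ (leaf x hx).2, hb.leafV _ (leaf x hx).2⟩
    intro x y hxy
    rcases h.mem_cases hall x with rfl | rfl | hx | hx <;>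
      rcases h.mem_cases hall y with rfl | rfl | hy | hy
    · exact absurd rfl hxy
    · exact ⟨hne, hlt⟩
    · have := inner' y hy; omega
    · have := leaf' y hy; omega
    · exact ⟨hne.symm, fun h => by omega⟩
    · exact absurd rfl hxy
    · have := inner' y hy; omega
    · have := leaf' y hy; omega
    · have := inner' x hx; omega
    · have := inner' x hx; omega
    · have h1 := inner' x hx
      have h2 := inner' y hy
      exact ⟨inner_inj x hx y hy hxy, fun h => by omega⟩
    · have h1 := inner' x hx
      have h2 := leaf' y hy
      have h3 := h1.2.2.2 y hy
      omega
    · have := leaf' x hx; omega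
    · have := leaf' x hx; omega
    · have h1 := leaf' x hx
      have h2 := inner' y hy
      have h3 := h2.2.2.2 x hx
      omega
    · have h1 := leaf' x hx
      have h2 := leaf' y hy
      exact ⟨leaf_inj x hx y hy hxy, fun h => by omega⟩
  refine ⟨⟨bijOn_of_full (h.toFinset_allEdges hG hall) h.nodup_allEdges
    (labels_labelingOf f ▸ hb.full), fun x y hxy => (key x y hxy).1⟩, fun x y hd => ?_⟩
  exact (key x y (by rintro rfl; omega)).2 hd

/-- A branch vertex has one leg fewer than its degree, so degrees above two give at least two legs
at each end. Unequal degrees call for a plain labeling, equal ones for a balanced one. -/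
lemma isStronglyAntimagic_of_degree_le (hG : G.IsTree) (huv : u ≠ v) (hu : 2 < G.degree u)
    (hv : 2 < G.degree v) (hvu : G.degree v ≤ G.degree u)
    (hdeg : ∀ x, 2 < G.degree x → x = u ∨ x = v) : G.IsStronglyAntimagic := by
  obtain ⟨C, hC⟩ := exists_isDecomp hG.connected huv
  obtain ⟨L, h, hall⟩ := hC.exists_spanning hG.connected hdeg
  have hdu := h.degree_left hG hall
  have hdv := h.degree_right hG hall
  have h0 : ∀ (P : V × List V → Prop) [DecidablePred P],
      0 ∉ ((L : Multiset (V × List V)).filter P).map fun p => p.2.length := by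
    intro P _ h0
    obtain ⟨p, hp, hp0⟩ := Multiset.mem_map.1 h0
    exact h.ne_nil p (Multiset.mem_of_mem_filter hp) (List.eq_nil_of_length_eq_zero hp0)
  rcases hvu.lt_or_eq with hlt | heq
  · obtain ⟨τ, D, hD, hs⟩ := hasPlain (by rw [Multiset.card_map, Multiset.card_map]; omega)
      (by rw [Multiset.card_map]; omega) (h0 (·.1 = u)) (h0 (¬ ·.1 = u)) (Nat.succ_ne_zero C.length)
    obtain ⟨f, rfl⟩ := h.exists_labelingOf_eq hs
    exact ⟨f, h.isStronglyAntimagicLabeling hG hall hu hv hvu hD.balanced fun _ => hD.lt⟩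
  · obtain ⟨D, hD, hs⟩ := hasBalanced (by rw [Multiset.card_map, Multiset.card_map]; omega)
      (by rw [Multiset.card_map]; omega) (h0 (·.1 = u)) (h0 (¬ ·.1 = u)) (Nat.succ_ne_zero C.length)
    obtain ⟨f, rfl⟩ := h.exists_labelingOf_eq hs
    exact ⟨f, h.isStronglyAntimagicLabeling hG hall hu hv hvu hD fun h => by omega⟩

end DoubleSpider

theorem mainTheorem2 {V : Type*} [Fintype V] [DecidableEq V] (G : SimpleGraph V)
    [DecidableRel G.Adj] (hG : G.IsDoubleSpider) : G.IsStronglyAntimagic := by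
  obtain ⟨hT, hcard⟩ := hG
  obtain ⟨u, v, huv, hs⟩ := Finset.card_eq_two.1 hcard
  have hiff : ∀ x, 2 < G.degree x ↔ x = u ∨ x = v := fun x => by
    simpa using Finset.ext_iff.1 hs x
  have hu := (hiff u).2 (.inl rfl)
  have hv := (hiff v).2 (.inr rfl)
  rcases le_total (G.degree v) (G.degree u) with h | h
  · exact DoubleSpider.isStronglyAntimagic_of_degree_le hT huv hu hv h fun x hx => (hiff x).1 hx
  · exact DoubleSpider.isStronglyAntimagic_of_degree_le hT huv.symm hv hu h
      fun x hx => ((hiff x).1 hx).symm
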